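/- \textbf{Second order equivalence of ensembles.} Let $V:\mathbb R\to\mathbb R$ satisfy $V=\varphi+\psi$, where $\varphi\in C^2(\mathbb R)$ with $\varphi''(x)\in[1/c,c]$ for all $x$ and some $c>0$, and where $\psi\in C^2(\mathbb R)$ is bounded together with $\psi'$ and $\psi''$. For $\lambda\in\mathbb R$ put $$Z_\lambda=\int_{\mathbb R}e^{\lambda u-V(u)}\,du,\qquad p_\lambda(u)=\frac{e^{\lambda u-V(u)}}{Z_\lambda},\qquad \mu_\lambda(du)=\prod_{j\in\mathbb Z}p_\lambda(u(j))\,du(j)\ \text{ on }\mathbb R^{\mathbb Z},$$ and write $E_\lambda$, $\mathrm{var}_\lambda$ for expectation and variance under $\mu_\lambda$. Let $\rho(\lambda)=\log Z_\lambda$, so that $\rho'(\lambda)=\int u\,p_\lambda(u)\,du$, let $\sigma_\lambda^2=\int(u-\rho'(\lambda))^2p_\lambda(u)\,du$, and let $h(x)=\sup_{\lambda}(\lambda x-\rho(\lambda))$ be the Legendre transform of $\rho$ (so $h'$ is the inverse function of $\rho'$). For $N\ge1$ write $\bar u^N=\frac1N\sum_{k=0}^{N-1}u(k)$ and, given $\lambda_0\in\mathbb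 R$ and $F:\mathbb R^{\mathbb Z}\to\mathbb R$, $$\psi_F(N,r)=E_{\lambda_0}[F\mid\bar u^N=r],\qquad \varphi_F(r)=E_{h'(r)}[F].$$ There is a constant $C>0$ depending only on $V$ such that for all $\lambda_0\in\mathbb R$, all integers $N\ge1$ and $0\le\ell\le N/2$, and all $F$ that depend only on $u(0),\dots,u(\ell-1)$ and satisfy $F\in L^2(\mu_\lambda)$ for all $\lambda\in\mathbb R$: the function $\varphi_F$ is twice continuously differentiable on $\mathbb R$, and $$E_{\lambda_0}\Big[\Big|\psi_F(N,\bar u^N)-\varphi_F(\rho'(\lambda_0))-\varphi_F'(\rho'(\lambda_0))\big(\bar u^N-\rho'(\lambda_0)\big)-\tfrac12\varphi_F''(\rho'(\lambda_0))\Big(\big(\bar u^N-\rho'(\lambda_0)\big)^2-\tfrac{\sigma_{\lambda_0}^2}{N}\Big)\Big|^2\Big]\le C\Big(\frac{\ell}{N}\Big)^3\sup_{\lambda\in\mathbb R}\mathrm{var}_\lambda(F),$$ where the supremum may be $+\infty$ (and $0\cdot\infty=0$). -/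

import Mathlib

open MeasureTheory ProbabilityTheory
open scoped ENNReal

namespace GinzburgLandau

/-- Assumption (V) on the potential: `V = φ + ψ` where `φ` is `C²` with `φ''` bounded between two
positive constants `1/C` and `C`, and where `ψ` is `C²` and bounded together with its derivatives
of order one and two. -/
def AssumptionV (V : ℝ → ℝ) : Prop :=
  ∃ φ ψ : ℝ → ℝ, (∀ x, V x = φ x + ψ x) ∧
    ContDiff ℝ 2 φ ∧
    (∃ C : ℝ, 0 < C ∧ ∀ x, 1 / C ≤ iteratedDeriv 2 φ x ∧ iteratedDeriv 2 φ x ≤ C) ∧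
    ContDiff ℝ 2 ψ ∧
    (∃ M : ℝ, ∀ k : ℕ, k ≤ 2 → ∀ x, |iteratedDeriv k ψ x| ≤ M)

/-- The single-site measure `p_λ(u) du = Z_λ⁻¹ exp (λ u - V u) du` on `ℝ`. -/
noncomputable def siteMeasure (V : ℝ → ℝ) (lam : ℝ) : Measure ℝ :=
  (volume : Measure ℝ).tilted (fun u => lam * u - V u)

/-- The stationary measure `μ_λ = ∏_{j ∈ ℤ} p_λ(u(j)) du(j)` on `ℝ^ℤ`. -/
noncomputable def stationaryMeasure (V : ℝ → ℝ) (lam : ℝ) : Measure (ℤ → ℝ) :=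
  Measure.infinitePi (fun _ : ℤ => siteMeasure V lam)

instance (V : ℝ → ℝ) (lam : ℝ) : IsFiniteMeasure (stationaryMeasure V lam) := by
  unfold stationaryMeasure
  by_cases h : IsProbabilityMeasure (siteMeasure V lam)
  · infer_instance
  · rw [Measure.infinitePi, dif_neg (fun h' => h (h' 0))]
    infer_instance

/-- The logarithmic partition function
`ρ(λ) = log Z_λ = log ∫ exp (λ u - V u) du`. -/
noncomputable def logPartition (V : ℝ → ℝ) (lam : ℝ) : ℝ :=
  Real.log (∫ u : ℝ, Real.exp (lam * u - V u))

/-- The mean `ρ'(λ) = ∫ u p_λ(u) du` of a coordinate under `μ_λ`. -/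
noncomputable def meanSpin (V : ℝ → ℝ) (lam : ℝ) : ℝ :=
  ∫ u, u ∂(siteMeasure V lam)

/-- The variance `σ_λ² = ∫ (u - ρ'(λ))² p_λ(u) du` of a coordinate under `μ_λ`. -/
noncomputable def sigmaSq (V : ℝ → ℝ) (lam : ℝ) : ℝ :=
  ∫ u, (u - meanSpin V lam) ^ 2 ∂(siteMeasure V lam)

/-- The Legendre transform `h(x) = sup_λ (λ x - ρ(λ))` of `ρ`. -/
noncomputable def legendre (V : ℝ → ℝ) (x : ℝ) : ℝ :=
  ⨆ lam : ℝ, (lam * x - logPartition V lam)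

/-- The spatial average `ū^N = N⁻¹ ∑_{k=0}^{N-1} u(k)`. -/
noncomputable def spatialAverage (N : ℕ) (u : ℤ → ℝ) : ℝ :=
  (∑ k ∈ Finset.range N, u (k : ℤ)) / (N : ℝ)

/-- The canonical expectation `ψ_F(N, ρ) = E_{λ₀}[F | ū^N = ρ]`, the integral of `F` against the
regular conditional distribution of `u` given `ū^N = ρ` under `μ_{λ₀}`. -/
noncomputable def canonicalExp (V : ℝ → ℝ) (lam0 : ℝ) (F : (ℤ → ℝ) → ℝ) (N : ℕ) (r : ℝ) : ℝ :=
  ∫ u, F u ∂(condDistrib id (spatialAverage N) (stationaryMeasure V lam0) r)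

/-- The grand canonical expectation `φ_F(ρ) = E_{h'(ρ)}[F]`. -/
noncomputable def grandCanonicalExp (V : ℝ → ℝ) (F : (ℤ → ℝ) → ℝ) (r : ℝ) : ℝ :=
  ∫ u, F u ∂(stationaryMeasure V (deriv (legendre V) r))

end GinzburgLandau

/-! The error is a function `d` of the average X = ū^N, so its L² norm is the supremum of E[d(X)
g(X)] / ‖g(X)‖ over smooth compactly supported `g`. In such a pairing E[F | X] may be replaced by F.
Put m, v, κ₃ for the mean, variance and third central moment of a spin, S_ℓ and S_N for the sums of
the first ℓ and N spins, and θ = F - E F. After rescaling `g` to a function g₀ of S_N, the claim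
bounds E[θ g₀(S_N)] minus multiples of E₁ = E[(S_N - Nm) g₀(S_N)] and E₂ = E[((S_N - Nm)² - Nv)
g₀(S_N)].

Since θ depends on the first ℓ spins only, g₀(S_N) may be averaged over the other N - ℓ spins, which
leaves a smoothed function of S_ℓ. Remove from it its mean, its linear part M₁(S_ℓ - ℓm) and its
quadratic part (M₂/2)((S_ℓ - ℓm)² - ℓv), where M_i = E[g₀^(i)(S_N)]. Three Poincaré inequalities for
S_ℓ (constant of order ℓ) bound the remainder by ℓ³ times the mean square of the smoothed third
derivative. Each derivative is then removed by a Fisher information bound for the sum of a third of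
the remaining spins, at the price of a factor of order 1/N. The square of the remainder is thus at
most C(ℓ/N)³ E[g₀²] (`remainder_bound`, `expansion_bound`), and no local limit theorem is needed.
Both inequalities are additive under convolution (`Poincare.conv`, `FisherBound.conv`).

This leaves M₁b₁ + (M₂/2)b₂ with b₁ = E[θ(S_ℓ - ℓm)] and b₂ = E[θ((S_ℓ - ℓm)² - ℓv)]. The same
expansion, applied to single spins and to pairs and then summed, expresses E₁ and E₂ through M₁ and
M₂; `combination_bound` eliminates M₁ and M₂. The resulting coefficients b₁/v and (b₂ - b₁κ₃/v)/v²
are exactly the first two derivatives of the grand canonical expectation, by the chain rule through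
the inverse of the mean spin (`grandCanonicalExp_derivs`).

Uniformity in λ holds because tilting adds only a linear term to the potential: the Fisher bound
follows from integration by parts and an upper bound for V'', the Poincaré inequality from convexity
of φ and boundedness of ψ (`exists_regular`). -/

namespace GinzburgLandau

/-! ### Polynomial growth, test functions and smoothing by a measure -/

/-- Functions on the line of at most polynomial growth. -/
def PolyBdd (f : ℝ → ℝ) : Prop :=
  ∃ (C : ℝ) (n : ℕ), 0 ≤ C ∧ ∀ x, |f x| ≤ C * (1 + |x|) ^ n

theorem PolyBdd.mul {f g : ℝ → ℝ} (hf : PolyBdd f) (hg : PolyBdd g) :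
    PolyBdd (fun x => f x * g x) := by
  obtain ⟨C, n, hC, hf⟩ := hf
  obtain ⟨D, m, hD, hg⟩ := hg
  refine ⟨C * D, n + m, by positivity, fun x => ?_⟩
  rw [abs_mul, pow_add]
  calc |f x| * |g x| ≤ (C * (1 + |x|) ^ n) * (D * (1 + |x|) ^ m) :=
        mul_le_mul (hf x) (hg x) (abs_nonneg _) (by positivity)
    _ = _ := by ring

theorem PolyBdd.add {f g : ℝ → ℝ} (hf : PolyBdd f) (hg : PolyBdd g) :
    PolyBdd (fun x => f x + g x) := by
  obtain ⟨C, n, hC, hf⟩ := hf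
  obtain ⟨D, m, hD, hg⟩ := hg
  refine ⟨C + D, n + m, by positivity, fun x => ?_⟩
  have h1 : (1 : ℝ) ≤ 1 + |x| := by linarith [abs_nonneg x]
  have h2 : (1 + |x|) ^ n ≤ (1 + |x|) ^ (n + m) := pow_le_pow_right₀ h1 (by omega)
  have h3 : (1 + |x|) ^ m ≤ (1 + |x|) ^ (n + m) := pow_le_pow_right₀ h1 (by omega)
  calc |f x + g x| ≤ |f x| + |g x| := abs_add_le _ _
    _ ≤ C * (1 + |x|) ^ (n + m) + D * (1 + |x|) ^ (n + m) :=
        add_le_add ((hf x).trans (by gcongr)) ((hg x).trans (by gcongr))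
    _ = _ := by ring

theorem PolyBdd.const (c : ℝ) : PolyBdd (fun _ => c) :=
  ⟨|c|, 0, abs_nonneg _, fun x => by simp⟩

theorem PolyBdd.id : PolyBdd (fun x => x) :=
  ⟨1, 1, zero_le_one, fun x => by simp⟩

theorem PolyBdd.of_le {f : ℝ → ℝ} {C : ℝ} {n : ℕ} (h : ∀ x, |f x| ≤ C * (1 + |x|) ^ n) :
    PolyBdd f :=
  ⟨|C|, n, abs_nonneg _, fun x => (h x).trans (by gcongr; exact le_abs_self C)⟩

theorem PolyBdd.neg {f : ℝ → ℝ} (hf : PolyBdd f) : PolyBdd (fun x => - f x) := by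
  simpa using (PolyBdd.const (-1)).mul hf

theorem PolyBdd.sub {f g : ℝ → ℝ} (hf : PolyBdd f) (hg : PolyBdd g) :
    PolyBdd (fun x => f x - g x) := by
  simpa [sub_eq_add_neg] using hf.add hg.neg

theorem PolyBdd.pow {f : ℝ → ℝ} (hf : PolyBdd f) (k : ℕ) : PolyBdd (fun x => f x ^ k) := by
  induction k with
  | zero => simpa using PolyBdd.const 1
  | succ k ih => simpa [pow_succ] using ih.mul hf

theorem one_add_abs_add_pow_le (x y : ℝ) (n : ℕ) :
    (1 + |x + y|) ^ n ≤ (1 + |x|) ^ n * (1 + |y|) ^ n := by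
  rw [← mul_pow]
  refine pow_le_pow_left₀ (by positivity) ?_ n
  nlinarith [abs_add_le x y, mul_nonneg (abs_nonneg x) (abs_nonneg y)]

theorem PolyBdd.comp_add {f : ℝ → ℝ} (hf : PolyBdd f) (y : ℝ) : PolyBdd (fun x => f (x + y)) := by
  obtain ⟨C, n, hC, hf⟩ := hf
  refine ⟨C * (1 + |y|) ^ n, n, by positivity, fun x => (hf _).trans ?_⟩
  have := one_add_abs_add_pow_le x y n
  calc C * (1 + |x + y|) ^ n ≤ C * ((1 + |x|) ^ n * (1 + |y|) ^ n) := by gcongr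
    _ = _ := by ring

/-- Finiteness of all polynomial moments. -/
def PolyInt (μ : Measure ℝ) : Prop := ∀ n : ℕ, Integrable (fun x : ℝ => (1 + |x|) ^ n) μ

theorem PolyInt.integrable {μ : Measure ℝ} (hμ : PolyInt μ) {f : ℝ → ℝ} (hf : PolyBdd f)
    (hc : Continuous f) : Integrable f μ := by
  obtain ⟨C, n, hC, hf⟩ := hf
  refine ((hμ n).const_mul C).mono' hc.aestronglyMeasurable (ae_of_all _ fun x => ?_)
  simpa using hf x

/-- A continuously differentiable function which, together with its derivative, has polynomial
growth. -/
structure Test (g g' : ℝ → ℝ) : Prop where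
  hasDerivAt : ∀ x, HasDerivAt g (g' x) x
  cont_deriv : Continuous g'
  growth : PolyBdd g
  growth_deriv : PolyBdd g'

theorem Test.cont {g g' : ℝ → ℝ} (h : Test g g') : Continuous g :=
  continuous_iff_continuousAt.2 fun x => (h.hasDerivAt x).continuousAt

theorem Test.mul {f f' g g' : ℝ → ℝ} (hf : Test f f') (hg : Test g g') :
    Test (fun x => f x * g x) (fun x => f' x * g x + f x * g' x) :=
  ⟨fun x => (hf.1 x).mul (hg.1 x), (hf.2.mul hg.cont).add (hf.cont.mul hg.2), hf.3.mul hg.3,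
    (hf.4.mul hg.3).add (hf.3.mul hg.4)⟩

theorem Test.const (c : ℝ) : Test (fun _ => c) (fun _ => 0) :=
  ⟨fun x => hasDerivAt_const x c, continuous_const, .const c, .const 0⟩

theorem Test.id : Test (fun x => x) (fun _ => 1) :=
  ⟨fun x => hasDerivAt_id x, continuous_const, .id, .const 1⟩

theorem Test.sub {f f' g g' : ℝ → ℝ} (hf : Test f f') (hg : Test g g') :
    Test (fun x => f x - g x) (fun x => f' x - g' x) :=
  ⟨fun x => (hf.1 x).sub (hg.1 x), hf.2.sub hg.2, hf.3.sub hg.3, hf.4.sub hg.4⟩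

theorem Test.comp_add {g g' : ℝ → ℝ} (h : Test g g') (y : ℝ) :
    Test (fun x => g (x + y)) (fun x => g' (x + y)) :=
  ⟨fun x => (h.1 (x + y)).comp_add_const x y, h.2.comp (continuous_id.add continuous_const),
    h.3.comp_add y, h.4.comp_add y⟩

theorem Test.add_comp {g g' : ℝ → ℝ} (h : Test g g') (y : ℝ) :
    Test (fun x => g (y + x)) (fun x => g' (y + x)) := by
  simpa only [add_comm] using h.comp_add y

theorem Test.congr {f f' g g' : ℝ → ℝ} (h : Test f f') (h1 : ∀ x, g x = f x)
    (h2 : ∀ x, g' x = f' x) : Test g g' := by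
  obtain rfl : g = f := funext h1
  obtain rfl : g' = f' := funext h2
  exact h

/-- Convolution of a function with (the reflection of) a measure. -/
noncomputable def smooth (μ : Measure ℝ) (g : ℝ → ℝ) (x : ℝ) : ℝ := ∫ t, g (x + t) ∂μ

section smooth
variable {μ ν : Measure ℝ}

theorem PolyBdd.integrable_shift (hμ : PolyInt μ) {g : ℝ → ℝ} (hg : PolyBdd g) (hc : Continuous g)
    (x : ℝ) : Integrable (fun t => g (x + t)) μ := by
  refine hμ.integrable ?_ (by fun_prop)
  simpa only [add_comm] using hg.comp_add x

theorem PolyBdd.smooth (hμ : PolyInt μ) {g : ℝ → ℝ} (hg : PolyBdd g) :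
    PolyBdd (smooth μ g) := by
  obtain ⟨C, n, hC, hg⟩ := hg
  refine PolyBdd.of_le (C := C * ∫ t, (1 + |t|) ^ n ∂μ) (n := n) fun x => ?_
  calc |∫ t, g (x + t) ∂μ| ≤ ∫ t, C * (1 + |x|) ^ n * (1 + |t|) ^ n ∂μ := by
        rw [← Real.norm_eq_abs]
        refine norm_integral_le_of_norm_le ((hμ n).const_mul _) (ae_of_all _ fun t => ?_)
        rw [Real.norm_eq_abs]
        refine (hg _).trans ?_
        rw [mul_assoc]
        exact mul_le_mul_of_nonneg_left (one_add_abs_add_pow_le x t n) hC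
    _ = _ := by rw [integral_const_mul]; ring

theorem continuous_smooth (hμ : PolyInt μ) {g : ℝ → ℝ} (hg : PolyBdd g) (hc : Continuous g) :
    Continuous (smooth μ g) := by
  obtain ⟨C, n, hC, hg⟩ := hg
  refine continuous_iff_continuousAt.2 fun x => ?_
  refine continuousAt_of_dominated (bound := fun t => C * (2 + |x|) ^ n * (1 + |t|) ^ n)
    (.of_forall fun y => (hc.comp (by fun_prop)).aestronglyMeasurable) ?_
    ((hμ n).const_mul _) (ae_of_all _ fun t => (hc.comp (by fun_prop)).continuousAt)
  filter_upwards [Metric.ball_mem_nhds x one_pos] with y hy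
  refine ae_of_all _ fun t => ?_
  rw [Metric.mem_ball, Real.dist_eq] at hy
  have h2 : |y| ≤ 1 + |x| := by
    have := abs_add_le (y - x) x
    rw [sub_add_cancel] at this; linarith
  rw [Real.norm_eq_abs]
  calc |g (y + t)| ≤ C * (1 + |y + t|) ^ n := hg _
    _ ≤ C * ((1 + |y|) ^ n * (1 + |t|) ^ n) := by gcongr; exact one_add_abs_add_pow_le _ _ _
    _ ≤ C * ((2 + |x|) ^ n * (1 + |t|) ^ n) := by gcongr C * (?_ ^ n * _); linarith
    _ = _ := by ring

/-- Smoothing commutes with differentiation; the derivative falls on `g`, so `μ` needs moments only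
and no density. -/
theorem Test.smooth (hμ : PolyInt μ) {g g' : ℝ → ℝ} (h : Test g g') :
    Test (smooth μ g) (smooth μ g') := by
  refine ⟨fun x => ?_, continuous_smooth hμ h.4 h.2, h.3.smooth hμ, h.4.smooth hμ⟩
  obtain ⟨C, n, hC, hg⟩ := h.4
  have hc := h.2
  have hc0 := h.cont
  refine (hasDerivAt_integral_of_dominated_loc_of_deriv_le (F := fun y t => g (y + t))
    (F' := fun y t => g' (y + t)) (Metric.ball_mem_nhds x one_pos)
    (bound := fun t => C * (2 + |x|) ^ n * (1 + |t|) ^ n)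
    (.of_forall fun y => (hc0.comp (by fun_prop)).aestronglyMeasurable)
    (h.3.integrable_shift hμ hc0 x) (hc.comp (by fun_prop)).aestronglyMeasurable
    (ae_of_all _ fun t y hy => ?_) ((hμ n).const_mul _) (ae_of_all _ fun t y _ => ?_)).2
  · rw [Metric.mem_ball, Real.dist_eq] at hy
    have h2 : |y| ≤ 1 + |x| := by
      have := abs_add_le (y - x) x
      rw [sub_add_cancel] at this; linarith
    rw [Real.norm_eq_abs]
    calc |g' (y + t)| ≤ C * (1 + |y + t|) ^ n := hg _
      _ ≤ C * ((1 + |y|) ^ n * (1 + |t|) ^ n) := by gcongr; exact one_add_abs_add_pow_le _ _ _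
      _ ≤ C * ((2 + |x|) ^ n * (1 + |t|) ^ n) := by gcongr C * (?_ ^ n * _); linarith
      _ = _ := by ring
  · exact (h.1 (y + t)).comp_add_const y t

theorem PolyInt.integrable_prod [SFinite μ] [SFinite ν] (hμ : PolyInt μ) (hν : PolyInt ν)
    {g : ℝ → ℝ} (hg : PolyBdd g) (hc : Continuous g) :
    Integrable (fun p : ℝ × ℝ => g (p.1 + p.2)) (μ.prod ν) := by
  obtain ⟨C, n, hC, hg⟩ := hg
  refine (((hμ n).mul_prod (hν n)).const_mul C).mono'
    (hc.comp (by fun_prop)).aestronglyMeasurable (ae_of_all _ fun p => ?_)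
  rw [Real.norm_eq_abs]
  exact (hg _).trans (mul_le_mul_of_nonneg_left (one_add_abs_add_pow_le _ _ n) hC)

theorem PolyInt.conv [SFinite μ] [SFinite ν] (hμ : PolyInt μ) (hν : PolyInt ν) :
    PolyInt (μ ∗ ν) := by
  intro n
  have hc : Continuous fun x : ℝ => (1 + |x|) ^ n := by fun_prop
  have hg : PolyBdd fun x : ℝ => (1 + |x|) ^ n :=
    ⟨1, n, zero_le_one, fun x => by rw [abs_of_nonneg (by positivity), one_mul]⟩
  rw [Measure.conv, integrable_map_measure hc.aestronglyMeasurable (by fun_prop)]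
  exact hμ.integrable_prod hν hg hc

theorem integral_conv_eq_smooth [SFinite μ] [SFinite ν] (hμ : PolyInt μ) (hν : PolyInt ν)
    {g : ℝ → ℝ} (hg : PolyBdd g) (hc : Continuous g) :
    ∫ x, g x ∂(μ ∗ ν) = ∫ x, smooth ν g x ∂μ :=
  integral_conv ((hμ.conv hν).integrable hg hc)

theorem smooth_conv [SFinite μ] [SFinite ν] (hμ : PolyInt μ) (hν : PolyInt ν)
    {g : ℝ → ℝ} (hg : PolyBdd g) (hc : Continuous g) (x : ℝ) :
    smooth (μ ∗ ν) g x = smooth μ (smooth ν g) x := by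
  have := integral_conv_eq_smooth hμ hν (g := fun t => g (x + t))
    (by simpa only [add_comm] using hg.comp_add x) (by fun_prop)
  simpa only [smooth, add_assoc] using this

end smooth

/-! ### Poincaré and Fisher information inequalities under convolution -/

/-- The Poincaré inequality with constant `K`. -/
def Poincare (μ : Measure ℝ) (K : ℝ) : Prop :=
  ∀ g g' : ℝ → ℝ, Test g g' → ∫ x, (g x - ∫ y, g y ∂μ) ^ 2 ∂μ ≤ K * ∫ x, g' x ^ 2 ∂μ

/-- The Fisher information of `μ` is at most `1 / k`, in weak form. -/
def FisherBound (μ : Measure ℝ) (k : ℝ) : Prop :=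
  ∀ g g' : ℝ → ℝ, Test g g' → k * (∫ x, g' x ∂μ) ^ 2 ≤ ∫ x, g x ^ 2 ∂μ

/-- Translation of the test function turns the integrated bound into a pointwise one, which can be
iterated. -/
theorem FisherBound.smooth_le {ν : Measure ℝ} {k : ℝ} (fν : FisherBound ν k) {g g' : ℝ → ℝ} (h : Test g g')
    (x : ℝ) : k * smooth ν g' x ^ 2 ≤ smooth ν (fun y => g y ^ 2) x :=
  fν _ _ (h.add_comp x)

section ineq
variable {μ ν : Measure ℝ} [IsProbabilityMeasure μ] [IsProbabilityMeasure ν]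

theorem integral_sub_const_sq {Ω : Type*} {mΩ : MeasurableSpace Ω} {P : Measure Ω}
    [IsProbabilityMeasure P] {f : Ω → ℝ} (h1 : Integrable f P)
    (h2 : Integrable (fun x => f x ^ 2) P) (c : ℝ) :
    ∫ x, (f x - c) ^ 2 ∂P = ∫ x, (f x - ∫ y, f y ∂P) ^ 2 ∂P + (∫ x, f x ∂P - c) ^ 2 := by
  have key : ∀ d : ℝ, ∫ x, (f x - d) ^ 2 ∂P = ∫ x, f x ^ 2 ∂P - 2 * d * ∫ x, f x ∂P + d ^ 2 := by
    intro d
    have : ∀ x, (f x - d) ^ 2 = f x ^ 2 - 2 * d * f x + d ^ 2 := fun x => by ring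
    have h3 : Integrable (fun x => 2 * d * f x) P := h1.const_mul _
    have h4 : Integrable (fun x => f x ^ 2 - 2 * d * f x) P := h2.sub h3
    simp_rw [this]
    rw [integral_add h4 (integrable_const _), integral_sub h2 h3, integral_const_mul]
    simp
  rw [key, key]; ring

theorem sq_integral_le {Ω : Type*} {mΩ : MeasurableSpace Ω} {P : Measure Ω}
    [IsProbabilityMeasure P] {f : Ω → ℝ} (h1 : Integrable f P)
    (h2 : Integrable (fun x => f x ^ 2) P) :
    (∫ x, f x ∂P) ^ 2 ≤ ∫ x, f x ^ 2 ∂P := by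
  have := integral_sub_const_sq h1 h2 0
  simp only [sub_zero] at this
  rw [this]
  have : 0 ≤ ∫ x, (f x - ∫ y, f y ∂P) ^ 2 ∂P := integral_nonneg fun _ => sq_nonneg _
  linarith

/-- The variance of g(X+Y) splits into the mean conditional variance given X and the variance of the
conditional mean. The first is controlled by the inequality for `ν`. The second is controlled by the
one for `μ`, since the conditional mean has derivative `smooth ν g'`, whose square Jensen bounds. -/
theorem Poincare.conv {a b : ℝ} (hμ : PolyInt μ) (hν : PolyInt ν) (ha : 0 ≤ a)
    (pμ : Poincare μ a) (pν : Poincare ν b) : Poincare (μ ∗ ν) (a + b) := by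
  intro g g' h
  set m := ∫ y, g y ∂(μ ∗ ν) with hm
  have hs := h.smooth hν
  have hm' : m = ∫ x, smooth ν g x ∂μ := integral_conv_eq_smooth hμ hν h.3 h.cont
  have hgm : Test (fun x => g x - m) g' := (h.sub (.const m)).congr (fun _ => rfl) (by simp)
  have hsq : PolyBdd (fun x => (g x - m) ^ 2) := hgm.3.pow 2
  have hcsq : Continuous (fun x => (g x - m) ^ 2) := hgm.cont.pow 2
  rw [integral_conv_eq_smooth hμ hν hsq hcsq,
    integral_conv_eq_smooth hμ hν (h.4.pow 2) (h.2.pow 2)]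
  have hpt : ∀ x, smooth ν (fun x => (g x - m) ^ 2) x
      ≤ b * smooth ν (fun x => g' x ^ 2) x + (smooth ν g x - m) ^ 2 := by
    intro x
    have hx := h.add_comp x
    have := integral_sub_const_sq (hν.integrable hx.3 hx.cont)
      (hν.integrable (hx.3.pow 2) (hx.cont.pow 2)) m
    have h3 := pν _ _ hx
    simp only [smooth]
    linarith
  have hi1 : Integrable (smooth ν fun x => g' x ^ 2) μ :=
    hμ.integrable ((h.4.pow 2).smooth hν) (continuous_smooth hν (h.4.pow 2) (h.2.pow 2))
  have hi2 : Integrable (fun x => (smooth ν g x - m) ^ 2) μ :=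
    hμ.integrable ((hs.3.sub (.const m)).pow 2) ((hs.cont.sub continuous_const).pow 2)
  have hi3 : Integrable (fun x => smooth ν g' x ^ 2) μ :=
    hμ.integrable (hs.4.pow 2) (hs.2.pow 2)
  calc ∫ x, smooth ν (fun x => (g x - m) ^ 2) x ∂μ
      ≤ ∫ x, (b * smooth ν (fun x => g' x ^ 2) x + (smooth ν g x - m) ^ 2) ∂μ :=
        integral_mono (hμ.integrable (hsq.smooth hν) (continuous_smooth hν hsq hcsq))
          ((hi1.const_mul b).add hi2) hpt
    _ = b * ∫ x, smooth ν (fun x => g' x ^ 2) x ∂μ + ∫ x, (smooth ν g x - m) ^ 2 ∂μ := by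
        rw [integral_add (hi1.const_mul b) hi2, integral_const_mul]
    _ ≤ b * ∫ x, smooth ν (fun x => g' x ^ 2) x ∂μ
        + a * ∫ x, smooth ν (fun x => g' x ^ 2) x ∂μ := by
        gcongr
        rw [hm']
        refine (pμ _ _ hs).trans (mul_le_mul_of_nonneg_left (integral_mono hi3 hi1 fun x => ?_) ha)
        have hx := h.add_comp x
        exact sq_integral_le (hν.integrable hx.4 hx.2) (hν.integrable (hx.4.pow 2) (hx.2.pow 2))
    _ = _ := by ring

/-- This is the superadditivity of inverse Fisher information, in dual form. E[g(X+Y)²] is the mean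
square of E[g | X] plus that of g - E[g | X]. The first piece is at least `a * m ^ 2` by the bound
for `μ`. Averaging the second over X gives a centred function of Y with the same mean derivative
`m`, so it is at least `b * m ^ 2`. -/
theorem FisherBound.conv {a b : ℝ} (hμ : PolyInt μ) (hν : PolyInt ν)
    (fμ : FisherBound μ a) (fν : FisherBound ν b) : FisherBound (μ ∗ ν) (a + b) := by
  intro g g' h
  have hs := h.smooth hν
  have ht := h.smooth hμ
  have hsq : PolyBdd (fun x => g x ^ 2) := h.3.pow 2
  have hcsq : Continuous (fun x => g x ^ 2) := h.cont.pow 2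
  set m := ∫ x, g' x ∂(μ ∗ ν) with hm
  set m0 := ∫ x, smooth ν g x ∂μ with hm0
  have hm1 : m = ∫ x, smooth ν g' x ∂μ := integral_conv_eq_smooth hμ hν h.4 h.2
  have hm2 : m = ∫ x, smooth μ g' x ∂ν := by
    rw [hm, Measure.conv_comm]; exact integral_conv_eq_smooth hν hμ h.4 h.2
  have h1 := fμ _ _ hs
  rw [← hm1] at h1
  have h2 := fν _ _ ((ht.sub (.const m0)).congr (fun _ => rfl) (g' := smooth μ g') (by simp))
  rw [← hm2] at h2
  -- the joint deviation from the conditional mean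
  have hi0 : Integrable (fun p : ℝ × ℝ => g (p.1 + p.2) ^ 2) (μ.prod ν) :=
    hμ.integrable_prod hν hsq hcsq
  have hig : Integrable (fun p : ℝ × ℝ => g (p.1 + p.2)) (μ.prod ν) :=
    hμ.integrable_prod hν h.3 h.cont
  have his : Integrable (smooth ν g) μ := hμ.integrable hs.3 hs.cont
  have his2 : Integrable (fun x => smooth ν g x ^ 2) μ := hμ.integrable (hs.3.pow 2) (hs.cont.pow 2)
  have hmeas : AEStronglyMeasurable (fun p : ℝ × ℝ => smooth ν g p.1) (μ.prod ν) :=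
    (hs.cont.comp continuous_fst).aestronglyMeasurable
  have hcg := h.cont
  have hcs := hs.cont
  have hL : MemLp (fun p : ℝ × ℝ => g (p.1 + p.2) - smooth ν g p.1) 2 (μ.prod ν) := by
    refine MemLp.sub ?_ ?_
    · exact (memLp_two_iff_integrable_sq hig.aestronglyMeasurable).2 hi0
    · exact (memLp_two_iff_integrable_sq hmeas).2 (his2.comp_fst ν)
  have hi1 : Integrable (fun p : ℝ × ℝ => (g (p.1 + p.2) - smooth ν g p.1) ^ 2) (μ.prod ν) :=
    hL.integrable_sq
  have hid : Integrable (fun p : ℝ × ℝ => g (p.1 + p.2) - smooth ν g p.1) (μ.prod ν) :=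
    hL.integrable (by norm_num)
  have e1 : ∫ x, smooth ν (fun y => g y ^ 2) x ∂μ
      = ∫ x, ∫ t, (g (x + t) - smooth ν g x) ^ 2 ∂ν ∂μ + ∫ x, smooth ν g x ^ 2 ∂μ := by
    rw [← integral_add hi1.integral_prod_left his2]
    refine integral_congr_ae (ae_of_all _ fun x => ?_)
    have hx := h.add_comp x
    have := integral_sub_const_sq (hν.integrable hx.3 hx.cont)
      (hν.integrable (hx.3.pow 2) (hx.cont.pow 2)) 0
    simpa [smooth] using this
  -- Jensen in the `x` variable, after exchanging the order of integration.
  have e2 : ∫ t, (smooth μ g t - m0) ^ 2 ∂ν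
      ≤ ∫ x, ∫ t, (g (x + t) - smooth ν g x) ^ 2 ∂ν ∂μ := by
    rw [integral_integral_swap (f := fun x t => (g (x + t) - smooth ν g x) ^ 2) hi1]
    refine integral_mono_of_nonneg (ae_of_all _ fun t => sq_nonneg _) hi1.integral_prod_right
      (ae_of_all _ fun t => ?_)
    have hit : Integrable (fun x => g (x + t)) μ :=
      hμ.integrable (h.comp_add t).3 (h.comp_add t).cont
    have hp : PolyBdd fun x => g (x + t) - smooth ν g x := (h.comp_add t).3.sub hs.3
    have hcp : Continuous fun x => g (x + t) - smooth ν g x := by fun_prop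
    have := sq_integral_le (hμ.integrable hp hcp) (hμ.integrable (hp.pow 2) (hcp.pow 2))
    rw [integral_sub hit his] at this
    simpa only [smooth, add_comm, hm0] using this
  rw [integral_conv_eq_smooth hμ hν hsq hcsq, e1]
  linarith

end ineq

/-! ### Laws of sums of independent variables -/

/-- The law of a sum of `n` independent variables of law `μ`. -/
noncomputable def sumLaw (μ : Measure ℝ) : ℕ → Measure ℝ
  | 0 => Measure.dirac 0
  | n + 1 => sumLaw μ n ∗ μ

section sumLaw
variable {μ : Measure ℝ} [IsProbabilityMeasure μ]

instance isProbabilityMeasure_sumLaw (n : ℕ) : IsProbabilityMeasure (sumLaw μ n) := by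
  induction n with
  | zero => exact inferInstanceAs (IsProbabilityMeasure (Measure.dirac 0))
  | succ n ih => exact inferInstanceAs (IsProbabilityMeasure (sumLaw μ n ∗ μ))

theorem sumLaw_one : sumLaw μ 1 = μ := by simp [sumLaw]

theorem sumLaw_add (m n : ℕ) : sumLaw μ (m + n) = sumLaw μ m ∗ sumLaw μ n := by
  induction n with
  | zero => simp [sumLaw]
  | succ n ih => rw [← add_assoc, sumLaw, ih, sumLaw, Measure.conv_assoc]

theorem polyInt_sumLaw (hμ : PolyInt μ) (n : ℕ) : PolyInt (sumLaw μ n) := by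
  induction n with
  | zero => intro k; exact integrable_dirac (by simp)
  | succ n ih => exact ih.conv hμ

theorem Poincare.sumLaw {K : ℝ} (hμ : PolyInt μ) (hK : 0 ≤ K) (h : Poincare μ K) (n : ℕ) :
    Poincare (sumLaw μ n) (n * K) := by
  induction n with
  | zero => intro g g' _; simp [GinzburgLandau.sumLaw]
  | succ n ih =>
    have := ih.conv (polyInt_sumLaw hμ n) hμ (by positivity) h
    rwa [← add_one_mul, ← Nat.cast_succ] at this

theorem FisherBound.sumLaw {k : ℝ} (hμ : PolyInt μ) (h : FisherBound μ k) (n : ℕ) :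
    FisherBound (sumLaw μ n) (n * k) := by
  induction n with
  | zero => intro g g' _; simpa using integral_nonneg fun _ => sq_nonneg _
  | succ n ih =>
    have := ih.conv (polyInt_sumLaw hμ n) hμ h
    rwa [← add_one_mul, ← Nat.cast_succ] at this

/-- The mean of the law `μ`. -/
noncomputable def mean1 (μ : Measure ℝ) : ℝ := ∫ x, x ∂μ

/-- The variance of the law `μ`. -/
noncomputable def var1 (μ : Measure ℝ) : ℝ := ∫ x, (x - mean1 μ) ^ 2 ∂μ

theorem integral_sub_sumLaw (hμ : PolyInt μ) (n : ℕ) :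
    ∫ x, (x - n * mean1 μ) ∂(sumLaw μ n) = 0 := by
  induction n with
  | zero => simp [sumLaw]
  | succ n ih =>
    have hn := polyInt_sumLaw hμ n
    have i1 := hμ.integrable .id continuous_id
    have ht := Test.id.sub (.const ((n + 1 : ℕ) * mean1 μ))
    rw [sumLaw, integral_conv_eq_smooth hn hμ ht.3 ht.cont, ← ih]
    refine integral_congr_ae (ae_of_all _ fun x => ?_)
    have i3 : Integrable (fun t => x + t) μ := (integrable_const _).add i1
    simp only [smooth]
    rw [integral_sub i3 (integrable_const _), integral_add (integrable_const _) i1]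
    simp [mean1]; ring

theorem integral_sub_sq_sumLaw (hμ : PolyInt μ) (n : ℕ) :
    ∫ x, (x - n * mean1 μ) ^ 2 ∂(sumLaw μ n) = n * var1 μ := by
  induction n with
  | zero => simp [sumLaw]
  | succ n ih =>
    have hn := polyInt_sumLaw hμ n
    have i1 := hμ.integrable .id continuous_id
    have i2 := hμ.integrable (PolyBdd.id.pow 2) (continuous_id.pow 2)
    have ht := Test.id.sub (.const ((n + 1 : ℕ) * mean1 μ))
    have hn1 := Test.id.sub (.const (n * mean1 μ))
    rw [sumLaw, integral_conv_eq_smooth hn hμ (ht.3.pow 2) (ht.cont.pow 2)]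
    have : ∀ x, smooth μ (fun x => (x - (n + 1 : ℕ) * mean1 μ) ^ 2) x
        = (x - n * mean1 μ) ^ 2 + var1 μ := by
      intro x
      have e := integral_sub_const_sq i1 i2 ((n + 1 : ℕ) * mean1 μ - x)
      simp only [smooth, var1, mean1] at *
      rw [show ∫ t, (x + t - (n + 1 : ℕ) * ∫ x, x ∂μ) ^ 2 ∂μ
        = ∫ t, (t - ((n + 1 : ℕ) * ∫ x, x ∂μ - x)) ^ 2 ∂μ by congr 1; ext t; ring, e]
      push_cast; ring
    simp_rw [this]
    rw [integral_add (hn.integrable (hn1.3.pow 2) (hn1.cont.pow 2)) (integrable_const _), ih]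
    simp; ring

end sumLaw

/-! ### Iterating the two inequalities -/

theorem Test.sq {g g' : ℝ → ℝ} (h : Test g g') : Test (fun x => g x ^ 2) (fun x => 2 * g x * g' x) :=
  (h.mul h).congr (fun x => by ring) (fun x => by ring)

theorem Test.const_mul {g g' : ℝ → ℝ} (h : Test g g') (c : ℝ) :
    Test (fun x => c * g x) (fun x => c * g' x) :=
  ((Test.const c).mul h).congr (fun x => by ring) (fun x => by ring)

/-- Iterating the Poincaré inequality bounds the distance of a function to the quadratic
polynomials. -/
theorem Poincare.quadratic_approx {μ : Measure ℝ} [IsProbabilityMeasure μ] {K : ℝ}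
    (hμ : PolyInt μ) (pμ : Poincare μ K) (hK : 0 ≤ K) {g0 g1 g2 g3 : ℝ → ℝ} (h0 : Test g0 g1)
    (h1 : Test g1 g2) (h2 : Test g2 g3) {a v : ℝ} (ha : ∫ x, (x - a) ∂μ = 0)
    (hv : ∫ x, (x - a) ^ 2 ∂μ = v) :
    ∫ x, (g0 x - ∫ y, g0 y ∂μ - (∫ y, g1 y ∂μ) * (x - a)
      - (∫ y, g2 y ∂μ) / 2 * ((x - a) ^ 2 - v)) ^ 2 ∂μ ≤ K ^ 3 * ∫ x, g3 x ^ 2 ∂μ := by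
  set m0 := ∫ y, g0 y ∂μ
  set m1 := ∫ y, g1 y ∂μ
  set m2 := ∫ y, g2 y ∂μ
  have hx : Test (fun x => x - a) (fun _ => 1) := (Test.id.sub (.const a)).congr (fun _ => rfl)
    (by simp)
  have t2 : Test (fun x => g2 x - m2) g3 := (h2.sub (.const m2)).congr (fun _ => rfl) (by simp)
  have t1 : Test (fun x => g1 x - m1 - m2 * (x - a)) (fun x => g2 x - m2) :=
    ((h1.sub (.const m1)).sub (hx.const_mul m2)).congr (fun _ => rfl) (by simp)
  have t0 : Test (fun x => g0 x - m0 - m1 * (x - a) - m2 / 2 * ((x - a) ^ 2 - v))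
      (fun x => g1 x - m1 - m2 * (x - a)) :=
    (((h0.sub (.const m0)).sub (hx.const_mul m1)).sub
      ((hx.sq.sub (.const v)).const_mul (m2 / 2))).congr (fun _ => rfl)
      (fun x => by ring)
  have ix : Integrable (fun x => x - a) μ := hμ.integrable hx.3 hx.cont
  have ix2 : Integrable (fun x => (x - a) ^ 2) μ := hμ.integrable hx.sq.3 hx.sq.cont
  have i1 : Integrable g1 μ := hμ.integrable h1.3 h1.cont
  have i0 : Integrable g0 μ := hμ.integrable h0.3 h0.cont
  -- The polynomial is chosen so that the remainder and its first two derivatives all have mean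
  -- zero; the Poincaré inequality then iterates with no variance term left over.
  have z1 : ∫ x, (g1 x - m1 - m2 * (x - a)) ∂μ = 0 := by
    have j1 : Integrable (fun x => g1 x - m1) μ := i1.sub (integrable_const _)
    rw [integral_sub j1 (ix.const_mul m2), integral_sub i1 (integrable_const _),
      integral_const_mul, ha]
    simp [m1]
  have z0 : ∫ x, (g0 x - m0 - m1 * (x - a) - m2 / 2 * ((x - a) ^ 2 - v)) ∂μ = 0 := by
    have j0 : Integrable (fun x => g0 x - m0) μ := i0.sub (integrable_const _)
    have j1 : Integrable (fun x => g0 x - m0 - m1 * (x - a)) μ := j0.sub (ix.const_mul m1)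
    have j2 : Integrable (fun x => (x - a) ^ 2 - v) μ := ix2.sub (integrable_const _)
    rw [integral_sub j1 (j2.const_mul _), integral_sub j0 (ix.const_mul m1),
      integral_sub i0 (integrable_const _), integral_const_mul, integral_const_mul, ha,
      integral_sub ix2 (integrable_const _), hv]
    simp [m0]
  have p2 := pμ _ _ h2
  have p1 := pμ _ _ t1
  have p0 := pμ _ _ t0
  simp only [z1, z0, sub_zero] at p1 p0
  calc _ ≤ _ := p0
    _ ≤ K * (K * (K * ∫ x, g3 x ^ 2 ∂μ)) := by
      gcongr; exact p1.trans (by gcongr)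
    _ = _ := by ring

theorem smooth_mono {μ : Measure ℝ} (hμ : PolyInt μ) {f g f' g' : ℝ → ℝ} (hf : Test f f')
    (hg : Test g g') (h : ∀ x, f x ≤ g x) (x : ℝ) : smooth μ f x ≤ smooth μ g x :=
  integral_mono (hμ.integrable (hf.add_comp x).3 (hf.add_comp x).cont)
    (hμ.integrable (hg.add_comp x).3 (hg.add_comp x).cont) fun _ => h _

/-- Each of the two independent pieces of the convolution absorbs one derivative: `ν` removes the
inner one, `μ` the outer one. -/
theorem FisherBound.smooth_two {μ ν : Measure ℝ} [IsProbabilityMeasure μ] [IsProbabilityMeasure ν]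
    {a b : ℝ} (hμ : PolyInt μ) (hν : PolyInt ν) (hb : 0 ≤ b) (fμ : FisherBound μ a)
    (fν : FisherBound ν b) {g0 g1 g2 : ℝ → ℝ} (h0 : Test g0 g1) (h1 : Test g1 g2) (x : ℝ) :
    a * b * smooth (μ ∗ ν) g2 x ^ 2 ≤ smooth (μ ∗ ν) (fun y => g0 y ^ 2) x := by
  rw [smooth_conv hμ hν h1.4 h1.2, smooth_conv hμ hν h0.sq.3 h0.sq.cont]
  have e1 := fμ.smooth_le (h1.smooth hν) x
  have e2 : b * smooth μ (fun y => smooth ν g1 y ^ 2) x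
      ≤ smooth μ (smooth ν fun y => g0 y ^ 2) x := by
    rw [smooth, ← integral_const_mul]
    exact smooth_mono hμ ((h1.smooth hν).sq.const_mul b) (h0.sq.smooth hν)
      (fun y => fν.smooth_le h0 y) x
  nlinarith

theorem FisherBound.smooth_three {μ ν τ : Measure ℝ} [IsProbabilityMeasure μ]
    [IsProbabilityMeasure ν] [IsProbabilityMeasure τ]
    {a b c : ℝ} (hμ : PolyInt μ) (hν : PolyInt ν) (hτ : PolyInt τ) (hb : 0 ≤ b)
    (hc : 0 ≤ c) (fμ : FisherBound μ a)
    (fν : FisherBound ν b) (fτ : FisherBound τ c) {g0 g1 g2 g3 : ℝ → ℝ} (h0 : Test g0 g1)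
    (h1 : Test g1 g2) (h2 : Test g2 g3) (x : ℝ) :
    a * b * c * smooth ((μ ∗ ν) ∗ τ) g3 x ^ 2 ≤ smooth ((μ ∗ ν) ∗ τ) (fun y => g0 y ^ 2) x := by
  have hμν := hμ.conv hν
  rw [smooth_conv hμν hτ h2.4 h2.2, smooth_conv hμν hτ h0.sq.3 h0.sq.cont]
  have e1 := smooth_two hμ hν hb fμ fν (h1.smooth hτ) (h2.smooth hτ) x
  have e2 : c * smooth (μ ∗ ν) (fun y => smooth τ g1 y ^ 2) x
      ≤ smooth (μ ∗ ν) (smooth τ fun y => g0 y ^ 2) x := by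
    rw [smooth, ← integral_const_mul]
    exact smooth_mono hμν ((h1.smooth hτ).sq.const_mul c) (h0.sq.smooth hτ)
      (fun y => fτ.smooth_le h0 y) x
  nlinarith

section sums
variable {ν : Measure ℝ} [IsProbabilityMeasure ν] {B : ℝ}

theorem sq_integral_deriv_sumLaw_le (hν : PolyInt ν) (hB : 0 < B) (f : FisherBound ν (1 / B))
    {g0 g1 : ℝ → ℝ} (h0 : Test g0 g1) (N : ℕ) :
    N * (∫ x, g1 x ∂(sumLaw ν N)) ^ 2 ≤ B * ∫ x, g0 x ^ 2 ∂(sumLaw ν N) := by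
  have := f.sumLaw hν N _ _ h0
  rw [mul_one_div, div_mul_eq_mul_div, div_le_iff₀ hB] at this
  linarith

theorem sq_integral_deriv_two_sumLaw_le (hν : PolyInt ν) (hB : 0 < B)
    (f : FisherBound ν (1 / B))
    {g0 g1 g2 : ℝ → ℝ} (h0 : Test g0 g1) (h1 : Test g1 g2) {N : ℕ} (hN : 2 ≤ N) :
    N ^ 2 * (∫ x, g2 x ∂(sumLaw ν N)) ^ 2 ≤ (5 * B) ^ 2 * ∫ x, g0 x ^ 2 ∂(sumLaw ν N) := by
  -- The factor 5 is not sharp for halves; it is the one that the splitting into thirds requires.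
  obtain ⟨a, b, rfl, ha, hb⟩ : ∃ a b, a + b = N ∧ N ≤ 5 * a ∧ N ≤ 5 * b :=
    ⟨N / 2, N - N / 2, by omega, by omega, by omega⟩
  have key := FisherBound.smooth_two (polyInt_sumLaw hν a) (polyInt_sumLaw hν b) (by positivity)
    (f.sumLaw hν a) (f.sumLaw hν b) h0 h1 0
  rw [← sumLaw_add] at key
  simp only [smooth, zero_add] at key
  have ha' : ((a + b : ℕ) : ℝ) ≤ 5 * B * (a * (1 / B)) := by
    rw [show 5 * B * (a * (1 / B)) = 5 * a by field_simp]; exact_mod_cast ha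
  have hb' : ((a + b : ℕ) : ℝ) ≤ 5 * B * (b * (1 / B)) := by
    rw [show 5 * B * (b * (1 / B)) = 5 * b by field_simp]; exact_mod_cast hb
  calc _ ≤ (5 * B * (a * (1 / B))) * (5 * B * (b * (1 / B)))
        * (∫ x, g2 x ∂(sumLaw ν (a + b))) ^ 2 := by
        rw [pow_two]; gcongr
    _ = (5 * B) ^ 2 * (a * (1 / B) * (b * (1 / B)) * (∫ x, g2 x ∂(sumLaw ν (a + b))) ^ 2) := by ring
    _ ≤ _ := by gcongr

/-- The second order remainder in the expansion of `E[g (S_N) | S_ℓ]`. -/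
noncomputable def remainder (ν : Measure ℝ) (ℓ n : ℕ) (g0 g1 g2 : ℝ → ℝ) (x : ℝ) : ℝ :=
  smooth (sumLaw ν n) g0 x - ∫ y, g0 y ∂(sumLaw ν (ℓ + n))
    - (∫ y, g1 y ∂(sumLaw ν (ℓ + n))) * (x - ℓ * mean1 ν)
    - (∫ y, g2 y ∂(sumLaw ν (ℓ + n))) / 2 * ((x - ℓ * mean1 ν) ^ 2 - ℓ * var1 ν)

/-- Three Poincaré inequalities on the block of `ℓ` variables cost `(ℓ * B) ^ 3` and leave a third
derivative smoothed by `n` variables. Cutting these `n` into thirds, one per derivative, gains a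
factor of order `n ^ 3`, which dominates `(ℓ + n) ^ 3` because `ℓ ≤ n`. -/
theorem remainder_bound (hν : PolyInt ν) (hB : 0 < B) (f : FisherBound ν (1 / B))
    (p : Poincare ν B) {g0 g1 g2 g3 : ℝ → ℝ} (h0 : Test g0 g1)
    (h1 : Test g1 g2) (h2 : Test g2 g3) {ℓ n : ℕ} (hn : 3 ≤ n) (hℓ : ℓ ≤ n) :
    ((ℓ + n : ℕ) : ℝ) ^ 3 * ∫ x, remainder ν ℓ n g0 g1 g2 x ^ 2 ∂(sumLaw ν ℓ)
      ≤ (10 * B ^ 2 * ℓ) ^ 3 * ∫ x, g0 x ^ 2 ∂(sumLaw ν (ℓ + n)) := by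
  have il := polyInt_sumLaw hν ℓ
  have iN := polyInt_sumLaw hν n
  have e : ∀ {g g'}, Test g g' → ∫ y, g y ∂(sumLaw ν (ℓ + n))
      = ∫ y, smooth (sumLaw ν n) g y ∂(sumLaw ν ℓ) := fun h => by
    rw [sumLaw_add, integral_conv_eq_smooth il iN h.3 h.cont]
  have q := (p.sumLaw hν hB.le ℓ).quadratic_approx il (by positivity) (h0.smooth iN)
    (h1.smooth iN) (h2.smooth iN) (integral_sub_sumLaw hν ℓ) (integral_sub_sq_sumLaw hν ℓ)
  have hR : ∫ x, remainder ν ℓ n g0 g1 g2 x ^ 2 ∂(sumLaw ν ℓ)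
      ≤ (ℓ * B) ^ 3 * ∫ x, smooth (sumLaw ν n) g3 x ^ 2 ∂(sumLaw ν ℓ) := by
    simpa only [remainder, e h0, e h1, e h2] using q
  obtain ⟨a, b, c, rfl, ha, hb, hc⟩ :
      -- The worst case is `n = 5`, split as 1 + 1 + 3.
      ∃ a b c, a + b + c = n ∧ n ≤ 5 * a ∧ n ≤ 5 * b ∧ n ≤ 5 * c :=
    ⟨n / 3, n / 3, n - 2 * (n / 3), by omega, by omega, by omega, by omega⟩
  have key : ∀ x, ((ℓ + (a + b + c) : ℕ) : ℝ) ^ 3 * smooth (sumLaw ν (a + b + c)) g3 x ^ 2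
      ≤ (10 * B) ^ 3 * smooth (sumLaw ν (a + b + c)) (fun y => g0 y ^ 2) x := by
    intro x
    have key := FisherBound.smooth_three (polyInt_sumLaw hν a) (polyInt_sumLaw hν b)
      (polyInt_sumLaw hν c) (by positivity) (by positivity)
      (f.sumLaw hν a) (f.sumLaw hν b) (f.sumLaw hν c) h0 h1 h2 x
    rw [← sumLaw_add, ← sumLaw_add] at key
    -- Here `ℓ ≤ n` doubles 5 to 10.
    have aux : ∀ d : ℕ, a + b + c ≤ 5 * d →
        ((ℓ + (a + b + c) : ℕ) : ℝ) ≤ 10 * B * (d * (1 / B)) := by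
      intro d hd
      rw [show 10 * B * (d * (1 / B)) = 10 * d by field_simp]
      exact_mod_cast (show ℓ + (a + b + c) ≤ 10 * d by omega)
    calc _ ≤ (10 * B * (a * (1 / B))) * (10 * B * (b * (1 / B))) * (10 * B * (c * (1 / B)))
          * smooth (sumLaw ν (a + b + c)) g3 x ^ 2 := by
          rw [pow_three']
          gcongr
          exacts [aux a ha, aux b hb, aux c hc]
      _ = (10 * B) ^ 3 * (a * (1 / B) * (b * (1 / B)) * (c * (1 / B))
          * smooth (sumLaw ν (a + b + c)) g3 x ^ 2) := by ring
      _ ≤ _ := by gcongr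
  have h3 := h2.smooth iN
  have t0 := h0.sq.smooth iN
  have int : ((ℓ + (a + b + c) : ℕ) : ℝ) ^ 3
        * ∫ x, smooth (sumLaw ν (a + b + c)) g3 x ^ 2 ∂(sumLaw ν ℓ)
      ≤ (10 * B) ^ 3 * ∫ x, g0 x ^ 2 ∂(sumLaw ν (ℓ + (a + b + c))) := by
    rw [e h0.sq, ← integral_const_mul, ← integral_const_mul]
    refine integral_mono ((il.integrable (h3.4.pow 2) (h3.2.pow 2)).const_mul _)
      ((il.integrable t0.3 t0.cont).const_mul _) key
  calc _ ≤ ((ℓ + (a + b + c) : ℕ) : ℝ) ^ 3 * ((ℓ * B) ^ 3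
        * ∫ x, smooth (sumLaw ν (a + b + c)) g3 x ^ 2 ∂(sumLaw ν ℓ)) := by gcongr
    _ = (ℓ * B) ^ 3 * (((ℓ + (a + b + c) : ℕ) : ℝ) ^ 3
        * ∫ x, smooth (sumLaw ν (a + b + c)) g3 x ^ 2 ∂(sumLaw ν ℓ)) := by ring
    _ ≤ (ℓ * B) ^ 3 * ((10 * B) ^ 3 * ∫ x, g0 x ^ 2 ∂(sumLaw ν (ℓ + (a + b + c)))) := by gcongr
    _ = _ := by ring

end sums

/-! ### Product measures: local functions and the total sum -/

theorem sq_integral_mul_le {Ω : Type*} {mΩ : MeasurableSpace Ω} {P : Measure Ω} {f g : Ω → ℝ}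
    (hf : MemLp f 2 P) (hg : MemLp g 2 P) :
    (∫ x, f x * g x ∂P) ^ 2 ≤ (∫ x, f x ^ 2 ∂P) * ∫ x, g x ^ 2 ∂P := by
  have hfg : Integrable (fun x => f x * g x) P := hf.integrable_mul hg
  have key : ∀ t : ℝ, 0 ≤ (∫ x, f x ^ 2 ∂P) * (t * t) + 2 * (∫ x, f x * g x ∂P) * t
      + ∫ x, g x ^ 2 ∂P := by
    intro t
    have h1 : Integrable (fun x => t * t * f x ^ 2) P := hf.integrable_sq.const_mul _
    have h2 : Integrable (fun x => 2 * t * (f x * g x)) P := hfg.const_mul _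
    have h3 : Integrable (fun x => t * t * f x ^ 2 + 2 * t * (f x * g x)) P := h1.add h2
    have : 0 ≤ ∫ x, (t * t * f x ^ 2 + 2 * t * (f x * g x) + g x ^ 2) ∂P :=
      integral_nonneg fun x => by
        show 0 ≤ t * t * f x ^ 2 + 2 * t * (f x * g x) + g x ^ 2
        nlinarith [sq_nonneg (t * f x + g x)]
    rw [integral_add h3 hg.integrable_sq, integral_add h1 h2, integral_const_mul,
      integral_const_mul] at this
    linarith
  have := discrim_le_zero key
  rw [discrim] at this
  linarith

section product
variable (ν : Measure ℝ) [IsProbabilityMeasure ν]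

/-- The sum of the coordinates in `A`. -/
def sumOn (A : Finset ℤ) (u : ℤ → ℝ) : ℝ := ∑ i ∈ A, u i

theorem measurable_sumOn (A : Finset ℤ) : Measurable (sumOn A) := by
  unfold sumOn; fun_prop

theorem iIndepFun_coord :
    iIndepFun (fun (i : ℤ) (u : ℤ → ℝ) => u i) (Measure.infinitePi fun _ : ℤ => ν) :=
  iIndepFun_infinitePi (X := fun _ x => x) (fun _ => measurable_id)

theorem map_sumOn (A : Finset ℤ) :
    (Measure.infinitePi fun _ : ℤ => ν).map (sumOn A) = sumLaw ν A.card := by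
  induction A using Finset.induction_on with
  | empty =>
    have : sumOn ∅ = fun _ => 0 := by ext u; simp [sumOn]
    rw [this, Measure.map_const]; simp [sumLaw]
  | insert j A hj ih =>
    have hind := (iIndepFun_coord ν).indepFun_finsetSum_of_notMem (fun i => measurable_pi_apply i) hj
    have hA : (∑ i ∈ A, fun u : ℤ → ℝ => u i) = sumOn A := by ext u; simp [sumOn]
    rw [hA] at hind
    have : sumOn (insert j A) = sumOn A + fun u => u j := by
      ext u; simp [sumOn, Finset.sum_insert hj, add_comm]
    rw [this, hind.map_add_eq_map_conv_map (measurable_sumOn A) (measurable_pi_apply j), ih,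
      Measure.infinitePi_map_eval, Finset.card_insert_of_notMem hj, sumLaw]

theorem integral_sumOn {g : ℝ → ℝ} (hg : Continuous g) (A : Finset ℤ) :
    ∫ u, g (sumOn A u) ∂(Measure.infinitePi fun _ : ℤ => ν) = ∫ x, g x ∂(sumLaw ν A.card) := by
  rw [← map_sumOn, integral_map (measurable_sumOn A).aemeasurable hg.aestronglyMeasurable]

theorem memLp_sumOn (hν : PolyInt ν) {g : ℝ → ℝ} (hg : Continuous g) (hb : PolyBdd g)
    (A : Finset ℤ) : MemLp (fun u => g (sumOn A u)) 2 (Measure.infinitePi fun _ : ℤ => ν) := by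
  have hm : AEStronglyMeasurable (fun u => g (sumOn A u)) (Measure.infinitePi fun _ : ℤ => ν) :=
    (hg.measurable.comp (measurable_sumOn A)).aestronglyMeasurable
  rw [memLp_two_iff_integrable_sq hm]
  have h : Integrable (fun x => g x ^ 2) (sumLaw ν A.card) :=
    (polyInt_sumLaw hν _).integrable (hb.pow 2) (hg.pow 2)
  rw [← map_sumOn] at h
  exact h.comp_measurable (measurable_sumOn A)

/-- The function `θ` is almost surely equal to a measurable function of the coordinates in `A`. -/
def AEDependsOn (A : Finset ℤ) (θ : (ℤ → ℝ) → ℝ) : Prop :=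
  ∃ f : (A → ℝ) → ℝ, Measurable f ∧
    θ =ᵐ[Measure.infinitePi fun _ : ℤ => ν] fun u => f (A.restrict u)

variable {ν}

/-- The coordinates in `J \ A` are independent of those in `A`, so Fubini integrates them out; their
sum has law `sumLaw ν (J.card - A.card)`. -/
theorem integral_mul_comp_sumOn (hν : PolyInt ν) {A J : Finset ℤ} (hA : A ⊆ J)
    {θ : (ℤ → ℝ) → ℝ} (hθ : AEDependsOn ν A θ) (hθ2 : MemLp θ 2 (Measure.infinitePi fun _ => ν))
    {g : ℝ → ℝ} (hg : Continuous g) (hb : PolyBdd g) :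
    ∫ u, θ u * g (sumOn J u) ∂(Measure.infinitePi fun _ : ℤ => ν)
      = ∫ u, θ u * smooth (sumLaw ν (J.card - A.card)) g (sumOn A u)
        ∂(Measure.infinitePi fun _ : ℤ => ν) := by
  set μ := Measure.infinitePi fun _ : ℤ => ν with hμ
  obtain ⟨f, hf, hθf⟩ := hθ
  have hi : Integrable (fun u => θ u * g (sumOn J u)) μ :=
    hθ2.integrable_mul (memLp_sumOn ν hν hg hb J)
  have hi' : Integrable (fun u => f (A.restrict u) * g (sumOn J u)) μ :=
    hi.congr (hθf.mono fun u hu => by simp only [hu])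
  rw [integral_congr_ae (g := fun u => f (A.restrict u) * g (sumOn J u))
    (hθf.mono fun u hu => by simp only [hu]),
    integral_congr_ae (f := fun u => θ u * _)
      (g := fun u => f (A.restrict u) * smooth (sumLaw ν (J.card - A.card)) g (sumOn A u))
    (hθf.mono fun u hu => by simp only [hu])]
  have hind : IndepFun A.restrict (sumOn (J \ A)) μ := by
    have h := (iIndepFun_coord ν).indepFun_finset A (J \ A) Finset.disjoint_sdiff
      (fun i => measurable_pi_apply i)
    have h2 := h.comp (φ := id) (ψ := fun x => ∑ i, x i) measurable_id (by fun_prop)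
    have e : sumOn (J \ A) = (fun x => ∑ i, x i) ∘ fun (a : ℤ → ℝ) (i : (J \ A : Finset ℤ)) => a i := by
      ext u
      exact (Finset.sum_coe_sort (J \ A) (fun i => u i)).symm
    rw [e]
    exact h2
  have hmap := (indepFun_iff_map_prod_eq_prod_map_map (A.measurable_restrict).aemeasurable
    (measurable_sumOn _).aemeasurable).1 hind
  rw [map_sumOn, Finset.card_sdiff_of_subset hA] at hmap
  set k : (A → ℝ) × ℝ → ℝ := fun p => f p.1 * g ((∑ i, p.1 i) + p.2) with hk
  have hkm : Measurable k := by
    have := hg.measurable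
    fun_prop
  have hsum : ∀ u : ℤ → ℝ, ∑ i, A.restrict u i = sumOn A u := fun u =>
    Finset.sum_coe_sort A (fun i => u i)
  have hpm : Measurable fun u : ℤ → ℝ => (A.restrict u, sumOn (J \ A) u) :=
    (A.measurable_restrict).prodMk (measurable_sumOn _)
  have e1 : ∀ u, f (A.restrict u) * g (sumOn J u) = k (A.restrict u, sumOn (J \ A) u) := by
    intro u
    simp only [hk, hsum]
    congr 2
    simp only [sumOn]
    rw [add_comm, Finset.sum_sdiff hA]
  simp_rw [e1] at hi' ⊢
  rw [← integral_map (f := k) hpm.aemeasurable hkm.aestronglyMeasurable, hmap, integral_prod,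
    integral_map (A.measurable_restrict).aemeasurable]
  · refine integral_congr_ae (ae_of_all _ fun u => ?_)
    simp only [hk, hsum, smooth, integral_const_mul]
  · exact hkm.stronglyMeasurable.integral_prod_right.aestronglyMeasurable
  · rw [← hmap, integrable_map_measure hkm.aestronglyMeasurable hpm.aemeasurable]
    exact hi'

/-- Second order expansion of the correlation between a local function and a function of the
total sum. -/
theorem expansion_bound (hν : PolyInt ν) {B : ℝ} (hB : 0 < B) (fi : FisherBound ν (1 / B))
    (p : Poincare ν B) {g0 g1 g2 g3 : ℝ → ℝ} (h0 : Test g0 g1)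
    (h1 : Test g1 g2) (h2 : Test g2 g3) {A J : Finset ℤ} (hA : A ⊆ J) (hJ : 5 ≤ J.card)
    (hAJ : 2 * A.card ≤ J.card)
    {θ : (ℤ → ℝ) → ℝ} (hθ : AEDependsOn ν A θ) (hθ2 : MemLp θ 2 (Measure.infinitePi fun _ => ν))
    (hθ0 : ∫ u, θ u ∂(Measure.infinitePi fun _ : ℤ => ν) = 0) :
    (∫ u, θ u * g0 (sumOn J u) ∂(Measure.infinitePi fun _ : ℤ => ν)
      - (∫ x, g1 x ∂(sumLaw ν J.card)) * ∫ u, θ u * (sumOn A u - A.card * mean1 ν)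
        ∂(Measure.infinitePi fun _ : ℤ => ν)
      - (∫ x, g2 x ∂(sumLaw ν J.card)) / 2
        * ∫ u, θ u * ((sumOn A u - A.card * mean1 ν) ^ 2 - A.card * var1 ν)
        ∂(Measure.infinitePi fun _ : ℤ => ν)) ^ 2
      ≤ (10 * B ^ 2) ^ 3 * ((A.card : ℝ) / J.card) ^ 3
        * (∫ u, θ u ^ 2 ∂(Measure.infinitePi fun _ : ℤ => ν))
        * ∫ u, g0 (sumOn J u) ^ 2 ∂(Measure.infinitePi fun _ : ℤ => ν) := by
  set μ := Measure.infinitePi fun _ : ℤ => ν with hμ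
  obtain ⟨n, hn⟩ := Nat.exists_eq_add_of_le (Finset.card_le_card hA)
  have hcard : J.card - A.card = n := by omega
  have hR := remainder_bound hν hB fi p h0 h1 h2 (ℓ := A.card) (n := n) (by omega) (by omega)
  have hT : Test (fun x => x - A.card * mean1 ν) (fun _ => 1) :=
    (Test.id.sub (.const _)).congr (fun _ => rfl) (by simp)
  have hT2 := hT.sq.sub (.const (A.card * var1 ν))
  have hs := h0.smooth (polyInt_sumLaw hν n)
  set M0 := ∫ y, g0 y ∂(sumLaw ν (A.card + n))
  set M1 := ∫ y, g1 y ∂(sumLaw ν (A.card + n))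
  set M2 := ∫ y, g2 y ∂(sumLaw ν (A.card + n))
  have hRt : Test (remainder ν A.card n g0 g1 g2) _ :=
    ((hs.sub (.const M0)).sub (hT.const_mul M1)).sub (hT2.const_mul (M2 / 2))
  have m1 := memLp_sumOn ν hν hT.cont hT.3 A
  have m2 := memLp_sumOn ν hν hT2.cont hT2.3 A
  have mR := memLp_sumOn ν hν hRt.cont hRt.3 A
  have mS := memLp_sumOn ν hν hs.cont hs.3 A
  have key : ∫ u, θ u * remainder ν A.card n g0 g1 g2 (sumOn A u) ∂μ
      = ∫ u, θ u * g0 (sumOn J u) ∂μ - M1 * ∫ u, θ u * (sumOn A u - A.card * mean1 ν) ∂μ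
        - M2 / 2 * ∫ u, θ u * ((sumOn A u - A.card * mean1 ν) ^ 2 - A.card * var1 ν) ∂μ := by
    rw [integral_mul_comp_sumOn hν hA hθ hθ2 h0.cont h0.3, hcard]
    have i0 : Integrable (fun u => θ u * smooth (sumLaw ν n) g0 (sumOn A u)) μ :=
      hθ2.integrable_mul mS
    have i1 : Integrable (fun u => M1 * (θ u * (sumOn A u - A.card * mean1 ν))) μ :=
      (hθ2.integrable_mul m1).const_mul M1
    have i2 : Integrable (fun u => M2 / 2 *
        (θ u * ((sumOn A u - A.card * mean1 ν) ^ 2 - A.card * var1 ν))) μ :=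
      (hθ2.integrable_mul m2).const_mul _
    have i3 : Integrable (fun u => M0 * θ u) μ := (hθ2.integrable (by norm_num)).const_mul M0
    have i4 : Integrable (fun u => θ u * smooth (sumLaw ν n) g0 (sumOn A u) - M0 * θ u) μ :=
      i0.sub i3
    have i5 : Integrable (fun u => θ u * smooth (sumLaw ν n) g0 (sumOn A u) - M0 * θ u
        - M1 * (θ u * (sumOn A u - A.card * mean1 ν))) μ := i4.sub i1
    -- Since `θ` is centred, the constant `M0` can be inserted freely; this makes the remainder
    -- appear.
    rw [← integral_const_mul, ← integral_const_mul,
      show (∫ u, θ u * smooth (sumLaw ν n) g0 (sumOn A u) ∂μ)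
        = ∫ u, (θ u * smooth (sumLaw ν n) g0 (sumOn A u) - M0 * θ u) ∂μ by
        rw [integral_sub i0 i3, integral_const_mul, hθ0, mul_zero, sub_zero],
      ← integral_sub i4 i1, ← integral_sub i5 i2]
    refine integral_congr_ae (ae_of_all _ fun u => ?_)
    show θ u * (smooth (sumLaw ν n) g0 (sumOn A u) - M0 - M1 * (sumOn A u - A.card * mean1 ν)
      - M2 / 2 * ((sumOn A u - A.card * mean1 ν) ^ 2 - A.card * var1 ν)) = _
    ring
  rw [hn, ← key]
  have hNpos : (0 : ℝ) < ((A.card + n : ℕ) : ℝ) := by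
    have : 0 < A.card + n := by omega
    exact_mod_cast this
  have e1 := integral_sumOn ν (g := fun x => remainder ν A.card n g0 g1 g2 x ^ 2)
    (hRt.cont.pow 2) A
  have e2 := integral_sumOn ν (g := fun x => g0 x ^ 2) (h0.cont.pow 2) J
  rw [hn] at e2
  refine (sq_integral_mul_le hθ2 mR).trans ?_
  rw [e1, e2]
  have hθn : 0 ≤ ∫ u, θ u ^ 2 ∂μ := integral_nonneg fun _ => sq_nonneg _
  have hR' : ∫ x, remainder ν A.card n g0 g1 g2 x ^ 2 ∂(sumLaw ν A.card)
      ≤ (10 * B ^ 2) ^ 3 * ((A.card : ℝ) / (A.card + n : ℕ)) ^ 3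
        * ∫ x, g0 x ^ 2 ∂(sumLaw ν (A.card + n)) := by
    rw [div_pow, mul_div_assoc', div_mul_eq_mul_div, le_div_iff₀ (pow_pos hNpos 3)]
    calc _ = _ := mul_comm _ _
      _ ≤ _ := hR
      _ = _ := by ring
  calc _ ≤ (∫ u, θ u ^ 2 ∂μ) * _ := mul_le_mul_of_nonneg_left hR' hθn
    _ = _ := by ring

/-- A function of the coordinates in `A` which is almost everywhere strongly measurable on the
infinite product is so on the finite product. -/
theorem aestronglyMeasurable_of_comp_restrict {A : Finset ℤ} {f : (A → ℝ) → ℝ}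
    (hm : AEStronglyMeasurable (fun u => f (A.restrict u)) (Measure.infinitePi fun _ : ℤ => ν)) :
    AEStronglyMeasurable f ((Measure.infinitePi fun _ : ℤ => ν).map A.restrict) := by
  classical
  set μ := Measure.infinitePi fun _ : ℤ => ν with hμ
  -- `Φ` takes the coordinates in `A` from its first argument and the others from an independent
  -- copy. It maps the product law to `μ`, so measurability pulls back to a product space, where
  -- almost every section in the first variable inherits it.
  let Φ : (A → ℝ) × (ℤ → ℝ) → (ℤ → ℝ) := fun p i => if h : i ∈ A then p.1 ⟨i, h⟩ else p.2 i
  have hΦ : Measurable Φ := by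
    refine measurable_pi_lambda _ fun i => ?_
    by_cases h : i ∈ A
    · simp only [Φ, h, dite_true]; fun_prop
    · simp only [Φ, h, dite_false]; fun_prop
  have : IsProbabilityMeasure (μ.map A.restrict) :=
    Measure.isProbabilityMeasure_map (A.measurable_restrict).aemeasurable
  have hmap : ((μ.map A.restrict).prod μ).map Φ = μ := by
    refine Measure.eq_infinitePi _ fun s t ht => ?_
    have hpre : Φ ⁻¹' (Set.pi (s : Set ℤ) t)
        = {x : A → ℝ | ∀ i : A, (i : ℤ) ∈ s → x i ∈ t i} ×ˢ Set.pi ((s \ A : Finset ℤ) : Set ℤ) t := by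
      ext p
      simp only [Set.mem_preimage, Set.mem_pi, Set.mem_prod, Set.mem_ofPred_eq, Finset.mem_coe,
        Finset.mem_sdiff]
      constructor
      · intro h
        refine ⟨fun i hi => ?_, fun i hi => ?_⟩
        · simpa [Φ, i.2] using h i hi
        · simpa [Φ, hi.2] using h i hi.1
      · rintro ⟨h1, h2⟩ i hi
        by_cases hiA : i ∈ A
        · simpa [Φ, hiA] using h1 ⟨i, hiA⟩ hi
        · simpa [Φ, hiA] using h2 i ⟨hi, hiA⟩
    have hms : MeasurableSet {x : A → ℝ | ∀ i : A, (i : ℤ) ∈ s → x i ∈ t i} := by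
      simp only [Set.ofPred_forall]
      exact MeasurableSet.iInter fun i => MeasurableSet.iInter fun _ =>
        (measurable_pi_apply i) (ht i)
    have hpre2 : A.restrict ⁻¹' {x : A → ℝ | ∀ i : A, (i : ℤ) ∈ s → x i ∈ t i}
        = Set.pi ((s ∩ A : Finset ℤ) : Set ℤ) t := by
      ext u
      simp only [Set.mem_preimage, Set.mem_ofPred_eq, Set.mem_pi, Finset.mem_coe, Finset.mem_inter]
      exact ⟨fun h i hi => h ⟨i, hi.2⟩ hi.1, fun h i hi => h i ⟨hi, i.2⟩⟩
    rw [Measure.map_apply hΦ (MeasurableSet.pi s.countable_toSet fun i _ => ht i), hpre,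
      Measure.prod_prod, Measure.map_apply A.measurable_restrict hms, hpre2,
      Measure.infinitePi_pi _ (fun i _ => ht i), Measure.infinitePi_pi _ (fun i _ => ht i),
      Finset.prod_inter_mul_prod_sdiff]
  have h1 : AEStronglyMeasurable ((fun u => f (A.restrict u)) ∘ Φ)
      ((μ.map A.restrict).prod μ) :=
    AEStronglyMeasurable.comp_measurable (by rwa [hmap]) hΦ
  have h2 : (fun u => f (A.restrict u)) ∘ Φ = fun p => f p.1 := by
    ext p
    simp only [Function.comp]
    congr 1
    ext i
    simp [Φ, i.2]
  rw [h2] at h1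
  obtain ⟨y, hy⟩ := h1.prod_swap.prodMk_left.exists
  exact hy

theorem DependsOn.exists_eq_comp_restrict {A : Finset ℤ} {F : (ℤ → ℝ) → ℝ}
    (hF : DependsOn F (A : Set ℤ)) : ∃ f : (A → ℝ) → ℝ, F = fun u => f (A.restrict u) := by
  classical
  refine ⟨fun x => F fun i => if h : i ∈ A then x ⟨i, h⟩ else 0, funext fun u => hF fun i hi => ?_⟩
  simp [Finset.mem_coe.1 hi]

/-- A measurable function depending on finitely many coordinates is almost surely equal to
a measurable function of these coordinates. -/
theorem aeDependsOn_of_dependsOn {A : Finset ℤ} {F : (ℤ → ℝ) → ℝ} (hF : DependsOn F (A : Set ℤ))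
    (hm : AEStronglyMeasurable F (Measure.infinitePi fun _ : ℤ => ν)) : AEDependsOn ν A F := by
  obtain ⟨f, rfl⟩ := DependsOn.exists_eq_comp_restrict hF
  have h3 := aestronglyMeasurable_of_comp_restrict hm
  exact ⟨h3.mk f, h3.stronglyMeasurable_mk.measurable,
    ae_of_ae_map (A.measurable_restrict).aemeasurable h3.ae_eq_mk⟩

end product

/-! ### Moment bounds for regular laws -/

/-- Quantitative regularity of a law on the line: moments, Poincaré inequality, Fisher
information. -/
structure Regular (ν : Measure ℝ) (B : ℝ) : Prop where
  polyInt : PolyInt ν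
  one_le : 1 ≤ B
  fisher : FisherBound ν (1 / B)
  poincare : Poincare ν B

/-- The third central moment. -/
noncomputable def thirdMoment (ν : Measure ℝ) : ℝ := ∫ x, (x - mean1 ν) ^ 3 ∂ν

/-- The variance of the squared centred variable. -/
noncomputable def varSq (ν : Measure ℝ) : ℝ := ∫ x, ((x - mean1 ν) ^ 2 - var1 ν) ^ 2 ∂ν

theorem abs_integral_mul_le {Ω : Type*} {mΩ : MeasurableSpace Ω} {P : Measure Ω} {f g : Ω → ℝ}
    (hf : MemLp f 2 P) (hg : MemLp g 2 P) {a b : ℝ} (ha : 0 ≤ a) (hb : 0 ≤ b)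
    (hfa : ∫ x, f x ^ 2 ∂P ≤ a ^ 2) (hgb : ∫ x, g x ^ 2 ∂P ≤ b ^ 2) :
    |∫ x, f x * g x ∂P| ≤ a * b := by
  refine abs_le_of_sq_le_sq ((sq_integral_mul_le hf hg).trans ?_) (by positivity)
  rw [mul_pow]
  exact mul_le_mul hfa hgb (integral_nonneg fun _ => sq_nonneg _) (by positivity)

theorem test_sub_const (a : ℝ) : Test (fun x => x - a) (fun _ => 1) :=
  (Test.id.sub (.const a)).congr (fun _ => rfl) (by simp)

section moments
variable {ν : Measure ℝ} [IsProbabilityMeasure ν] {B : ℝ}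

theorem integral_sub_mean1 (hν : PolyInt ν) : ∫ x, (x - mean1 ν) ∂ν = 0 := by
  simpa [sumLaw_one] using integral_sub_sumLaw hν 1

theorem Regular.var1_le (h : Regular ν B) : var1 ν ≤ B := by
  have := h.poincare _ _ Test.id
  simp only [one_pow, integral_const, probReal_univ, smul_eq_mul, mul_one] at this
  exact this

/-- The Fisher bound tested on the centred coordinate, whose derivative is 1: a Cramér–Rao
inequality. -/
theorem Regular.one_le_mul_var1 (h : Regular ν B) : 1 ≤ B * var1 ν := by
  have hB : 0 < B := by linarith [h.one_le]
  have := h.fisher _ _ (test_sub_const (mean1 ν))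
  simp only [integral_const, probReal_univ, smul_eq_mul, mul_one, one_pow] at this
  rw [div_le_iff₀ hB] at this
  rw [mul_comm]; exact this

theorem Regular.var1_pos (h : Regular ν B) : 0 < var1 ν := by
  have := h.one_le_mul_var1
  have := h.one_le
  by_contra hc
  nlinarith

/-- The Poincaré inequality applied to the centred square returns the variance, itself at most `n *
B`; hence no separate fourth moment estimate is needed. -/
theorem varSq_sumLaw_le (h : Regular ν B) (n : ℕ) :
    ∫ x, ((x - n * mean1 ν) ^ 2 - n * var1 ν) ^ 2 ∂(sumLaw ν n) ≤ (2 * B * n) ^ 2 := by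
  have hB : 0 < B := by linarith [h.one_le]
  have := h.poincare.sumLaw h.polyInt hB.le n _ _ (test_sub_const (n * mean1 ν)).sq
  rw [integral_sub_sq_sumLaw h.polyInt] at this
  refine this.trans ?_
  have e : ∀ x : ℝ, (2 * (x - n * mean1 ν) * 1) ^ 2 = 4 * (x - n * mean1 ν) ^ 2 := fun x => by ring
  simp_rw [e]
  rw [integral_const_mul, integral_sub_sq_sumLaw h.polyInt]
  have := h.var1_le
  calc n * B * (4 * (n * var1 ν)) = 4 * n ^ 2 * B * var1 ν := by ring
    _ ≤ 4 * n ^ 2 * B * B := by gcongr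
    _ = _ := by ring

theorem Regular.varSq_le (h : Regular ν B) : varSq ν ≤ (2 * B) ^ 2 := by
  have := varSq_sumLaw_le h 1
  simp only [sumLaw_one, Nat.cast_one, one_mul, mul_one] at this
  exact this

theorem memLp_two_of_test {P : Measure ℝ} (hP : PolyInt P) {g g' : ℝ → ℝ} (hg : Test g g') :
    MemLp g 2 P :=
  (memLp_two_iff_integrable_sq hg.cont.aestronglyMeasurable).2
    (hP.integrable (hg.3.pow 2) (hg.cont.pow 2))

theorem integral_sq_sub_mul (hν : PolyInt ν) :
    ∫ x, ((x - mean1 ν) ^ 2 - var1 ν) * (x - mean1 ν) ∂ν = thirdMoment ν := by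
  have t := test_sub_const (mean1 ν)
  have i1 := hν.integrable t.3 t.cont
  have i3 := hν.integrable (t.3.pow 3) (t.cont.pow 3)
  have e : ∀ x, ((x - mean1 ν) ^ 2 - var1 ν) * (x - mean1 ν)
      = (x - mean1 ν) ^ 3 - var1 ν * (x - mean1 ν) := fun x => by ring
  simp_rw [e]
  rw [integral_sub i3 (i1.const_mul _), integral_const_mul, integral_sub_mean1 hν, thirdMoment]
  simp

/-- The third central moment is the covariance of the centred square with the centred variable, to
which Cauchy–Schwarz applies. -/
theorem Regular.abs_thirdMoment_le (h : Regular ν B) : |thirdMoment ν| ≤ 2 * B ^ 2 := by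
  have hB := h.one_le
  have t := test_sub_const (mean1 ν)
  have t2 := t.sq.sub (.const (var1 ν))
  have := abs_integral_mul_le (memLp_two_of_test h.polyInt t2) (memLp_two_of_test h.polyInt t)
    (a := 2 * B) (b := B) (by positivity) (by positivity) h.varSq_le
    (h.var1_le.trans (by nlinarith))
  rw [integral_sq_sub_mul h.polyInt] at this
  linarith

end moments

/-! ### Expansions against functions of the total sum, and the dual estimate -/

section expand
variable {ν : Measure ℝ} [IsProbabilityMeasure ν] {B : ℝ}

/-- The square root of `expansion_bound`, with free upper bounds `a`, `G`, `e` for the three norms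
so that it can be used for one spin, for pairs and for a block. -/
theorem Regular.abs_expansion_le (h : Regular ν B) {g0 g1 g2 g3 : ℝ → ℝ} (h0 : Test g0 g1)
    (h1 : Test g1 g2) (h2 : Test g2 g3) {A J : Finset ℤ} (hA : A ⊆ J) (hJ : 5 ≤ J.card)
    (hAJ : 2 * A.card ≤ J.card)
    {θ : (ℤ → ℝ) → ℝ} (hθ : AEDependsOn ν A θ) (hθ2 : MemLp θ 2 (Measure.infinitePi fun _ => ν))
    (hθ0 : ∫ u, θ u ∂(Measure.infinitePi fun _ : ℤ => ν) = 0) {a G e : ℝ} (ha : 0 ≤ a)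
    (hG : 0 ≤ G) (he : 0 ≤ e)
    (hθa : ∫ u, θ u ^ 2 ∂(Measure.infinitePi fun _ : ℤ => ν) ≤ a ^ 2)
    (hg : ∫ x, g0 x ^ 2 ∂(sumLaw ν J.card) ≤ G ^ 2)
    (hAe : ((A.card : ℝ) / J.card) ^ 3 ≤ e ^ 2) :
    |∫ u, θ u * g0 (sumOn J u) ∂(Measure.infinitePi fun _ : ℤ => ν)
      - (∫ x, g1 x ∂(sumLaw ν J.card)) * ∫ u, θ u * (sumOn A u - A.card * mean1 ν)
        ∂(Measure.infinitePi fun _ : ℤ => ν)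
      - (∫ x, g2 x ∂(sumLaw ν J.card)) / 2
        * ∫ u, θ u * ((sumOn A u - A.card * mean1 ν) ^ 2 - A.card * var1 ν)
        ∂(Measure.infinitePi fun _ : ℤ => ν)| ≤ 100 * B ^ 4 * e * a * G := by
  have hB := h.one_le
  have key := expansion_bound h.polyInt (by linarith) h.fisher h.poincare h0 h1 h2 hA hJ hAJ hθ hθ2
    hθ0
  rw [integral_sumOn ν (g := fun x => g0 x ^ 2) (h0.cont.pow 2) J] at key
  refine abs_le_of_sq_le_sq (key.trans ?_) (by positivity)
  have hB2 : (1 : ℝ) ≤ 10 * B ^ 2 := by nlinarith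
  have hpos : 0 ≤ ∫ u, θ u ^ 2 ∂(Measure.infinitePi fun _ : ℤ => ν) :=
    integral_nonneg fun _ => sq_nonneg _
  have hpos2 : 0 ≤ ∫ x, g0 x ^ 2 ∂(sumLaw ν J.card) := integral_nonneg fun _ => sq_nonneg _
  -- Raising the exponent 3 to 4 makes the constant a perfect square.
  calc _ ≤ (10 * B ^ 2) ^ 4 * e ^ 2 * a ^ 2 * G ^ 2 := by
        have : (10 * B ^ 2) ^ 3 ≤ (10 * B ^ 2) ^ 4 := pow_le_pow_right₀ hB2 (by norm_num)
        gcongr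
    _ = _ := by ring

theorem integral_coord {k : ℝ → ℝ} (hk : Continuous k) (i : ℤ) :
    ∫ u, k (u i) ∂(Measure.infinitePi fun _ : ℤ => ν) = ∫ x, k x ∂ν := by
  have := integral_sumOn ν hk {i}
  simpa [sumOn, sumLaw_one] using this

theorem aeDependsOn_comp_coord {ν : Measure ℝ} {k : ℝ → ℝ} (hk : Continuous k) (i : ℤ) :
    AEDependsOn ν {i} fun u => k (u i) :=
  ⟨fun x => k (x ⟨i, Finset.mem_singleton_self i⟩), by have := hk.measurable; fun_prop,
    Filter.Eventually.of_forall fun u => rfl⟩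

theorem memLp_coord (hν : PolyInt ν) {k : ℝ → ℝ} (hk : Continuous k) (hb : PolyBdd k) (i : ℤ) :
    MemLp (fun u => k (u i)) 2 (Measure.infinitePi fun _ : ℤ => ν) := by
  simpa [sumOn] using memLp_sumOn ν hν hk hb {i}

theorem integral_coord_mul {k l : ℝ → ℝ} {i j : ℤ} (hij : i ≠ j) (hk : Continuous k)
    (hl : Continuous l) :
    ∫ u, k (u i) * l (u j) ∂(Measure.infinitePi fun _ : ℤ => ν)
      = (∫ x, k x ∂ν) * ∫ x, l x ∂ν := by
  rw [← integral_prod_mul, ← Measure.infinitePi_map_eval_prod (P := fun _ : ℤ => ν) hij,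
    integral_map (by fun_prop) (by fun_prop)]

theorem integrable_coord_mul (hν : PolyInt ν) {k l : ℝ → ℝ} (i j : ℤ) (hk : Continuous k)
    (hbk : PolyBdd k) (hl : Continuous l) (hbl : PolyBdd l) :
    Integrable (fun u => k (u i) * l (u j)) (Measure.infinitePi fun _ : ℤ => ν) :=
  (memLp_coord hν hk hbk i).integrable_mul (memLp_coord hν hl hbl j)

/-- The cube of the root of the relative block size `1 / N`. -/
noncomputable def rate (N : ℕ) : ℝ := √((1 / (N : ℝ)) ^ 3)

theorem rate_nonneg (N : ℕ) : 0 ≤ rate N := Real.sqrt_nonneg _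

theorem rate_sq (N : ℕ) : rate N ^ 2 = (1 / (N : ℝ)) ^ 3 := Real.sq_sqrt (by positivity)

theorem Regular.abs_coord_le (h : Regular ν B) {g0 g1 g2 g3 : ℝ → ℝ} (h0 : Test g0 g1)
    (h1 : Test g1 g2) (h2 : Test g2 g3) {J : Finset ℤ} (hJ : 5 ≤ J.card) {i : ℤ} (hi : i ∈ J)
    {k k' : ℝ → ℝ} (hk : Test k k') (hk0 : ∫ x, k x ∂ν = 0) {a G : ℝ} (ha : 0 ≤ a) (hG : 0 ≤ G)
    (hka : ∫ x, k x ^ 2 ∂ν ≤ a ^ 2) (hg : ∫ x, g0 x ^ 2 ∂(sumLaw ν J.card) ≤ G ^ 2) :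
    |∫ u, k (u i) * g0 (sumOn J u) ∂(Measure.infinitePi fun _ : ℤ => ν)
      - (∫ x, g1 x ∂(sumLaw ν J.card)) * ∫ x, k x * (x - mean1 ν) ∂ν
      - (∫ x, g2 x ∂(sumLaw ν J.card)) / 2 * ∫ x, k x * ((x - mean1 ν) ^ 2 - var1 ν) ∂ν|
      ≤ 100 * B ^ 4 * rate J.card * a * G := by
  have hc := hk.cont
  have := h.abs_expansion_le h0 h1 h2 (Finset.singleton_subset_iff.2 hi) hJ (by simp; omega)
    (aeDependsOn_comp_coord hc i) (memLp_coord h.polyInt hc hk.3 i)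
    (by rw [integral_coord hc, hk0]) ha hG (rate_nonneg J.card)
    (by rw [integral_coord (k := fun x => k x ^ 2) (hc.pow 2)]; exact hka) hg
    (by rw [rate_sq]; simp)
  have e1 := integral_coord (ν := ν) (k := fun x => k x * (x - mean1 ν)) (by fun_prop) i
  have e2 := integral_coord (ν := ν) (k := fun x => k x * ((x - mean1 ν) ^ 2 - var1 ν))
    (by fun_prop) i
  simpa [sumOn, e1, e2] using this

/-- For a product of two distinct centred spins the linear term vanishes by independence. In the
quadratic one only the cross term survives and gives twice the squared variance. -/
theorem Regular.abs_pair_le (h : Regular ν B) {g0 g1 g2 g3 : ℝ → ℝ} (h0 : Test g0 g1)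
    (h1 : Test g1 g2) (h2 : Test g2 g3) {J : Finset ℤ} (hJ : 5 ≤ J.card) {i j : ℤ} (hi : i ∈ J)
    (hj : j ∈ J) (hij : i ≠ j) {G : ℝ} (hG : 0 ≤ G)
    (hg : ∫ x, g0 x ^ 2 ∂(sumLaw ν J.card) ≤ G ^ 2) :
    |∫ u, ((u i - mean1 ν) * (u j - mean1 ν)) * g0 (sumOn J u)
        ∂(Measure.infinitePi fun _ : ℤ => ν)
      - (∫ x, g2 x ∂(sumLaw ν J.card)) * var1 ν ^ 2|
      ≤ 300 * B ^ 5 * rate J.card * G := by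
  set μ := Measure.infinitePi fun _ : ℤ => ν with hμ
  have hν := h.polyInt
  have hB := h.one_le
  set m := mean1 ν with hm
  have t := test_sub_const m
  have hcard : ({i, j} : Finset ℤ).card = 2 := Finset.card_pair hij
  have hz : ∫ x, (x - m) ∂ν = 0 := integral_sub_mean1 hν
  have hsq := integral_coord_mul (ν := ν) (k := fun x => (x - m) ^ 2) (l := fun x => (x - m) ^ 2)
    hij (by fun_prop) (by fun_prop)
  have h11 := integral_coord_mul (ν := ν) (k := fun x => (x - m)) (l := fun x => (x - m))
    hij (by fun_prop) (by fun_prop)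
  have h21 := integral_coord_mul (ν := ν) (k := fun x => (x - m) ^ 2) (l := fun x => (x - m))
    hij (by fun_prop) (by fun_prop)
  have h12 := integral_coord_mul (ν := ν) (k := fun x => (x - m)) (l := fun x => (x - m) ^ 2)
    hij (by fun_prop) (by fun_prop)
  have h31 := integral_coord_mul (ν := ν) (k := fun x => (x - m) ^ 3) (l := fun x => (x - m))
    hij (by fun_prop) (by fun_prop)
  have h13 := integral_coord_mul (ν := ν) (k := fun x => (x - m)) (l := fun x => (x - m) ^ 3)
    hij (by fun_prop) (by fun_prop)
  simp only [hz, mul_zero, zero_mul] at h11 h21 h12 h31 h13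
  have hint : ∀ a b : ℕ, Integrable (fun u : ℤ → ℝ => (u i - m) ^ a * (u j - m) ^ b) μ :=
    fun a b => integrable_coord_mul hν i j (k := fun x => (x - m) ^ a) (l := fun x => (x - m) ^ b)
      (by fun_prop) (t.3.pow a) (by fun_prop) (t.3.pow b)
  have i11 : Integrable (fun u : ℤ → ℝ => (u i - m) * (u j - m)) μ := by simpa using hint 1 1
  have i21 : Integrable (fun u : ℤ → ℝ => (u i - m) ^ 2 * (u j - m)) μ := by simpa using hint 2 1
  have i12 : Integrable (fun u : ℤ → ℝ => (u i - m) * (u j - m) ^ 2) μ := by simpa using hint 1 2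
  have i31 : Integrable (fun u : ℤ → ℝ => (u i - m) ^ 3 * (u j - m)) μ := by simpa using hint 3 1
  have i13 : Integrable (fun u : ℤ → ℝ => (u i - m) * (u j - m) ^ 3) μ := by simpa using hint 1 3
  have hS : ∀ u, sumOn {i, j} u = u i + u j := fun u => Finset.sum_pair hij
  have key := h.abs_expansion_le h0 h1 h2 (A := {i, j}) (J := J)
    -- The block has two sites, and `2 ^ 3 ≤ 3 ^ 2` accounts for the 3.
    (θ := fun u => (u i - m) * (u j - m)) (a := B) (e := 3 * rate J.card)
    (by intro x hx; simp at hx; rcases hx with rfl | rfl <;> assumption) hJ (by omega)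
    ⟨fun x => (x ⟨i, by simp⟩ - m) * (x ⟨j, by simp⟩ - m), by fun_prop,
      Filter.Eventually.of_forall fun u => rfl⟩
    ((memLp_two_iff_integrable_sq i11.aestronglyMeasurable).2
      (by simpa [mul_pow] using hint 2 2)) h11 (by positivity) hG
      (mul_nonneg (by norm_num) (rate_nonneg _))
      (by simp only [mul_pow]
          rw [hsq]
          have := h.var1_le
          have hp := h.var1_pos.le
          show var1 ν * var1 ν ≤ _
          nlinarith) hg
      (by rw [mul_pow, rate_sq, hcard, div_pow, div_pow]
          have : (0 : ℝ) < (J.card : ℝ) ^ 3 := by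
            have : 0 < J.card := by omega
            positivity
          rw [mul_div_assoc', div_le_div_iff_of_pos_right this]; norm_num)
  simp only [hS, hcard] at key
  have e1 : ∫ u : ℤ → ℝ, (u i - m) * (u j - m) * (u i + u j - (2 : ℕ) * m) ∂μ = 0 := by
    have e : ∀ u : ℤ → ℝ, (u i - m) * (u j - m) * (u i + u j - (2 : ℕ) * m)
      = (u i - m) ^ 2 * (u j - m) + (u i - m) * (u j - m) ^ 2 := fun u => by push_cast; ring
    simp_rw [e]
    rw [integral_add i21 i12, h21, h12, add_zero]
  have e2 : ∫ u : ℤ → ℝ, (u i - m) * (u j - m) * ((u i + u j - (2 : ℕ) * m) ^ 2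
      - (2 : ℕ) * var1 ν) ∂μ = 2 * var1 ν ^ 2 := by
    have e : ∀ u : ℤ → ℝ, (u i - m) * (u j - m) * ((u i + u j - (2 : ℕ) * m) ^ 2
      - (2 : ℕ) * var1 ν) = (u i - m) ^ 3 * (u j - m) + (u i - m) * (u j - m) ^ 3
        + 2 * ((u i - m) ^ 2 * (u j - m) ^ 2) - 2 * var1 ν * ((u i - m) * (u j - m)) :=
      fun u => by push_cast; ring
    simp_rw [e]
    have j1 : Integrable (fun u : ℤ → ℝ => (u i - m) ^ 3 * (u j - m) + (u i - m) * (u j - m) ^ 3) μ :=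
      i31.add i13
    have j2 : Integrable (fun u : ℤ → ℝ => (u i - m) ^ 3 * (u j - m) + (u i - m) * (u j - m) ^ 3
      + 2 * ((u i - m) ^ 2 * (u j - m) ^ 2)) μ := j1.add ((hint 2 2).const_mul 2)
    rw [integral_sub j2 (i11.const_mul _), integral_add j1 ((hint 2 2).const_mul 2),
      integral_add i31 i13, integral_const_mul, integral_const_mul, h31, h13, h11, hsq]
    simp only [← var1.eq_1, hm]
    ring
  rw [e1, e2] at key
  convert key using 1
  · congr 1; ring
  · ring

theorem sum_sub_mean (J : Finset ℤ) (m : ℝ) (u : ℤ → ℝ) :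
    sumOn J u - J.card * m = ∑ i ∈ J, (u i - m) := by
  simp [sumOn, Finset.sum_sub_distrib]

theorem sum_sub_mean_sq (J : Finset ℤ) (m v : ℝ) (u : ℤ → ℝ) :
    (sumOn J u - J.card * m) ^ 2 - J.card * v
      = ∑ i ∈ J, ((u i - m) ^ 2 - v) + ∑ i ∈ J, ∑ j ∈ J.erase i, (u i - m) * (u j - m) := by
  rw [sum_sub_mean, pow_two, Finset.sum_mul_sum, ← Finset.sum_add_distrib]
  have : (J.card : ℝ) * v = ∑ i ∈ J, v := by simp
  rw [this, ← Finset.sum_sub_distrib]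
  refine Finset.sum_congr rfl fun i hi => ?_
  rw [← Finset.add_sum_erase J _ hi]; ring

theorem abs_sum_sub_card_mul_le {ι : Type*} (s : Finset ι) (f : ι → ℝ) (c d : ℝ)
    (h : ∀ i ∈ s, |f i - c| ≤ d) : |∑ i ∈ s, f i - s.card * c| ≤ s.card * d := by
  have e : ∑ i ∈ s, f i - s.card * c = ∑ i ∈ s, (f i - c) := by
    simp [Finset.sum_sub_distrib]
  rw [e]
  refine (Finset.abs_sum_le_sum_abs _ _).trans ((Finset.sum_le_sum h).trans ?_)
  simp

/-- The centred total is a sum of single spins, each expanded with block size 1. -/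
theorem Regular.abs_linear_le (h : Regular ν B) {g0 g1 g2 g3 : ℝ → ℝ} (h0 : Test g0 g1)
    (h1 : Test g1 g2) (h2 : Test g2 g3) {J : Finset ℤ} (hJ : 5 ≤ J.card) {G : ℝ} (hG : 0 ≤ G)
    (hg : ∫ x, g0 x ^ 2 ∂(sumLaw ν J.card) ≤ G ^ 2) :
    |∫ u, (sumOn J u - J.card * mean1 ν) * g0 (sumOn J u) ∂(Measure.infinitePi fun _ : ℤ => ν)
      - J.card * ((∫ x, g1 x ∂(sumLaw ν J.card)) * var1 ν
        + (∫ x, g2 x ∂(sumLaw ν J.card)) / 2 * thirdMoment ν)|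
      ≤ J.card * (100 * B ^ 5 * rate J.card * G) := by
  have hB := h.one_le
  have t := test_sub_const (mean1 ν)
  simp_rw [sum_sub_mean, Finset.sum_mul]
  have i1 : ∀ i, Integrable (fun u => (u i - mean1 ν) * g0 (sumOn J u))
      (Measure.infinitePi fun _ : ℤ => ν) := fun i =>
    (memLp_coord h.polyInt t.cont t.3 i).integrable_mul (memLp_sumOn ν h.polyInt h0.cont h0.3 J)
  rw [integral_finsetSum _ fun i _ => i1 i]
  refine abs_sum_sub_card_mul_le _ _ _ _ fun i hi => ?_
  have := h.abs_coord_le h0 h1 h2 hJ hi t (integral_sub_mean1 h.polyInt) (a := B) (by linarith) hG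
    (h.var1_le.trans (by nlinarith)) hg
  have e1 : ∫ x, (x - mean1 ν) * (x - mean1 ν) ∂ν = var1 ν := by simp_rw [← pow_two]; rfl
  have e2 : ∫ x, (x - mean1 ν) * ((x - mean1 ν) ^ 2 - var1 ν) ∂ν = thirdMoment ν := by
    rw [← integral_sq_sub_mul h.polyInt]; simp_rw [mul_comm]
  rw [e1, e2] at this
  convert this using 1
  · congr 1; ring
  · ring

/-- The square of the centred total splits into diagonal terms, treated as single spins, and `J.card
* (J.card - 1)` ordered pairs. The pairs produce the dominant `M2 * v ^ 2` contribution. -/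
theorem Regular.abs_quadratic_le (h : Regular ν B) {g0 g1 g2 g3 : ℝ → ℝ} (h0 : Test g0 g1)
    (h1 : Test g1 g2) (h2 : Test g2 g3) {J : Finset ℤ} (hJ : 5 ≤ J.card) {G : ℝ} (hG : 0 ≤ G)
    (hg : ∫ x, g0 x ^ 2 ∂(sumLaw ν J.card) ≤ G ^ 2) :
    |∫ u, ((sumOn J u - J.card * mean1 ν) ^ 2 - J.card * var1 ν) * g0 (sumOn J u)
        ∂(Measure.infinitePi fun _ : ℤ => ν)
      - (J.card * ((∫ x, g1 x ∂(sumLaw ν J.card)) * thirdMoment ν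
          + (∫ x, g2 x ∂(sumLaw ν J.card)) / 2 * varSq ν)
        + J.card * ((J.card - 1) * ((∫ x, g2 x ∂(sumLaw ν J.card)) * var1 ν ^ 2)))|
      ≤ J.card ^ 2 * (500 * B ^ 5 * rate J.card * G) := by
  have hB := h.one_le
  have hν := h.polyInt
  have t := test_sub_const (mean1 ν)
  have t2 := t.sq.sub (.const (var1 ν))
  have mg := memLp_sumOn ν hν h0.cont h0.3 J
  set μ := Measure.infinitePi fun _ : ℤ => ν with hμ
  set M1 := ∫ x, g1 x ∂(sumLaw ν J.card)
  set M2 := ∫ x, g2 x ∂(sumLaw ν J.card)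
  simp_rw [sum_sub_mean_sq, add_mul, Finset.sum_mul]
  have i1 : ∀ i, Integrable (fun u => ((u i - mean1 ν) ^ 2 - var1 ν) * g0 (sumOn J u)) μ :=
    fun i => (memLp_coord hν t2.cont t2.3 i).integrable_mul mg
  have i2 : ∀ i j, i ≠ j →
      Integrable (fun u => (u i - mean1 ν) * (u j - mean1 ν) * g0 (sumOn J u)) μ := by
    intro i j hij
    refine MemLp.integrable_mul (p := 2) (q := 2) (f := fun u => (u i - mean1 ν) * (u j - mean1 ν)) ?_ mg
    refine (memLp_two_iff_integrable_sq ?_).2 ?_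
    · exact (integrable_coord_mul hν i j t.cont t.3 t.cont t.3).aestronglyMeasurable
    · simp_rw [mul_pow]
      exact integrable_coord_mul hν i j t.sq.cont t.sq.3 t.sq.cont t.sq.3
  have i2' : ∀ i ∈ J, ∀ j ∈ J.erase i,
      Integrable (fun u => (u i - mean1 ν) * (u j - mean1 ν) * g0 (sumOn J u)) μ :=
    fun i _ j hj => i2 i j (Finset.ne_of_mem_erase hj).symm
  rw [integral_add (integrable_finsetSum _ fun i _ => i1 i)
    (integrable_finsetSum _ fun i hi => integrable_finsetSum _ fun j hj => i2' i hi j hj),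
    integral_finsetSum _ fun i _ => i1 i,
    integral_finsetSum _ fun i hi => integrable_finsetSum _ fun j hj => i2' i hi j hj]
  have b1 := abs_sum_sub_card_mul_le J
    (fun i => ∫ u, ((u i - mean1 ν) ^ 2 - var1 ν) * g0 (sumOn J u) ∂μ)
    (M1 * thirdMoment ν + M2 / 2 * varSq ν) (200 * B ^ 5 * rate J.card * G) fun i hi => by
    have := h.abs_coord_le h0 h1 h2 hJ hi t2 (by
        rw [integral_sub (hν.integrable t.sq.3 t.sq.cont) (integrable_const _)]
        simp [var1]) (a := 2 * B) (by linarith) hG h.varSq_le hg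
    have e2 : ∫ x, ((x - mean1 ν) ^ 2 - var1 ν) * ((x - mean1 ν) ^ 2 - var1 ν) ∂ν = varSq ν := by
      simp_rw [← pow_two]; rfl
    rw [integral_sq_sub_mul hν, e2] at this
    convert this using 1
    · congr 1; ring
    · ring
  have b2 := abs_sum_sub_card_mul_le J
    (fun i => ∫ u, ∑ j ∈ J.erase i, (u i - mean1 ν) * (u j - mean1 ν) * g0 (sumOn J u) ∂μ)
    ((J.card - 1) * (M2 * var1 ν ^ 2)) ((J.card - 1) * (300 * B ^ 5 * rate J.card * G))
    fun i hi => by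
    rw [integral_finsetSum _ fun j hj => i2' i hi j hj]
    have hc : ((J.erase i).card : ℝ) = J.card - 1 := by
      rw [Finset.card_erase_of_mem hi, Nat.cast_sub (by omega), Nat.cast_one]
    rw [← hc]
    refine abs_sum_sub_card_mul_le _ _ _ _ fun j hj => ?_
    exact h.abs_pair_le h0 h1 h2 hJ hi (Finset.mem_of_mem_erase hj)
      (Finset.ne_of_mem_erase hj).symm hG hg
  have hr := rate_nonneg J.card
  have hX : 0 ≤ B ^ 5 * rate J.card * G := by positivity
  have hN : (5 : ℝ) ≤ J.card := by exact_mod_cast hJ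
  rw [add_sub_add_comm]
  refine (abs_add_le _ _).trans ((add_le_add b1 b2).trans ?_)
  -- The diagonal contributes 200 per site and the pairs 300 each, hence 500 in total.
  nlinarith [mul_nonneg (by linarith : (0 : ℝ) ≤ J.card) hX,
    mul_nonneg (sq_nonneg (J.card : ℝ)) hX]

/-- Elimination of the unknown `M1` and `M2`. The values of `c1` and `c2` solve `c1 * v = b1` and
`c1 * k3 + c2 * v ^ 2 = b2`, so the main terms cancel. What remains is the three expansion errors
and a correction of relative order `1 / n` from the quadratic term. In the application `r` is `N ^
(-3/2)`, and `e` is `(ℓ / N) ^ (3/2)`, which is at least `l * r`. -/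
theorem combination_bound {B V G n r l e M1 M2 k3 k4 v b1 b2 c1 c2 Eθ E1 E2 : ℝ}
    (hB : 1 ≤ B) (hV : 0 ≤ V) (hG : 0 ≤ G) (hn : 1 ≤ n) (hr : 0 ≤ r) (hl : 0 ≤ l)
    (hle : l * r ≤ e) (hv : 0 < v) (hvB : v ≤ B) (hk3 : |k3| ≤ 2 * B ^ 2)
    (hk4 : |k4| ≤ (2 * B) ^ 2) (hc1 : c1 = b1 / v) (hc2 : c2 = (b2 - b1 * k3 / v) / v ^ 2)
    (hc1' : |c1| ≤ B ^ 2 * l * V) (hc2' : |c2| ≤ 4 * B ^ 6 * l * V)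
    (hM1 : |M1| ≤ B * (n * r) * G) (hM2 : |M2| ≤ 5 * B * (n * r) * G)
    (hθ : |Eθ - M1 * b1 - M2 / 2 * b2| ≤ 100 * B ^ 4 * e * V * G)
    (hE1 : |E1 - n * (M1 * v + M2 / 2 * k3)| ≤ n * (100 * B ^ 5 * r * G))
    (hE2 : |E2 - (n * (M1 * k3 + M2 / 2 * k4) + n * ((n - 1) * (M2 * v ^ 2)))|
      ≤ n ^ 2 * (500 * B ^ 5 * r * G)) :
    |Eθ - c1 / n * E1 - c2 / (2 * n ^ 2) * E2| ≤ 1300 * B ^ 11 * e * V * G := by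
  have hn0 : 0 < n := by linarith
  set X1 := E1 - n * (M1 * v + M2 / 2 * k3) with hX1
  set X2 := E2 - (n * (M1 * k3 + M2 / 2 * k4) + n * ((n - 1) * (M2 * v ^ 2))) with hX2
  -- The correction: the diagonal of the quadratic term, together with the difference between `n *
  -- (n - 1)` and `n ^ 2`.
  set X3 := (M1 * k3 + M2 / 2 * k4 - M2 * v ^ 2) / n with hX3
  have hid : Eθ - c1 / n * E1 - c2 / (2 * n ^ 2) * E2
      = (Eθ - M1 * b1 - M2 / 2 * b2) - c1 * (X1 / n) - c2 * (X2 / (2 * n ^ 2) + X3 / 2) := by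
    rw [hX1, hX2, hX3, hc1, hc2]
    field_simp
    ring
  have hY1 : |X1 / n| ≤ 100 * B ^ 5 * r * G := by
    rw [abs_div, abs_of_pos hn0, div_le_iff₀ hn0]; linarith
  have hY2 : |X2 / (2 * n ^ 2)| ≤ 250 * B ^ 5 * r * G := by
    rw [abs_div, abs_of_pos (by positivity : 0 < 2 * n ^ 2), div_le_iff₀ (by positivity)]; linarith
  have hY3 : |X3| ≤ 17 * B ^ 3 * r * G := by
    rw [hX3, abs_div, abs_of_pos hn0, div_le_iff₀ hn0]
    have p1 : |M1 * k3| ≤ (B * (n * r) * G) * (2 * B ^ 2) := by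
      rw [abs_mul]; gcongr
    have p2 : |M2 / 2 * k4| ≤ (5 * B * (n * r) * G) / 2 * (2 * B) ^ 2 := by
      rw [abs_mul, abs_div, abs_two]; gcongr
    have p3 : |M2 * v ^ 2| ≤ (5 * B * (n * r) * G) * B ^ 2 := by
      rw [abs_mul, abs_of_nonneg (sq_nonneg v)]; gcongr
    calc |M1 * k3 + M2 / 2 * k4 - M2 * v ^ 2|
        ≤ |M1 * k3| + |M2 / 2 * k4| + |M2 * v ^ 2| :=
          (abs_sub _ _).trans (add_le_add_left (abs_add_le _ _) _)
      _ ≤ _ := add_le_add (add_le_add p1 p2) p3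
      _ = _ := by ring
  have hY4 : |X2 / (2 * n ^ 2) + X3 / 2| ≤ 259 * B ^ 5 * r * G := by
    have : B ^ 3 ≤ B ^ 5 := pow_le_pow_right₀ hB (by norm_num)
    have h2 : 17 * B ^ 3 * r * G ≤ 17 * B ^ 5 * r * G := by gcongr
    have h3 : |X3 / 2| ≤ 17 * B ^ 5 * r * G / 2 := by
      rw [abs_div, abs_two]; linarith
    have h4 : 0 ≤ B ^ 5 * r * G := by positivity
    refine (abs_add_le _ _).trans ?_
    linarith
  have he : 0 ≤ e := le_trans (by positivity) hle
  have hVG : 0 ≤ V * G := by positivity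
  have t1 : |c1 * (X1 / n)| ≤ 100 * B ^ 11 * e * V * G := by
    rw [abs_mul]
    calc _ ≤ (B ^ 2 * l * V) * (100 * B ^ 5 * r * G) := by gcongr
      _ = 100 * B ^ 7 * (l * r) * (V * G) := by ring
      _ ≤ 100 * B ^ 11 * e * (V * G) := by
        have : B ^ 7 ≤ B ^ 11 := pow_le_pow_right₀ hB (by norm_num)
        gcongr
      _ = _ := by ring
  have t2 : |c2 * (X2 / (2 * n ^ 2) + X3 / 2)| ≤ 1036 * B ^ 11 * e * V * G := by
    rw [abs_mul]
    calc _ ≤ (4 * B ^ 6 * l * V) * (259 * B ^ 5 * r * G) := by gcongr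
      _ = 1036 * B ^ 11 * (l * r) * (V * G) := by ring
      _ ≤ 1036 * B ^ 11 * e * (V * G) := by gcongr
      _ = _ := by ring
  have t0 : 100 * B ^ 4 * e * V * G ≤ 100 * B ^ 11 * e * V * G := by
    have : B ^ 4 ≤ B ^ 11 := pow_le_pow_right₀ hB (by norm_num)
    gcongr
  have hp : 0 ≤ B ^ 11 * e * V * G := by positivity
  rw [hid]
  refine ((abs_sub _ _).trans (add_le_add_left (abs_sub _ _) _)).trans ?_
  linarith

/-- In squared form this is `l ^ 2 ≤ l ^ 3`; here nonemptiness of the block is used. -/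
theorem card_mul_rate_le {l N : ℕ} (hl : 1 ≤ l) :
    l * rate N ≤ √(((l : ℝ) / N) ^ 3) := by
  have hl' : (1 : ℝ) ≤ l := by exact_mod_cast hl
  rw [rate, ← Real.sqrt_sq (by positivity : (0 : ℝ) ≤ l), ← Real.sqrt_mul (by positivity),
    Real.sqrt_sq (by positivity : (0 : ℝ) ≤ l)]
  refine Real.sqrt_le_sqrt ?_
  rw [div_pow, div_pow, one_pow, mul_one_div]
  gcongr
  norm_num

/-- `N * rate N` is `N ^ (-1/2)`, the size of the mean derivative of a function of the total sum. -/
theorem abs_le_of_mul_sq_le {N : ℕ} {M a : ℝ} (hN : 1 ≤ N) (ha : 0 ≤ a) (h : N * M ^ 2 ≤ a ^ 2) :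
    |M| ≤ N * rate N * a := by
  have hN' : (0 : ℝ) < N := by exact_mod_cast hN
  refine abs_le_of_sq_le_sq ?_ (mul_nonneg (mul_nonneg hN'.le (rate_nonneg N)) ha)
  rw [mul_pow, mul_pow, rate_sq]
  field_simp
  linarith

/-- The coefficients of the second order expansion are controlled by the variance. -/
theorem Regular.coeff_bounds (h : Regular ν B) {A : Finset ℤ} (hA : 1 ≤ A.card)
    {θ : (ℤ → ℝ) → ℝ} (hθ2 : MemLp θ 2 (Measure.infinitePi fun _ => ν)) {V b1 b2 : ℝ} (hV : 0 ≤ V)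
    (hθV : ∫ u, θ u ^ 2 ∂(Measure.infinitePi fun _ : ℤ => ν) ≤ V ^ 2)
    (hb1 : b1 = ∫ u, θ u * (sumOn A u - A.card * mean1 ν) ∂(Measure.infinitePi fun _ : ℤ => ν))
    (hb2 : b2 = ∫ u, θ u * ((sumOn A u - A.card * mean1 ν) ^ 2 - A.card * var1 ν)
        ∂(Measure.infinitePi fun _ : ℤ => ν)) :
    |b1 / var1 ν| ≤ B ^ 2 * A.card * V ∧
    |(b2 - b1 * thirdMoment ν / var1 ν) / var1 ν ^ 2| ≤ 4 * B ^ 6 * A.card * V := by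
  have hB := h.one_le
  have hν := h.polyInt
  have hv := h.var1_pos
  have hA' : (1 : ℝ) ≤ A.card := by exact_mod_cast hA
  have t := test_sub_const (A.card * mean1 ν)
  have t2 := t.sq.sub (.const (A.card * var1 ν))
  have e1 : |b1| ≤ V * (B * A.card) := by
    rw [hb1]
    refine abs_integral_mul_le hθ2 (memLp_sumOn ν hν t.cont t.3 A) hV (by positivity) hθV ?_
    rw [integral_sumOn ν (g := fun x => (x - A.card * mean1 ν) ^ 2) t.sq.cont,
      integral_sub_sq_sumLaw hν]
    calc (A.card : ℝ) * var1 ν ≤ A.card * B := by gcongr; exact h.var1_le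
      _ ≤ (B * A.card) ^ 2 := by nlinarith [mul_le_mul hB hA' (by norm_num) (by linarith)]
  have e2 : |b2| ≤ V * (2 * B * A.card) := by
    rw [hb2]
    refine abs_integral_mul_le hθ2 (memLp_sumOn ν hν t2.cont t2.3 A) hV (by positivity) hθV ?_
    rw [integral_sumOn ν
      (g := fun x => ((x - A.card * mean1 ν) ^ 2 - A.card * var1 ν) ^ 2) t2.sq.cont]
    exact varSq_sumLaw_le h _
  have hinv : 1 / var1 ν ≤ B := by
    rw [div_le_iff₀ hv]; exact h.one_le_mul_var1
  have hinv0 : 0 ≤ 1 / var1 ν := by positivity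
  have hb1v : |b1 / var1 ν| ≤ B ^ 2 * A.card * V := by
    rw [abs_div, abs_of_pos hv, div_eq_mul_one_div]
    calc _ ≤ (V * (B * A.card)) * B := by gcongr
      _ = _ := by ring
  refine ⟨hb1v, ?_⟩
  have e3 : |b1 * thirdMoment ν / var1 ν| ≤ 2 * B ^ 4 * A.card * V := by
    rw [mul_div_right_comm, abs_mul]
    calc _ ≤ (B ^ 2 * A.card * V) * (2 * B ^ 2) := by gcongr; exact h.abs_thirdMoment_le
      _ = _ := by ring
  have e4 : |b2 - b1 * thirdMoment ν / var1 ν| ≤ 4 * B ^ 4 * A.card * V := by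
    refine (abs_sub _ _).trans ((add_le_add e2 e3).trans ?_)
    have : B ≤ B ^ 4 := le_self_pow₀ hB (by norm_num)
    have h2 : V * (2 * B * A.card) ≤ V * (2 * B ^ 4 * A.card) := by gcongr
    linarith
  rw [abs_div, abs_of_pos (by positivity : 0 < var1 ν ^ 2), div_eq_mul_one_div, ← one_div_pow]
  calc _ ≤ (4 * B ^ 4 * A.card * V) * B ^ 2 := by gcongr
    _ = _ := by ring

/-- The dual form of the second order equivalence of ensembles. -/
theorem Regular.duality_bound (h : Regular ν B) {g0 g1 g2 g3 : ℝ → ℝ} (h0 : Test g0 g1)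
    (h1 : Test g1 g2) (h2 : Test g2 g3) {A J : Finset ℤ} (hA : A ⊆ J) (hA1 : 1 ≤ A.card)
    (hAJ : 2 * A.card ≤ J.card)
    {θ : (ℤ → ℝ) → ℝ} (hθ : AEDependsOn ν A θ) (hθ2 : MemLp θ 2 (Measure.infinitePi fun _ => ν))
    (hθ0 : ∫ u, θ u ∂(Measure.infinitePi fun _ : ℤ => ν) = 0) {V G b1 b2 : ℝ} (hV : 0 ≤ V)
    (hG : 0 ≤ G) (hθV : ∫ u, θ u ^ 2 ∂(Measure.infinitePi fun _ : ℤ => ν) ≤ V ^ 2)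
    (hg : ∫ x, g0 x ^ 2 ∂(sumLaw ν J.card) ≤ G ^ 2)
    (hb1 : b1 = ∫ u, θ u * (sumOn A u - A.card * mean1 ν) ∂(Measure.infinitePi fun _ : ℤ => ν))
    (hb2 : b2 = ∫ u, θ u * ((sumOn A u - A.card * mean1 ν) ^ 2 - A.card * var1 ν)
        ∂(Measure.infinitePi fun _ : ℤ => ν)) :
    |∫ u, θ u * g0 (sumOn J u) ∂(Measure.infinitePi fun _ : ℤ => ν)
      - b1 / var1 ν / J.card * ∫ u, (sumOn J u - J.card * mean1 ν) * g0 (sumOn J u)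
        ∂(Measure.infinitePi fun _ : ℤ => ν)
      - (b2 - b1 * thirdMoment ν / var1 ν) / var1 ν ^ 2 / (2 * J.card ^ 2)
        * ∫ u, ((sumOn J u - J.card * mean1 ν) ^ 2 - J.card * var1 ν) * g0 (sumOn J u)
        ∂(Measure.infinitePi fun _ : ℤ => ν)|
      ≤ 1300 * B ^ 11 * √(((A.card : ℝ) / J.card) ^ 3) * V * G := by
  have hB := h.one_le
  have hν := h.polyInt
  obtain ⟨hc1, hc2⟩ := h.coeff_bounds hA1 hθ2 hV hθV hb1 hb2
  have hle := card_mul_rate_le (N := J.card) hA1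
  have hr := rate_nonneg J.card
  have hJ1 : 1 ≤ J.card := by omega
  have hJ1' : (1 : ℝ) ≤ J.card := by exact_mod_cast hJ1
  have hE0 := integral_sumOn ν (g := fun x => g0 x ^ 2) h0.sq.cont J
  -- The pair expansion needs two sites and three more to absorb the derivatives, hence 5. Below
  -- that the ratio `ℓ / N` is bounded away from zero and Cauchy–Schwarz on each term suffices.
  rcases le_or_gt 5 J.card with hJ | hJ
  · refine combination_bound hB hV hG hJ1' hr (Nat.cast_nonneg _) hle h.var1_pos h.var1_le
      h.abs_thirdMoment_le (k4 := varSq ν) ?_ rfl rfl hc1 hc2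
      (M1 := ∫ x, g1 x ∂(sumLaw ν J.card)) (M2 := ∫ x, g2 x ∂(sumLaw ν J.card)) ?_ ?_ ?_
      (h.abs_linear_le h0 h1 h2 hJ hG hg) (h.abs_quadratic_le h0 h1 h2 hJ hG hg)
    · have : 0 ≤ varSq ν := integral_nonneg fun _ => sq_nonneg _
      rw [abs_of_nonneg this]; exact h.varSq_le
    · have := sq_integral_deriv_sumLaw_le hν (by linarith) h.fisher h0 J.card
      refine (abs_le_of_mul_sq_le hJ1 (by positivity : 0 ≤ B * G) ?_).trans (by linarith)
      calc _ ≤ B * ∫ x, g0 x ^ 2 ∂(sumLaw ν J.card) := this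
        _ ≤ B ^ 2 * G ^ 2 := by
          gcongr
          exact le_self_pow₀ hB (by norm_num)
        _ = _ := by ring
    · have := sq_integral_deriv_two_sumLaw_le hν (by linarith) h.fisher h0 h1 (N := J.card)
        (by omega)
      refine (abs_le_of_mul_sq_le hJ1 (by positivity : 0 ≤ 5 * B * G) ?_).trans (by linarith)
      -- The available decay `1 / N` of the mean second derivative is weakened to `N ^ (-1/2)`,
      -- which is all that the combination uses.
      calc _ ≤ (J.card : ℝ) ^ 2 * (∫ x, g2 x ∂(sumLaw ν J.card)) ^ 2 := by
            gcongr; exact le_self_pow₀ hJ1' (by norm_num)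
        _ ≤ _ := this
        _ ≤ (5 * B) ^ 2 * G ^ 2 := by gcongr
        _ = _ := by ring
    · rw [hb1, hb2]
      exact h.abs_expansion_le h0 h1 h2 hA hJ hAJ hθ hθ2 hθ0 hV hG (Real.sqrt_nonneg _) hθV hg
        (by rw [Real.sq_sqrt (by positivity)])
  · have t := test_sub_const (J.card * mean1 ν)
    have t2 := t.sq.sub (.const (J.card * var1 ν))
    have mg := memLp_sumOn ν hν h0.cont h0.3 J
    have hg' : ∫ u, g0 (sumOn J u) ^ 2 ∂(Measure.infinitePi fun _ : ℤ => ν) ≤ G ^ 2 := by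
      rw [hE0]; exact hg
    have f0 := abs_integral_mul_le hθ2 mg hV hG hθV hg'
    have f1 := abs_integral_mul_le (memLp_sumOn ν hν t.cont t.3 J) mg
      (a := B * J.card) (by positivity) hG (by
        rw [integral_sumOn ν (g := fun x => (x - J.card * mean1 ν) ^ 2) t.sq.cont,
          integral_sub_sq_sumLaw hν]
        calc (J.card : ℝ) * var1 ν ≤ J.card * B := by gcongr; exact h.var1_le
          _ ≤ (B * J.card) ^ 2 := by nlinarith [mul_le_mul hB hJ1' (by norm_num) (by linarith)]) hg'
    have f2 := abs_integral_mul_le (memLp_sumOn ν hν t2.cont t2.3 J) mg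
      (a := 2 * B * J.card) (by positivity) hG (by
        rw [integral_sumOn ν
          (g := fun x => ((x - J.card * mean1 ν) ^ 2 - J.card * var1 ν) ^ 2) t2.sq.cont]
        exact varSq_sumLaw_le h _) hg'
    set E0 := ∫ u, θ u * g0 (sumOn J u) ∂(Measure.infinitePi fun _ : ℤ => ν)
    set E1 := ∫ u, (sumOn J u - J.card * mean1 ν) * g0 (sumOn J u)
      ∂(Measure.infinitePi fun _ : ℤ => ν)
    set E2 := ∫ u, ((sumOn J u - J.card * mean1 ν) ^ 2 - J.card * var1 ν) * g0 (sumOn J u)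
      ∂(Measure.infinitePi fun _ : ℤ => ν)
    set c1 := b1 / var1 ν
    set c2 := (b2 - b1 * thirdMoment ν / var1 ν) / var1 ν ^ 2
    set e := √(((A.card : ℝ) / J.card) ^ 3)
    have hJ0 : (0 : ℝ) < J.card := by linarith
    have q1 : |c1 / J.card * E1| ≤ B ^ 3 * A.card * V * G := by
      rw [abs_mul, abs_div, abs_of_pos hJ0]
      calc _ ≤ (B ^ 2 * A.card * V) / J.card * (B * J.card * G) := by gcongr
        _ = _ := by field_simp
    have q2 : |c2 / (2 * J.card ^ 2) * E2| ≤ 4 * B ^ 7 * A.card * V * G := by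
      rw [abs_mul, abs_div, abs_of_pos (by positivity : (0 : ℝ) < 2 * J.card ^ 2)]
      calc _ ≤ (4 * B ^ 6 * A.card * V) / (2 * J.card ^ 2) * (2 * B * J.card * G) := by gcongr
        _ = 4 * B ^ 7 * A.card * V * G / J.card := by field_simp
        _ ≤ _ := div_le_self (by positivity) hJ1'
    -- At most four sites, and `(1/4) ^ (3/2)` is `1/8`.
    have hrate : 1 / 8 ≤ rate J.card := by
      refine Real.le_sqrt_of_sq_le ?_
      have h4 : (J.card : ℝ) ≤ 4 := by exact_mod_cast (by omega : J.card ≤ 4)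
      calc (1 / 8 : ℝ) ^ 2 = (1 / 4) ^ 3 := by norm_num
        _ ≤ _ := by gcongr
    have hA' : (1 : ℝ) ≤ A.card := by exact_mod_cast hA1
    have hAe : (A.card : ℝ) ≤ 8 * e := by nlinarith
    have hp : 0 ≤ V * G := by positivity
    calc |E0 - c1 / J.card * E1 - c2 / (2 * J.card ^ 2) * E2|
        ≤ V * G + B ^ 3 * A.card * V * G + 4 * B ^ 7 * A.card * V * G :=
          ((abs_sub _ _).trans (add_le_add_left (abs_sub _ _) _)).trans
            (add_le_add (add_le_add f0 q1) q2)
      _ ≤ B ^ 11 * A.card * (V * G) + B ^ 11 * A.card * (V * G)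
          + 4 * B ^ 11 * A.card * (V * G) := by
          have e3 : B ^ 3 ≤ B ^ 11 := pow_le_pow_right₀ hB (by norm_num)
          have e7 : B ^ 7 ≤ B ^ 11 := pow_le_pow_right₀ hB (by norm_num)
          have e0 : 1 ≤ B ^ 11 := one_le_pow₀ hB
          have e1 : 1 ≤ B ^ 11 * A.card := by nlinarith
          have k0 : V * G ≤ B ^ 11 * A.card * (V * G) := le_mul_of_one_le_left hp e1
          have k1 : B ^ 3 * A.card * V * G ≤ B ^ 11 * A.card * (V * G) := by
            rw [mul_assoc]; gcongr
          have k2 : 4 * B ^ 7 * A.card * V * G ≤ 4 * B ^ 11 * A.card * (V * G) := by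
            rw [mul_assoc]; gcongr
          linarith
      _ = 6 * B ^ 11 * A.card * (V * G) := by ring
      _ ≤ 6 * B ^ 11 * (8 * e) * (V * G) := by gcongr
      _ ≤ 1300 * B ^ 11 * e * V * G := by
          have : 0 ≤ B ^ 11 * e * (V * G) := by positivity
          linarith

end expand

/-! ### The single-site measure: Poincaré and Fisher bounds uniform in the tilt -/

/-- The data of a decomposition of the potential into a uniformly convex part and a bounded
perturbation, with derivatives. -/
structure Decomposition (V φ φ1 φ2 ψ ψ1 ψ2 : ℝ → ℝ) (κ L M : ℝ) : Prop where
  eq : ∀ x, V x = φ x + ψ x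
  hφ : ∀ x, HasDerivAt φ (φ1 x) x
  hφ1 : ∀ x, HasDerivAt φ1 (φ2 x) x
  cφ2 : Continuous φ2
  hψ : ∀ x, HasDerivAt ψ (ψ1 x) x
  hψ1 : ∀ x, HasDerivAt ψ1 (ψ2 x) x
  cψ2 : Continuous ψ2
  κ_pos : 0 < κ
  κ_le : ∀ x, κ ≤ φ2 x
  le_L : ∀ x, φ2 x ≤ L
  ψ_le : ∀ x, |ψ x| ≤ M
  ψ1_le : ∀ x, |ψ1 x| ≤ M
  ψ2_le : ∀ x, |ψ2 x| ≤ M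

theorem hasDerivAt_of_contDiff_two {f : ℝ → ℝ} (hf : ContDiff ℝ 2 f) :
    (∀ x, HasDerivAt f (deriv f x) x) ∧ (∀ x, HasDerivAt (deriv f) (iteratedDeriv 2 f x) x) ∧
      Continuous (iteratedDeriv 2 f) := by
  refine ⟨fun x => ((hf.differentiable (by norm_num)) x).hasDerivAt, fun x => ?_,
    hf.continuous_iteratedDeriv 2 le_rfl⟩
  have := (hf.differentiable_iteratedDeriv 1 (by norm_num)) x
  rw [iteratedDeriv_succ]
  rw [iteratedDeriv_one] at *
  exact this.hasDerivAt

theorem AssumptionV.exists_decomposition {V : ℝ → ℝ} (hV : AssumptionV V) :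
    ∃ φ φ1 φ2 ψ ψ1 ψ2 κ L M, Decomposition V φ φ1 φ2 ψ ψ1 ψ2 κ L M := by
  obtain ⟨φ, ψ, hE, hφ, ⟨C, hC, hCb⟩, hψ, M, hM⟩ := hV
  obtain ⟨a1, a2, a3⟩ := hasDerivAt_of_contDiff_two hφ
  obtain ⟨b1, b2, b3⟩ := hasDerivAt_of_contDiff_two hψ
  exact ⟨φ, _, _, ψ, _, _, 1 / C, C, M, hE, a1, a2, a3, b1, b2, b3, by positivity,
    fun x => (hCb x).1, fun x => (hCb x).2, fun x => by simpa using hM 0 (by norm_num) x,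
    fun x => by simpa [iteratedDeriv_one] using hM 1 (by norm_num) x, fun x => hM 2 le_rfl x⟩

namespace Decomposition
variable {V φ φ1 φ2 ψ ψ1 ψ2 : ℝ → ℝ} {κ L M : ℝ}

theorem slope_lower (h : Decomposition V φ φ1 φ2 ψ ψ1 ψ2 κ L M) {x y : ℝ} (hxy : x ≤ y) :
    κ * (y - x) ≤ φ1 y - φ1 x := by
  have hd : ∀ t, HasDerivAt (fun t => φ1 t - κ * t) (φ2 t - κ) t := fun t => by
    exact ((h.hφ1 t).sub ((hasDerivAt_id t).const_mul κ)).congr_deriv (by simp)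
  have := monotone_of_deriv_nonneg (fun t => (hd t).differentiableAt)
    (fun t => by rw [(hd t).deriv]; linarith [h.κ_le t]) hxy
  simp only at this
  linarith

theorem slope_upper (h : Decomposition V φ φ1 φ2 ψ ψ1 ψ2 κ L M) {x y : ℝ} (hxy : x ≤ y) :
    φ1 y - φ1 x ≤ L * (y - x) := by
  have hd : ∀ t, HasDerivAt (fun t => L * t - φ1 t) (L - φ2 t) t := fun t => by
    exact (((hasDerivAt_id t).const_mul L).sub (h.hφ1 t)).congr_deriv (by simp)
  have := monotone_of_deriv_nonneg (fun t => (hd t).differentiableAt)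
    (fun t => by rw [(hd t).deriv]; linarith [h.le_L t]) hxy
  simp only at this
  linarith

theorem cont_φ1 (h : Decomposition V φ φ1 φ2 ψ ψ1 ψ2 κ L M) : Continuous φ1 :=
  continuous_iff_continuousAt.2 fun x => (h.hφ1 x).continuousAt

theorem cont_φ (h : Decomposition V φ φ1 φ2 ψ ψ1 ψ2 κ L M) : Continuous φ :=
  continuous_iff_continuousAt.2 fun x => (h.hφ x).continuousAt

theorem cont_ψ (h : Decomposition V φ φ1 φ2 ψ ψ1 ψ2 κ L M) : Continuous ψ :=
  continuous_iff_continuousAt.2 fun x => (h.hψ x).continuousAt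

/-- `φ1` has slope at least `κ`, so it reaches `lam` within distance `|lam - φ1 0| / κ` of the
origin. The point found is the mode of the convex weight tilted by `lam`. -/
theorem exists_center (h : Decomposition V φ φ1 φ2 ψ ψ1 ψ2 κ L M) (lam : ℝ) :
    ∃ m, φ1 m = lam := by
  set d := |lam - φ1 0| / κ with hd
  have hd0 : 0 ≤ d := div_nonneg (abs_nonneg _) h.κ_pos.le
  have hκd : κ * d = |lam - φ1 0| := by rw [hd]; field_simp [h.κ_pos.ne']
  have h1 := h.slope_lower hd0
  have h2 := h.slope_lower (neg_nonpos.2 hd0)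
  have := intermediate_value_Icc (by linarith : -d ≤ d) h.cont_φ1.continuousOn
  obtain ⟨m, -, hm⟩ := this (show lam ∈ Set.Icc (φ1 (-d)) (φ1 d) from
    ⟨by linarith [neg_abs_le (lam - φ1 0)], by linarith [le_abs_self (lam - φ1 0)]⟩)
  exact ⟨m, hm⟩

theorem center_lower (h : Decomposition V φ φ1 φ2 ψ ψ1 ψ2 κ L M) (m x : ℝ) :
    κ * (x - m) ^ 2 ≤ (x - m) * (φ1 x - φ1 m) := by
  rcases le_total m x with hx | hx
  · nlinarith [h.slope_lower hx]
  · nlinarith [h.slope_lower hx]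

theorem center_upper (h : Decomposition V φ φ1 φ2 ψ ψ1 ψ2 κ L M) (m x : ℝ) :
    |φ1 x - φ1 m| ≤ L * |x - m| := by
  rcases le_total m x with hx | hx
  · rw [abs_of_nonneg (sub_nonneg.2 hx), abs_of_nonneg]
    · exact h.slope_upper hx
    · nlinarith [h.slope_lower hx, h.κ_pos]
  · rw [abs_of_nonpos (sub_nonpos.2 hx), abs_of_nonpos]
    · linarith [h.slope_upper hx]
    · nlinarith [h.slope_lower hx, h.κ_pos]

theorem quadratic_lower (h : Decomposition V φ φ1 φ2 ψ ψ1 ψ2 κ L M) (m x : ℝ) :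
    φ m + φ1 m * (x - m) + κ / 2 * (x - m) ^ 2 ≤ φ x := by
  have hd : ∀ t, HasDerivAt (fun t => φ t - φ1 m * (t - m) - κ / 2 * (t - m) ^ 2)
      (φ1 t - φ1 m - κ * (t - m)) t := fun t => by
    have h1 : HasDerivAt (fun t => t - m) 1 t := (hasDerivAt_id t).sub_const m
    exact (((h.hφ t).sub (h1.const_mul (φ1 m))).sub ((h1.pow 2).const_mul (κ / 2))).congr_deriv
      (by simp; ring)
  have hc : Continuous fun t => φ t - φ1 m * (t - m) - κ / 2 * (t - m) ^ 2 :=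
    continuous_iff_continuousAt.2 fun t => (hd t).continuousAt
  rcases le_total m x with hx | hx
  · have := monotoneOn_of_deriv_nonneg (convex_Ici m) hc.continuousOn
      (fun t _ => (hd t).differentiableAt.differentiableWithinAt)
      (fun t ht => by
        rw [interior_Ici] at ht
        rw [(hd t).deriv]; linarith [h.slope_lower (le_of_lt ht)])
      (Set.self_mem_Ici) hx hx
    simp only [sub_self, mul_zero] at this
    linarith
  · have := antitoneOn_of_deriv_nonpos (convex_Iic m) hc.continuousOn
      (fun t _ => (hd t).differentiableAt.differentiableWithinAt)
      (fun t ht => by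
        rw [interior_Iic] at ht
        rw [(hd t).deriv]; linarith [h.slope_lower (le_of_lt ht)])
      hx (Set.self_mem_Iic) hx
    simp only [sub_self, mul_zero] at this
    linarith

/-- Around the mode the weight is dominated by a Gaussian of curvature `κ`. -/
theorem integrable_exp (h : Decomposition V φ φ1 φ2 ψ ψ1 ψ2 κ L M) (lam : ℝ) :
    Integrable (fun x => Real.exp (lam * x - φ x)) := by
  obtain ⟨m, hm⟩ := h.exists_center lam
  have hG : Integrable (fun x => Real.exp (lam * m - φ m) * Real.exp (-(κ / 2) * (x - m) ^ 2)) :=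
    ((integrable_exp_neg_mul_sq (half_pos h.κ_pos)).comp_sub_right m).const_mul _
  have hc := h.cont_φ
  refine hG.mono' (by fun_prop) (ae_of_all _ fun x => ?_)
  rw [Real.norm_eq_abs, Real.abs_exp, ← Real.exp_add]
  refine Real.exp_le_exp.2 ?_
  have := h.quadratic_lower m x
  rw [hm] at this
  linarith

theorem one_add_abs_pow_le (n : ℕ) (x : ℝ) :
    (1 + |x|) ^ n ≤ (n.factorial * Real.exp 1) * (Real.exp x + Real.exp (-x)) := by
  have h1 := Real.pow_div_factorial_le_exp (1 + |x|) (by positivity) n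
  rw [div_le_iff₀ (by positivity)] at h1
  have h2 : Real.exp |x| ≤ Real.exp x + Real.exp (-x) := by
    rcases abs_cases x with ⟨hx, -⟩ | ⟨hx, -⟩ <;> rw [hx] <;>
      linarith [Real.exp_pos x, Real.exp_pos (-x)]
  calc (1 + |x|) ^ n ≤ Real.exp (1 + |x|) * n.factorial := h1
    _ = (n.factorial * Real.exp 1) * Real.exp |x| := by rw [Real.exp_add]; ring
    _ ≤ _ := by gcongr

/-- A polynomial is dominated by `exp x + exp (-x)`, which only shifts the tilt by ±1. -/
theorem integrable_mul_exp (h : Decomposition V φ φ1 φ2 ψ ψ1 ψ2 κ L M) (lam : ℝ) {f : ℝ → ℝ}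
    (hf : PolyBdd f) (hc : Continuous f) :
    Integrable (fun x => f x * Real.exp (lam * x - φ x)) := by
  obtain ⟨C, n, hC, hf⟩ := hf
  have hi := ((h.integrable_exp (lam + 1)).add (h.integrable_exp (lam - 1))).const_mul
    (C * (n.factorial * Real.exp 1))
  have := h.cont_φ
  refine hi.mono' (by fun_prop) (ae_of_all _ fun x => ?_)
  rw [Real.norm_eq_abs, abs_mul, Real.abs_exp]
  calc |f x| * Real.exp (lam * x - φ x)
      ≤ (C * ((n.factorial * Real.exp 1) * (Real.exp x + Real.exp (-x))))
        * Real.exp (lam * x - φ x) := by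
        gcongr
        exact (hf x).trans (by gcongr; exact one_add_abs_pow_le n x)
    _ = C * (n.factorial * Real.exp 1) * (Real.exp ((lam + 1) * x - φ x)
        + Real.exp ((lam - 1) * x - φ x)) := by
        rw [show (lam + 1) * x - φ x = x + (lam * x - φ x) by ring,
          show (lam - 1) * x - φ x = -x + (lam * x - φ x) by ring, Real.exp_add, Real.exp_add]
        ring

/-- The Poincaré inequality for the uniformly log-concave weight, with the value at the mode in
place of the mean. -/
theorem poincare_convex (h : Decomposition V φ φ1 φ2 ψ ψ1 ψ2 κ L M) (m : ℝ) {g g' : ℝ → ℝ}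
    (hg : Test g g') :
    κ * ∫ x, (g x - g m) ^ 2 * Real.exp (φ1 m * x - φ x)
      ≤ ∫ x, g' x ^ 2 * Real.exp (φ1 m * x - φ x) := by
  -- Write `g - g m = (x - m) * b` and integrate the derivative of `(x - m) * b ^ 2` against the
  -- weight. That derivative is `2 * g' * b - b ^ 2 ≤ g' ^ 2`, while the logarithmic derivative of
  -- the weight yields at least `κ * (x - m) ^ 2 * b ^ 2`.
  set b := dslope g m with hb
  have hgm : ∀ x, (x - m) * b x = g x - g m := fun x => by
    simpa using sub_smul_dslope g m x
  have hbm : b m = g' m := by rw [hb, dslope_same, (hg.1 m).deriv]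
  have hbc : Continuous b := by
    rw [← continuousOn_univ, hb, continuousOn_dslope Filter.univ_mem]
    exact ⟨hg.cont.continuousOn, (hg.1 m).differentiableAt⟩
  have hbp : PolyBdd b := by
    obtain ⟨D, hD⟩ := (isCompact_Icc (a := m - 1) (b := m + 1)).exists_bound_of_continuousOn
      hbc.continuousOn
    obtain ⟨C, n, hC, hf⟩ := (hg.sub (.const (g m))).3
    refine (PolyBdd.of_le (C := |D| + C) (n := n) fun x => ?_)
    have h1 : 1 ≤ (1 + |x|) ^ n := one_le_pow₀ (by linarith [abs_nonneg x])
    rcases le_total |x - m| 1 with hx | hx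
    · have := hD x ⟨by linarith [neg_abs_le (x - m)], by linarith [le_abs_self (x - m)]⟩
      rw [Real.norm_eq_abs] at this
      have h2 := le_abs_self D
      have h3 : |D| ≤ |D| * (1 + |x|) ^ n := le_mul_of_one_le_right (abs_nonneg _) h1
      have h4 : 0 ≤ C * (1 + |x|) ^ n := by positivity
      linarith
    · have h5 : |b x| ≤ |x - m| * |b x| := le_mul_of_one_le_left (abs_nonneg _) hx
      rw [← abs_mul, hgm] at h5
      have h4 : 0 ≤ |D| * (1 + |x|) ^ n := by positivity
      linarith [hf x]
  -- At `m` the quotient is only known to be continuous, so the derivative there is read off from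
  -- the slope of the whole product.
  have hBd : ∀ x, HasDerivAt (fun x => (x - m) * b x ^ 2) (2 * g' x * b x - b x ^ 2) x := by
    intro x
    by_cases hx : x = m
    · subst hx
      rw [hasDerivAt_iff_tendsto_slope]
      have : Filter.Tendsto (fun y => b y ^ 2) (nhdsWithin x {x}ᶜ) (nhds (b x ^ 2)) :=
        ((hbc.pow 2).tendsto x).mono_left nhdsWithin_le_nhds
      rw [hbm] at this ⊢
      convert this.congr' ?_ using 2
      · ring
      · filter_upwards [self_mem_nhdsWithin] with y hy
        have : y - x ≠ 0 := sub_ne_zero.2 hy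
        rw [slope_def_field]
        field_simp
        ring
    · have hne : x - m ≠ 0 := sub_ne_zero.2 hx
      have h1 : HasDerivAt (fun t => t - m) 1 x := (hasDerivAt_id x).sub_const m
      have h2 := (((hg.1 x).sub_const (g m)).pow 2).div h1 hne
      have hev : (fun x => (x - m) * b x ^ 2) =ᶠ[nhds x]
          (fun y => (g y - g m) ^ 2 / (y - m)) := by
        filter_upwards [isOpen_ne.mem_nhds hx] with y hy
        have : y - m ≠ 0 := sub_ne_zero.2 hy
        rw [← hgm y]
        field_simp
      refine (h2.congr_of_eventuallyEq hev).congr_deriv ?_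
      simp only [Pi.pow_apply]
      rw [← hgm x]
      field_simp
      ring
  set w : ℝ → ℝ := fun x => Real.exp (φ1 m * x - φ x) with hw
  have hwd : ∀ x, HasDerivAt w ((φ1 m - φ1 x) * w x) x := fun x => by
    refine (((hasDerivAt_id x).const_mul (φ1 m)).sub (h.hφ x)).exp.congr_deriv ?_
    show Real.exp (φ1 m * x - φ x) * _ = _ * Real.exp (φ1 m * x - φ x)
    ring
  have hcφ1 := h.cont_φ1
  have hpx : PolyBdd fun x => x - m := (test_sub_const m).3
  have hpφ1 : PolyBdd fun x => φ1 m - φ1 x := by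
    obtain ⟨C, n, hC, hf⟩ := hpx
    have hL : 0 ≤ L := (h.κ_pos.le.trans (h.κ_le 0)).trans (h.le_L 0)
    refine PolyBdd.of_le (C := L * C) (n := n) fun x => ?_
    rw [abs_sub_comm]
    calc _ ≤ L * |x - m| := h.center_upper m x
      _ ≤ L * (C * (1 + |x|) ^ n) := by gcongr; exact hf x
      _ = _ := by ring
  have hcg' := hg.2
  have hcg := hg.cont
  have i1 : Integrable fun x => (x - m) * b x ^ 2 * w x :=
    h.integrable_mul_exp _ (hpx.mul (hbp.pow 2)) (by fun_prop)
  have i2 : Integrable fun x => (2 * g' x * b x - b x ^ 2) * w x :=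
    h.integrable_mul_exp _ ((((PolyBdd.const 2).mul hg.4).mul hbp).sub (hbp.pow 2)) (by fun_prop)
  have i3 : Integrable fun x => ((x - m) * b x ^ 2 * (φ1 m - φ1 x)) * w x :=
    h.integrable_mul_exp _ ((hpx.mul (hbp.pow 2)).mul hpφ1) (by fun_prop)
  have i4 : Integrable fun x => (g x - g m) ^ 2 * w x :=
    h.integrable_mul_exp _ ((hg.sub (.const (g m))).3.pow 2) (by fun_prop)
  have i5 : Integrable fun x => g' x ^ 2 * w x :=
    h.integrable_mul_exp _ (hg.4.pow 2) (by fun_prop)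
  have hz := integral_eq_zero_of_hasDerivAt_of_integrable
    (f := fun x => (x - m) * b x ^ 2 * w x)
    (f' := fun x => (2 * g' x * b x - b x ^ 2) * w x
      + ((x - m) * b x ^ 2 * (φ1 m - φ1 x)) * w x)
    (fun x => by
      refine ((hBd x).mul (hwd x)).congr_deriv ?_
      show _ + (x - m) * b x ^ 2 * _ = _
      ring) (i2.add i3) i1
  rw [integral_add i2 i3] at hz
  have hpos : ∀ x, 0 < w x := fun x => Real.exp_pos _
  have l1 : ∫ x, (2 * g' x * b x - b x ^ 2) * w x ≤ ∫ x, g' x ^ 2 * w x :=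
    integral_mono i2 i5 fun x => by
      refine mul_le_mul_of_nonneg_right ?_ (hpos x).le
      nlinarith [sq_nonneg (g' x - b x)]
  have l2 : κ * ∫ x, (g x - g m) ^ 2 * w x ≤ - ∫ x, ((x - m) * b x ^ 2 * (φ1 m - φ1 x)) * w x := by
    rw [← integral_const_mul, ← integral_neg]
    refine integral_mono (i4.const_mul κ) i3.neg fun x => ?_
    show κ * ((g x - g m) ^ 2 * w x) ≤ -((x - m) * b x ^ 2 * (φ1 m - φ1 x) * w x)
    rw [← hgm x]
    have := mul_le_mul_of_nonneg_left (h.center_lower m x)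
      (mul_nonneg (sq_nonneg (b x)) (hpos x).le)
    nlinarith
  linarith

theorem exp_le (h : Decomposition V φ φ1 φ2 ψ ψ1 ψ2 κ L M) (lam x : ℝ) :
    Real.exp (lam * x - V x) ≤ Real.exp M * Real.exp (lam * x - φ x) := by
  rw [← Real.exp_add, h.eq]
  exact Real.exp_le_exp.2 (by linarith [neg_abs_le (ψ x), h.ψ_le x])

theorem le_exp (h : Decomposition V φ φ1 φ2 ψ ψ1 ψ2 κ L M) (lam x : ℝ) :
    Real.exp (lam * x - φ x) ≤ Real.exp M * Real.exp (lam * x - V x) := by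
  rw [← Real.exp_add, h.eq]
  exact Real.exp_le_exp.2 (by linarith [le_abs_self (ψ x), h.ψ_le x])

theorem integrable_mul_exp_V (h : Decomposition V φ φ1 φ2 ψ ψ1 ψ2 κ L M) (lam : ℝ) {f : ℝ → ℝ}
    (hf : PolyBdd f) (hc : Continuous f) :
    Integrable (fun x => f x * Real.exp (lam * x - V x)) := by
  have h1 := h.cont_φ
  have h2 := h.cont_ψ
  have h3 : Continuous V := by rw [funext h.eq]; fun_prop
  refine ((h.integrable_mul_exp lam hf hc).norm.const_mul (Real.exp M)).mono' (by fun_prop)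
    (ae_of_all _ fun x => ?_)
  simp only [norm_mul, Real.norm_eq_abs, Real.abs_exp]
  have := mul_le_mul_of_nonneg_left (h.exp_le lam x) (abs_nonneg (f x))
  linarith

theorem integrable_exp_V (h : Decomposition V φ φ1 φ2 ψ ψ1 ψ2 κ L M) (lam : ℝ) :
    Integrable (fun x => Real.exp (lam * x - V x)) := by
  simpa using h.integrable_mul_exp_V lam (.const 1) continuous_const

theorem isProbabilityMeasure (h : Decomposition V φ φ1 φ2 ψ ψ1 ψ2 κ L M) (lam : ℝ) :
    IsProbabilityMeasure (siteMeasure V lam) :=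
  isProbabilityMeasure_tilted (h.integrable_exp_V lam)

theorem integral_siteMeasure (V : ℝ → ℝ) (lam : ℝ) (f : ℝ → ℝ) :
    ∫ x, f x ∂(siteMeasure V lam)
      = (∫ x, f x * Real.exp (lam * x - V x)) / ∫ x, Real.exp (lam * x - V x) := by
  rw [siteMeasure, integral_tilted, ← integral_div]
  refine integral_congr_ae (ae_of_all _ fun x => ?_)
  simp only [smul_eq_mul]; ring

theorem partition_pos (h : Decomposition V φ φ1 φ2 ψ ψ1 ψ2 κ L M) (lam : ℝ) :
    0 < ∫ x, Real.exp (lam * x - V x) :=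
  integral_exp_pos (h.integrable_exp_V lam)

theorem polyInt (h : Decomposition V φ φ1 φ2 ψ ψ1 ψ2 κ L M) (lam : ℝ) :
    PolyInt (siteMeasure V lam) := by
  intro n
  rw [siteMeasure, integrable_tilted_iff]
  have := h.integrable_mul_exp_V lam (f := fun x => (1 + |x|) ^ n)
    (PolyBdd.of_le (C := 1) (n := n) fun x => by rw [abs_of_nonneg (by positivity), one_mul])
    (by fun_prop)
  simpa [mul_comm] using this
  exact h.integrable_exp_V lam

theorem test_score (h : Decomposition V φ φ1 φ2 ψ ψ1 ψ2 κ L M) (lam : ℝ) :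
    Test (fun x => φ1 x + ψ1 x - lam) (fun x => φ2 x + ψ2 x) := by
  have hL : 0 ≤ L := (h.κ_pos.le.trans (h.κ_le 0)).trans (h.le_L 0)
  have p1 : PolyBdd φ1 := by
    have : PolyBdd fun x => φ1 x - φ1 0 := PolyBdd.of_le (C := L) (n := 1) fun x => by
      have := h.center_upper 0 x
      simp only [sub_zero] at this
      rw [pow_one]; nlinarith
    simpa using this.add (.const (φ1 0))
  have p2 : PolyBdd ψ1 := PolyBdd.of_le (C := M) (n := 0) fun x => by simpa using h.ψ1_le x
  have p3 : PolyBdd φ2 := PolyBdd.of_le (C := L) (n := 0) fun x => by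
    rw [abs_of_nonneg (h.κ_pos.le.trans (h.κ_le x))]; simpa using h.le_L x
  have p4 : PolyBdd ψ2 := PolyBdd.of_le (C := M) (n := 0) fun x => by simpa using h.ψ2_le x
  exact ⟨fun x => ((h.hφ1 x).add (h.hψ1 x)).sub_const lam, h.cφ2.add h.cψ2,
    (p1.add p2).sub (.const lam), p3.add p4⟩

/-- `φ1 + ψ1 - lam` is minus the logarithmic derivative of the density, and the boundary terms
vanish. -/
theorem integral_by_parts (h : Decomposition V φ φ1 φ2 ψ ψ1 ψ2 κ L M) (lam : ℝ) {g g' : ℝ → ℝ}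
    (hg : Test g g') :
    ∫ x, g' x ∂(siteMeasure V lam) = ∫ x, g x * (φ1 x + ψ1 x - lam) ∂(siteMeasure V lam) := by
  have ht := h.test_score lam
  have hz := integral_eq_zero_of_hasDerivAt_of_integrable
    (f := fun x => g x * Real.exp (lam * x - V x))
    (f' := fun x => g' x * Real.exp (lam * x - V x)
      - (g x * (φ1 x + ψ1 x - lam)) * Real.exp (lam * x - V x))
    (fun x => by
      have hV : HasDerivAt V (φ1 x + ψ1 x) x := by
        rw [funext h.eq]; exact (h.hφ x).add (h.hψ x)
      refine ((hg.1 x).mul (((hasDerivAt_id x).const_mul lam).sub hV).exp).congr_deriv ?_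
      show g' x * Real.exp (lam * x - V x) + g x * (Real.exp (lam * x - V x) * _) = _
      ring)
    ((h.integrable_mul_exp_V lam hg.4 hg.2).sub
      (h.integrable_mul_exp_V lam (hg.mul ht).3 (hg.mul ht).cont))
    (h.integrable_mul_exp_V lam hg.3 hg.cont)
  rw [integral_sub (h.integrable_mul_exp_V lam hg.4 hg.2)
      (h.integrable_mul_exp_V lam (hg.mul ht).3 (hg.mul ht).cont), sub_eq_zero] at hz
  rw [integral_siteMeasure, integral_siteMeasure, hz]

/-- Integration by parts and Cauchy–Schwarz reduce the claim to the second moment of the score. A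
second integration by parts turns that into the mean of `φ2 + ψ2`, in which `lam` no longer appears.
-/
theorem fisherBound (h : Decomposition V φ φ1 φ2 ψ ψ1 ψ2 κ L M) (lam : ℝ) {B : ℝ} (hB : 0 < B)
    (hLM : L + M ≤ B) : FisherBound (siteMeasure V lam) (1 / B) := by
  intro g g' hg
  have := h.isProbabilityMeasure lam
  have hp := h.polyInt lam
  have ht := h.test_score lam
  have hs : ∫ x, (φ1 x + ψ1 x - lam) ^ 2 ∂(siteMeasure V lam) ≤ B := by
    simp_rw [pow_two]
    rw [← h.integral_by_parts lam ht]
    calc ∫ x, (φ2 x + ψ2 x) ∂(siteMeasure V lam) ≤ ∫ _, B ∂(siteMeasure V lam) :=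
          integral_mono (hp.integrable ht.4 ht.2) (integrable_const _) fun x => by
            show φ2 x + ψ2 x ≤ B
            linarith [h.le_L x, le_abs_self (ψ2 x), h.ψ2_le x]
      _ = B := by simp
  rw [h.integral_by_parts lam hg, div_mul_eq_mul_div, one_mul, div_le_iff₀ hB]
  refine (sq_integral_mul_le (memLp_two_of_test hp hg) (memLp_two_of_test hp ht)).trans ?_
  exact mul_le_mul_of_nonneg_left hs (integral_nonneg fun _ => sq_nonneg _)

/-- Perturbation by the bounded `ψ` (Holley–Stroock): passing between the weights of `V` and `φ`
costs `exp M` each way, and replacing the value at the mode by the mean only decreases the left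
side. -/
theorem poincare (h : Decomposition V φ φ1 φ2 ψ ψ1 ψ2 κ L M) (lam : ℝ) {B : ℝ}
    (hB : Real.exp M * Real.exp M / κ ≤ B) : Poincare (siteMeasure V lam) B := by
  intro g g' hg
  have := h.isProbabilityMeasure lam
  have hp := h.polyInt lam
  obtain ⟨m, hm⟩ := h.exists_center lam
  have hgm := hg.sub (.const (g m))
  have i1 := hp.integrable hg.3 hg.cont
  have e := integral_sub_const_sq i1 (hp.integrable (hg.3.pow 2) (hg.cont.pow 2)) (g m)
  have key := h.poincare_convex m hg
  rw [hm] at key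
  have hZ := h.partition_pos lam
  have hM := Real.exp_pos M
  have j1 := h.integrable_mul_exp_V lam (hgm.3.pow 2) (hgm.cont.pow 2)
  have j2 := h.integrable_mul_exp_V lam (hg.4.pow 2) (hg.2.pow 2)
  have j3 := h.integrable_mul_exp lam (hgm.3.pow 2) (hgm.cont.pow 2)
  have j4 := h.integrable_mul_exp lam (hg.4.pow 2) (hg.2.pow 2)
  have l1 : ∫ x, (g x - g m) ^ 2 * Real.exp (lam * x - V x)
      ≤ Real.exp M * ∫ x, (g x - g m) ^ 2 * Real.exp (lam * x - φ x) := by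
    rw [← integral_const_mul]
    refine integral_mono j1 (j3.const_mul _) fun x => ?_
    have := mul_le_mul_of_nonneg_left (h.exp_le lam x) (sq_nonneg (g x - g m))
    show (g x - g m) ^ 2 * Real.exp (lam * x - V x)
      ≤ Real.exp M * ((g x - g m) ^ 2 * Real.exp (lam * x - φ x))
    linarith
  have l2 : ∫ x, g' x ^ 2 * Real.exp (lam * x - φ x)
      ≤ Real.exp M * ∫ x, g' x ^ 2 * Real.exp (lam * x - V x) := by
    rw [← integral_const_mul]
    refine integral_mono j4 (j2.const_mul _) fun x => ?_
    have := mul_le_mul_of_nonneg_left (h.le_exp lam x) (sq_nonneg (g' x))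
    show g' x ^ 2 * Real.exp (lam * x - φ x)
      ≤ Real.exp M * (g' x ^ 2 * Real.exp (lam * x - V x))
    linarith
  have hI : 0 ≤ ∫ x, g' x ^ 2 * Real.exp (lam * x - V x) :=
    integral_nonneg fun x => mul_nonneg (sq_nonneg _) (Real.exp_pos _).le
  have l3 : ∫ x, (g x - g m) ^ 2 * Real.exp (lam * x - V x)
      ≤ B * ∫ x, g' x ^ 2 * Real.exp (lam * x - V x) := by
    calc _ ≤ _ := l1
      _ ≤ Real.exp M * ((Real.exp M * ∫ x, g' x ^ 2 * Real.exp (lam * x - V x)) / κ) := by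
        gcongr
        rw [le_div_iff₀ h.κ_pos]
        linarith
      _ = (Real.exp M * Real.exp M / κ) * ∫ x, g' x ^ 2 * Real.exp (lam * x - V x) := by ring
      _ ≤ _ := by gcongr
  calc _ ≤ ∫ x, (g x - g m) ^ 2 ∂(siteMeasure V lam) := by
        rw [e]; linarith [sq_nonneg (∫ x, g x ∂(siteMeasure V lam) - g m)]
    _ ≤ _ := by
        rw [integral_siteMeasure, integral_siteMeasure, mul_div_assoc']
        gcongr

theorem exists_regular (h : Decomposition V φ φ1 φ2 ψ ψ1 ψ2 κ L M) :
    ∃ B, ∀ lam, Regular (siteMeasure V lam) B := by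
  refine ⟨max 1 (max (L + M) (Real.exp M * Real.exp M / κ)), fun lam => ⟨h.polyInt lam,
    le_max_left _ _, h.fisherBound lam (lt_of_lt_of_le one_pos (le_max_left _ _))
      ((le_max_left _ _).trans (le_max_right _ _)),
    h.poincare lam ((le_max_right _ _).trans (le_max_right _ _))⟩⟩

end Decomposition

/-! ### Exponential moments and derivatives in the chemical potential -/

section expMoments
variable {Ω : Type*} {mΩ : MeasurableSpace Ω} {μ : Measure Ω} {X F : Ω → ℝ}

/-- A nonnegative `F` is absorbed into the measure as a density. Its exponential moments are finite
for every `t`, so every `t` is interior to the domain of the moment generating function. -/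
theorem expMoment_of_nonneg (hF : AEMeasurable F μ) (h0 : ∀ ω, 0 ≤ F ω)
    (hi : ∀ t : ℝ, Integrable (fun ω => F ω * Real.exp (t * X ω)) μ) (n : ℕ) (t : ℝ) :
    Integrable (fun ω => F ω * X ω ^ n * Real.exp (t * X ω)) μ ∧
    HasDerivAt (fun t => ∫ ω, F ω * X ω ^ n * Real.exp (t * X ω) ∂μ)
      (∫ ω, F ω * X ω ^ (n + 1) * Real.exp (t * X ω) ∂μ) t := by
  set κ := μ.withDensity fun ω => ENNReal.ofReal (F ω) with hκ
  have hm : AEMeasurable (fun ω => ENNReal.ofReal (F ω)) μ := hF.ennreal_ofReal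
  have htop : ∀ᵐ ω ∂μ, ENNReal.ofReal (F ω) < ∞ := ae_of_all _ fun _ => ENNReal.ofReal_lt_top
  have hset : integrableExpSet X κ = Set.univ := by
    ext t
    simp only [Set.mem_univ, iff_true]
    show Integrable _ κ
    rw [hκ, integrable_withDensity_iff_integrable_smul₀' hm htop]
    simpa [ENNReal.toReal_ofReal (h0 _)] using hi t
  have ht : ∀ t, t ∈ interior (integrableExpSet X κ) := by simp [hset]
  have e : ∀ (n : ℕ) (t : ℝ), ∫ ω, X ω ^ n * Real.exp (t * X ω) ∂κ
      = ∫ ω, F ω * X ω ^ n * Real.exp (t * X ω) ∂μ := fun n t => by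
    rw [hκ, integral_withDensity_eq_integral_toReal_smul₀ hm htop]
    refine integral_congr_ae (ae_of_all _ fun ω => ?_)
    simp [ENNReal.toReal_ofReal (h0 ω), mul_assoc]
  constructor
  · have := integrable_pow_mul_exp_of_mem_interior_integrableExpSet (ht t) n
    rw [hκ, integrable_withDensity_iff_integrable_smul₀' hm htop] at this
    simpa [ENNReal.toReal_ofReal (h0 _), mul_assoc] using this
  · have := hasDerivAt_integral_pow_mul_exp_real (ht t) n
    rw [e] at this
    exact this.congr_of_eventuallyEq (Filter.Eventually.of_forall fun t => (e n t).symm)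

theorem expMoment (hF : AEMeasurable F μ)
    (hi : ∀ t : ℝ, Integrable (fun ω => F ω * Real.exp (t * X ω)) μ) (n : ℕ) (t : ℝ) :
    Integrable (fun ω => F ω * X ω ^ n * Real.exp (t * X ω)) μ ∧
    HasDerivAt (fun t => ∫ ω, F ω * X ω ^ n * Real.exp (t * X ω) ∂μ)
      (∫ ω, F ω * X ω ^ (n + 1) * Real.exp (t * X ω) ∂μ) t := by
  have hab : ∀ t : ℝ, Integrable (fun ω => |F ω| * Real.exp (t * X ω)) μ := fun t =>
    (hi t).abs.congr (ae_of_all _ fun ω => by simp [abs_mul])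
  -- Positive and negative parts; both inherit the integrability hypothesis.
  have hp := expMoment_of_nonneg (F := fun ω => (|F ω| + F ω) / 2) (μ := μ) (X := X)
    ((hF.abs.add hF).div_const 2) (fun ω => by linarith [neg_abs_le (F ω)])
    (fun t => (((hab t).add (hi t)).div_const 2).congr (ae_of_all _ fun ω => by
      simp only [Pi.add_apply]; ring))
  have hn := expMoment_of_nonneg (F := fun ω => (|F ω| - F ω) / 2) (μ := μ) (X := X)
    ((hF.abs.sub hF).div_const 2) (fun ω => by linarith [le_abs_self (F ω)])
    (fun t => (((hab t).sub (hi t)).div_const 2).congr (ae_of_all _ fun ω => by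
      simp only [Pi.sub_apply]; ring))
  have e : ∀ (n : ℕ) (t : ℝ) (ω : Ω), F ω * X ω ^ n * Real.exp (t * X ω)
      = (|F ω| + F ω) / 2 * X ω ^ n * Real.exp (t * X ω)
        - (|F ω| - F ω) / 2 * X ω ^ n * Real.exp (t * X ω) := fun n t ω => by ring
  have ei : ∀ (n : ℕ) (t : ℝ), ∫ ω, F ω * X ω ^ n * Real.exp (t * X ω) ∂μ
      = ∫ ω, (|F ω| + F ω) / 2 * X ω ^ n * Real.exp (t * X ω) ∂μ
        - ∫ ω, (|F ω| - F ω) / 2 * X ω ^ n * Real.exp (t * X ω) ∂μ := fun n t => by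
    rw [← integral_sub (hp n t).1 (hn n t).1]
    exact integral_congr_ae (ae_of_all _ (e n t))
  refine ⟨((hp n t).1.sub (hn n t).1).congr (ae_of_all _ fun ω => (e n t ω).symm), ?_⟩
  rw [ei]
  exact ((hp n t).2.sub (hn n t).2).congr_of_eventuallyEq
    (Filter.Eventually.of_forall fun t => ei n t)

end expMoments

/-- The `k`-th moment of a spin. -/
noncomputable def spinMoment (V : ℝ → ℝ) (k : ℕ) (lam : ℝ) : ℝ := ∫ x, x ^ k ∂(siteMeasure V lam)

section site
variable {V φ φ1 φ2 ψ ψ1 ψ2 : ℝ → ℝ} {κ L M : ℝ}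

namespace Decomposition

theorem continuous_V (h : Decomposition V φ φ1 φ2 ψ ψ1 ψ2 κ L M) : Continuous V := by
  have h1 := h.cont_φ
  have h2 := h.cont_ψ
  rw [funext h.eq]; fun_prop

theorem hasDerivAt_weightMoment (h : Decomposition V φ φ1 φ2 ψ ψ1 ψ2 κ L M) (k : ℕ) (lam : ℝ) :
    HasDerivAt (fun lam => ∫ x, x ^ k * Real.exp (lam * x - V x))
      (∫ x, x ^ (k + 1) * Real.exp (lam * x - V x)) lam := by
  have hc := h.continuous_V
  have e : ∀ t x : ℝ, Real.exp (-V x) * Real.exp (t * x) = Real.exp (t * x - V x) := fun t x => by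
    rw [← Real.exp_add]; ring_nf
  have := (expMoment (μ := (volume : Measure ℝ)) (X := fun x => x) (F := fun x => Real.exp (-V x))
    (by fun_prop) (fun t => by simpa only [e] using h.integrable_exp_V t) k lam).2
  have e2 : ∀ (k : ℕ) (t x : ℝ), Real.exp (-V x) * x ^ k * Real.exp (t * x)
      = x ^ k * Real.exp (t * x - V x) := fun k t x => by rw [← e]; ring
  simpa only [e2] using this

theorem spinMoment_eq (V : ℝ → ℝ) (k : ℕ) (lam : ℝ) :
    spinMoment V k lam = (∫ x, x ^ k * Real.exp (lam * x - V x))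
      / ∫ x, x ^ 0 * Real.exp (lam * x - V x) := by
  rw [spinMoment, integral_siteMeasure]; simp

theorem meanSpin_eq (V : ℝ → ℝ) (lam : ℝ) : meanSpin V lam = spinMoment V 1 lam := by
  simp [meanSpin, spinMoment]

theorem hasDerivAt_spinMoment (h : Decomposition V φ φ1 φ2 ψ ψ1 ψ2 κ L M) (k : ℕ) (lam : ℝ) :
    HasDerivAt (spinMoment V k)
      (spinMoment V (k + 1) lam - spinMoment V 1 lam * spinMoment V k lam) lam := by
  have hZ : (∫ x, x ^ 0 * Real.exp (lam * x - V x)) ≠ 0 := by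
    simpa using (h.partition_pos lam).ne'
  rw [show spinMoment V k = _ from funext (spinMoment_eq V k)]
  refine ((h.hasDerivAt_weightMoment k lam).div (h.hasDerivAt_weightMoment 0 lam) hZ).congr_deriv ?_
  simp only [spinMoment_eq, zero_add]
  field_simp

theorem integrable_pow (h : Decomposition V φ φ1 φ2 ψ ψ1 ψ2 κ L M) (k : ℕ) (lam : ℝ) :
    Integrable (fun x => x ^ k) (siteMeasure V lam) :=
  (h.polyInt lam).integrable (PolyBdd.id.pow k) (continuous_pow k)

theorem sigmaSq_eq (h : Decomposition V φ φ1 φ2 ψ ψ1 ψ2 κ L M) (lam : ℝ) :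
    sigmaSq V lam = spinMoment V 2 lam - spinMoment V 1 lam ^ 2 := by
  have := h.isProbabilityMeasure lam
  have i1 : Integrable (fun x : ℝ => x) (siteMeasure V lam) := by simpa using h.integrable_pow 1 lam
  have := integral_sub_const_sq i1 (h.integrable_pow 2 lam) 0
  simp only [sub_zero] at this
  rw [← meanSpin_eq, spinMoment, this, sigmaSq]
  simp only [meanSpin]
  ring

theorem thirdMoment_eq (h : Decomposition V φ φ1 φ2 ψ ψ1 ψ2 κ L M) (lam : ℝ) :
    thirdMoment (siteMeasure V lam) = spinMoment V 3 lam
      - 3 * spinMoment V 1 lam * spinMoment V 2 lam + 2 * spinMoment V 1 lam ^ 3 := by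
  have := h.isProbabilityMeasure lam
  have i1 : Integrable (fun x : ℝ => x) (siteMeasure V lam) := by simpa using h.integrable_pow 1 lam
  have i2 := h.integrable_pow 2 lam
  have i3 := h.integrable_pow 3 lam
  have hm : mean1 (siteMeasure V lam) = spinMoment V 1 lam := meanSpin_eq V lam
  have hm' : ∫ x, x ∂(siteMeasure V lam) = spinMoment V 1 lam := meanSpin_eq V lam
  set a := spinMoment V 1 lam
  have e : ∀ x : ℝ, (x - a) ^ 3 = x ^ 3 - 3 * a * x ^ 2 + 3 * a ^ 2 * x - a ^ 3 := fun x => by ring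
  have j1 : Integrable (fun x => x ^ 3 - 3 * a * x ^ 2) (siteMeasure V lam) :=
    i3.sub (i2.const_mul _)
  have j2 : Integrable (fun x => x ^ 3 - 3 * a * x ^ 2 + 3 * a ^ 2 * x) (siteMeasure V lam) :=
    j1.add (i1.const_mul _)
  rw [thirdMoment, hm]
  simp_rw [e]
  rw [integral_sub j2 (integrable_const _), integral_add j1 (i1.const_mul _),
    integral_sub i3 (i2.const_mul _), integral_const_mul, integral_const_mul, hm']
  simp only [integral_const, probReal_univ, smul_eq_mul, one_mul, spinMoment]
  ring

theorem hasDerivAt_meanSpin (h : Decomposition V φ φ1 φ2 ψ ψ1 ψ2 κ L M) (lam : ℝ) :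
    HasDerivAt (meanSpin V) (sigmaSq V lam) lam := by
  rw [show meanSpin V = _ from funext (meanSpin_eq V)]
  refine (h.hasDerivAt_spinMoment 1 lam).congr_deriv ?_
  rw [h.sigmaSq_eq]; ring

theorem hasDerivAt_sigmaSq (h : Decomposition V φ φ1 φ2 ψ ψ1 ψ2 κ L M) (lam : ℝ) :
    HasDerivAt (sigmaSq V) (thirdMoment (siteMeasure V lam)) lam := by
  rw [show sigmaSq V = _ from funext h.sigmaSq_eq]
  refine ((h.hasDerivAt_spinMoment 2 lam).sub
    ((h.hasDerivAt_spinMoment 1 lam).pow 2)).congr_deriv ?_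
  rw [h.thirdMoment_eq]
  simp
  ring

theorem hasDerivAt_logPartition (h : Decomposition V φ φ1 φ2 ψ ψ1 ψ2 κ L M) (lam : ℝ) :
    HasDerivAt (logPartition V) (meanSpin V lam) lam := by
  have h0 := h.hasDerivAt_weightMoment 0 lam
  have hZ := h.partition_pos lam
  simp only [pow_zero, one_mul, zero_add] at h0
  refine (h0.log hZ.ne').congr_deriv ?_
  rw [meanSpin_eq, spinMoment_eq]; simp

theorem continuous_meanSpin (h : Decomposition V φ φ1 φ2 ψ ψ1 ψ2 κ L M) :
    Continuous (meanSpin V) :=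
  continuous_iff_continuousAt.2 fun x => (h.hasDerivAt_meanSpin x).continuousAt

theorem continuous_sigmaSq (h : Decomposition V φ φ1 φ2 ψ ψ1 ψ2 κ L M) :
    Continuous (sigmaSq V) :=
  continuous_iff_continuousAt.2 fun x => (h.hasDerivAt_sigmaSq x).continuousAt

theorem continuous_thirdMoment (h : Decomposition V φ φ1 φ2 ψ ψ1 ψ2 κ L M) :
    Continuous fun lam => thirdMoment (siteMeasure V lam) := by
  have hk : ∀ k, Continuous (spinMoment V k) := fun k =>
    continuous_iff_continuousAt.2 fun x => (h.hasDerivAt_spinMoment k x).continuousAt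
  have h1 := hk 1
  have h2 := hk 2
  have h3 := hk 3
  simp_rw [h.thirdMoment_eq]
  fun_prop

theorem sigmaSq_pos (h : Decomposition V φ φ1 φ2 ψ ψ1 ψ2 κ L M) (lam : ℝ) : 0 < sigmaSq V lam := by
  obtain ⟨B, hB⟩ := h.exists_regular
  have := h.isProbabilityMeasure lam
  exact (hB lam).var1_pos

theorem strictMono_meanSpin (h : Decomposition V φ φ1 φ2 ψ ψ1 ψ2 κ L M) :
    StrictMono (meanSpin V) :=
  strictMono_of_deriv_pos fun x => by
    rw [(h.hasDerivAt_meanSpin x).deriv]; exact h.sigmaSq_pos x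

/-- The Cramér–Rao bound `1 ≤ B * sigmaSq` keeps the slope of the mean spin above `1 / B`, so it is
unbounded in both directions. -/
theorem surjective_meanSpin (h : Decomposition V φ φ1 φ2 ψ ψ1 ψ2 κ L M) :
    Function.Surjective (meanSpin V) := by
  obtain ⟨B, hB⟩ := h.exists_regular
  have hB0 : 0 < B := by linarith [(hB 0).one_le]
  have hmono : Monotone fun t => B * meanSpin V t - t := by
    have hd : ∀ t, HasDerivAt (fun t => B * meanSpin V t - t) (B * sigmaSq V t - 1) t := fun t =>
      ((h.hasDerivAt_meanSpin t).const_mul B).sub (hasDerivAt_id t)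
    refine monotone_of_deriv_nonneg (fun t => (hd t).differentiableAt) fun t => ?_
    rw [(hd t).deriv]
    have := h.isProbabilityMeasure t
    have h1 : 1 ≤ B * sigmaSq V t := (hB t).one_le_mul_var1
    linarith
  intro y
  set d := B * |y - meanSpin V 0| with hd
  have hd0 : 0 ≤ d := by positivity
  have h1 := hmono hd0
  have h2 := hmono (neg_nonpos.2 hd0)
  simp only at h1 h2
  have hr : B * (y - meanSpin V 0) ≤ d := mul_le_mul_of_nonneg_left (le_abs_self _) hB0.le
  have hl : B * -(y - meanSpin V 0) ≤ d := mul_le_mul_of_nonneg_left (neg_le_abs _) hB0.le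
  have hle : y ≤ meanSpin V d := by
    refine le_of_mul_le_mul_left ?_ hB0; linarith
  have hge : meanSpin V (-d) ≤ y := by
    refine le_of_mul_le_mul_left ?_ hB0; linarith
  obtain ⟨x, -, hx⟩ := intermediate_value_Icc (by linarith : -d ≤ d)
    h.continuous_meanSpin.continuousOn ⟨hge, hle⟩
  exact ⟨x, hx⟩

/-- Convexity, from monotonicity of the derivative; it identifies where the supremum in the Legendre
transform is attained. -/
theorem logPartition_tangent (h : Decomposition V φ φ1 φ2 ψ ψ1 ψ2 κ L M) (a t : ℝ) :
    logPartition V a + meanSpin V a * (t - a) ≤ logPartition V t := by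
  have hd : ∀ t, HasDerivAt (fun t => logPartition V t - meanSpin V a * (t - a))
      (meanSpin V t - meanSpin V a) t := fun t =>
    ((h.hasDerivAt_logPartition t).sub (((hasDerivAt_id t).sub_const a).const_mul
      (meanSpin V a))).congr_deriv (by simp)
  have hc : Continuous fun t => logPartition V t - meanSpin V a * (t - a) :=
    continuous_iff_continuousAt.2 fun t => (hd t).continuousAt
  rcases le_total a t with hx | hx
  · have := monotoneOn_of_deriv_nonneg (convex_Ici a) hc.continuousOn
      (fun t _ => (hd t).differentiableAt.differentiableWithinAt)
      (fun t ht => by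
        rw [interior_Ici] at ht
        rw [(hd t).deriv]; linarith [h.strictMono_meanSpin.monotone (le_of_lt ht)])
      (Set.self_mem_Ici) hx hx
    simp only [sub_self, mul_zero] at this
    linarith
  · have := antitoneOn_of_deriv_nonpos (convex_Iic a) hc.continuousOn
      (fun t _ => (hd t).differentiableAt.differentiableWithinAt)
      (fun t ht => by
        rw [interior_Iic] at ht
        rw [(hd t).deriv]; linarith [h.strictMono_meanSpin.monotone (le_of_lt ht)])
      hx (Set.self_mem_Iic) hx
    simp only [sub_self, mul_zero] at this
    linarith

/-- The derivative of the Legendre transform is the inverse function of the mean spin. -/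
theorem exists_deriv_legendre (h : Decomposition V φ φ1 φ2 ψ ψ1 ψ2 κ L M) :
    (∀ lam, deriv (legendre V) (meanSpin V lam) = lam) ∧
    (∀ r, meanSpin V (deriv (legendre V) r) = r) ∧
    (∀ r, HasDerivAt (deriv (legendre V)) (sigmaSq V (deriv (legendre V) r))⁻¹ r) := by
  set e := h.strictMono_meanSpin.orderIsoOfSurjective _ h.surjective_meanSpin with he
  have h1 : ∀ r, meanSpin V (e.symm r) = r := fun r => e.apply_symm_apply r
  have h2 : ∀ t, e.symm (meanSpin V t) = t := fun t => e.symm_apply_apply t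
  have hd : ∀ r, HasDerivAt e.symm (sigmaSq V (e.symm r))⁻¹ r := fun r =>
    HasDerivAt.of_local_left_inverse e.symm.continuous.continuousAt
      (h.hasDerivAt_meanSpin _) (h.sigmaSq_pos _).ne' (Filter.Eventually.of_forall h1)
  have hleg : ∀ r, legendre V r = e.symm r * r - logPartition V (e.symm r) := fun r => by
    have hle : ∀ t, t * r - logPartition V t ≤ e.symm r * r - logPartition V (e.symm r) := fun t => by
      have := h.logPartition_tangent (e.symm r) t
      rw [h1] at this
      linarith
    exact le_antisymm (ciSup_le hle) (le_ciSup (f := fun t => t * r - logPartition V t)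
      ⟨_, by rintro _ ⟨t, rfl⟩; exact hle t⟩ (e.symm r))
  have hder : ∀ r, HasDerivAt (legendre V) (e.symm r) r := fun r => by
    rw [funext hleg]
    refine (((hd r).mul (hasDerivAt_id r)).sub
      ((h.hasDerivAt_logPartition (e.symm r)).comp r (hd r))).congr_deriv ?_
    simp [h1]; ring
  have hde : deriv (legendre V) = e.symm := funext fun r => (hder r).deriv
  rw [hde]
  exact ⟨h2, h1, hd⟩

theorem siteMeasure_eq_tilted (h : Decomposition V φ φ1 φ2 ψ ψ1 ψ2 κ L M) (lam : ℝ) :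
    siteMeasure V lam = (siteMeasure V 0).tilted (fun x => lam * x) := by
  rw [siteMeasure, siteMeasure, tilted_tilted]
  · congr 1; ext x; simp; ring
  · exact h.integrable_exp_V 0

theorem integrable_exp_mul_site (h : Decomposition V φ φ1 φ2 ψ ψ1 ψ2 κ L M) (a t : ℝ) :
    Integrable (fun x => Real.exp (t * x)) (siteMeasure V a) := by
  rw [siteMeasure, integrable_tilted_iff (h.integrable_exp_V a)]
  refine (h.integrable_exp_V (a + t)).congr (ae_of_all _ fun x => ?_)
  simp only [smul_eq_mul, ← Real.exp_add]; ring_nf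

end Decomposition
end site

/-! ### Tilting the product measure and differentiating the grand canonical expectation -/

namespace Decomposition
variable {V φ φ1 φ2 ψ ψ1 ψ2 : ℝ → ℝ} {κ L M : ℝ}

theorem mgf_sumOn (h : Decomposition V φ φ1 φ2 ψ ψ1 ψ2 κ L M) (A : Finset ℤ) (t : ℝ) :
    Integrable (fun u => Real.exp (t * sumOn A u)) (stationaryMeasure V 0) ∧
    ∫ u, Real.exp (t * sumOn A u) ∂(stationaryMeasure V 0)
      = (∫ x, Real.exp (t * x) ∂(siteMeasure V 0)) ^ A.card := by
  have := h.isProbabilityMeasure 0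
  have hind := iIndepFun_coord (siteMeasure V 0)
  have hs : (∑ i ∈ A, fun u : ℤ → ℝ => u i) = sumOn A := by ext u; simp [sumOn]
  have hi : ∀ i : ℤ, Integrable (fun u : ℤ → ℝ => Real.exp (t * u i)) (stationaryMeasure V 0) :=
    fun i => by
      have h0 := h.integrable_exp_mul_site 0 t
      rw [← Measure.infinitePi_map_eval (fun _ : ℤ => siteMeasure V 0) i] at h0
      exact h0.comp_measurable (measurable_pi_apply i)
  constructor
  · have := hind.integrable_exp_mul_sum (fun i => measurable_pi_apply i) (s := A) (t := t)
      (fun i _ => hi i)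
    rwa [hs] at this
  · have := hind.mgf_sum (fun i => measurable_pi_apply i) A (t := t)
    rw [hs] at this
    refine this.trans ?_
    have e : ∀ i : ℤ, mgf (fun u : ℤ → ℝ => u i) (stationaryMeasure V 0) t
        = ∫ x, Real.exp (t * x) ∂(siteMeasure V 0) := fun i =>
      integral_coord (k := fun x => Real.exp (t * x)) (by fun_prop) i
    exact (Finset.prod_congr rfl fun i _ => e i).trans (by simp)

/-- On infinitely many sites the measures for different parameters are mutually singular. Only the
marginals on a finite set are related by a density, and that density is a function of the sum over
this set. -/
theorem map_restrict_tilted (h : Decomposition V φ φ1 φ2 ψ ψ1 ψ2 κ L M) (A : Finset ℤ) (lam : ℝ) :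
    ((stationaryMeasure V 0).tilted fun u => lam * sumOn A u).map A.restrict
      = (stationaryMeasure V lam).map A.restrict := by
  have := h.isProbabilityMeasure 0
  have := h.isProbabilityMeasure lam
  have hmeas := A.measurable_restrict (X := fun _ : ℤ => ℝ)
  rw [stationaryMeasure, stationaryMeasure, Measure.infinitePi_map_restrict]
  symm
  refine Measure.pi_eq fun s hs => ?_
  have hsA : MeasurableSet (A.restrict ⁻¹' Set.pi Set.univ s : Set (ℤ → ℝ)) :=
    hmeas (MeasurableSet.univ_pi hs)
  set m := ∫ x, Real.exp (lam * x) ∂(siteMeasure V 0) with hm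
  have hmgf := (h.mgf_sumOn A lam).2
  rw [stationaryMeasure] at hmgf
  rw [Measure.map_apply hmeas (MeasurableSet.univ_pi hs), tilted_apply' _ _ hsA, hmgf,
    ← lintegral_indicator hsA]
  set k : A → ℝ → ℝ≥0∞ := fun i => (s i).indicator fun x => ENNReal.ofReal (Real.exp (lam * x) / m)
  have hk : ∀ i, Measurable (k i) := fun i =>
    Measurable.indicator (by fun_prop) (hs i)
  have hprod : ∀ u : ℤ → ℝ, (A.restrict ⁻¹' Set.pi Set.univ s).indicator
      (fun u => ENNReal.ofReal (Real.exp (lam * sumOn A u) / m ^ A.card)) u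
      = ∏ i : A, k i (u i) := by
    intro u
    by_cases hu : u ∈ A.restrict ⁻¹' Set.pi Set.univ s
    · have hu' : ∀ i : A, u i ∈ s i := fun i => hu i (Set.mem_univ i)
      rw [Set.indicator_of_mem hu]
      have : ∀ i : A, k i (u i) = ENNReal.ofReal (Real.exp (lam * u i) / m) := fun i =>
        Set.indicator_of_mem (hu' i) _
      simp_rw [this]
      rw [← ENNReal.ofReal_prod_of_nonneg, Finset.prod_div_distrib, ← Real.exp_sum,
        ← Finset.mul_sum, Finset.sum_coe_sort A (fun i => u i)]
      · rw [Finset.prod_const, Finset.card_univ, Fintype.card_coe]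
        rfl
      · intro i _
        have : 0 ≤ m := integral_nonneg fun _ => (Real.exp_pos _).le
        positivity
    · rw [Set.indicator_of_notMem hu]
      have : ∃ i : A, u i ∉ s i := by
        by_contra hc
        push Not at hc
        exact hu fun i _ => hc i
      obtain ⟨i, hi⟩ := this
      exact (Finset.prod_eq_zero (Finset.mem_univ i) (Set.indicator_of_notMem hi _)).symm
  refine (lintegral_congr hprod).trans ?_
  have hind : iIndepFun (fun (i : A) (u : ℤ → ℝ) => k i (u i))
      (Measure.infinitePi fun _ : ℤ => siteMeasure V 0) :=
    ((iIndepFun_coord (siteMeasure V 0)).precomp Subtype.val_injective).comp k hk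
  rw [lintegral_prod_eq_prod_lintegral_of_indepFun _ _ hind fun i =>
    (hk i).comp (measurable_pi_apply _)]
  refine Finset.prod_congr rfl fun i _ => ?_
  rw [h.siteMeasure_eq_tilted lam, tilted_apply' _ _ (hs i), ← lintegral_indicator (hs i),
    ← lintegral_map (hk i) (measurable_pi_apply _), Measure.infinitePi_map_eval]

theorem integral_tilted_eq (h : Decomposition V φ φ1 φ2 ψ ψ1 ψ2 κ L M) {A : Finset ℤ} (lam : ℝ)
    {G : (ℤ → ℝ) → ℝ} (hG : DependsOn G (A : Set ℤ))
    (hm : AEStronglyMeasurable G (stationaryMeasure V lam)) :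
    AEStronglyMeasurable G ((stationaryMeasure V 0).tilted fun u => lam * sumOn A u) ∧
    (Integrable G (stationaryMeasure V lam) →
      Integrable G ((stationaryMeasure V 0).tilted fun u => lam * sumOn A u)) ∧
    ∫ u, G u ∂(stationaryMeasure V lam)
      = ∫ u, G u ∂((stationaryMeasure V 0).tilted fun u => lam * sumOn A u) := by
  have := h.isProbabilityMeasure lam
  obtain ⟨g, rfl⟩ := DependsOn.exists_eq_comp_restrict hG
  have hg : AEStronglyMeasurable g ((stationaryMeasure V lam).map A.restrict) :=
    aestronglyMeasurable_of_comp_restrict hm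
  have hr := (A.measurable_restrict (X := fun _ : ℤ => ℝ))
  have hg' := hg
  rw [← h.map_restrict_tilted] at hg'
  refine ⟨hg'.comp_measurable hr, fun hi => ?_, ?_⟩
  · have : Integrable g ((stationaryMeasure V lam).map A.restrict) :=
      (integrable_map_measure hg hr.aemeasurable).2 hi
    rw [← h.map_restrict_tilted] at this
    exact this.comp_measurable hr
  · rw [← integral_map hr.aemeasurable hg, ← h.map_restrict_tilted,
      integral_map hr.aemeasurable hg']

theorem dependsOn_sumOn (A : Finset ℤ) : DependsOn (sumOn A) (A : Set ℤ) :=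
  fun _ _ hxy => Finset.sum_congr rfl fun i hi => hxy i hi

/-- Mixed moments of a local function and the sum of its coordinates. -/
noncomputable def mixedMoment (V : ℝ → ℝ) (A : Finset ℤ) (F : (ℤ → ℝ) → ℝ) (k : ℕ) (lam : ℝ) : ℝ :=
  ∫ u, F u * sumOn A u ^ k ∂(stationaryMeasure V lam)

theorem mixedMoment_eq (h : Decomposition V φ φ1 φ2 ψ ψ1 ψ2 κ L M) {A : Finset ℤ}
    {F : (ℤ → ℝ) → ℝ} (hF : DependsOn F (A : Set ℤ))
    (hm : ∀ lam, AEStronglyMeasurable F (stationaryMeasure V lam)) (k : ℕ) (lam : ℝ) :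
    mixedMoment V A F k lam
      = (∫ u, F u * sumOn A u ^ k * Real.exp (lam * sumOn A u) ∂(stationaryMeasure V 0))
        / ∫ u, Real.exp (lam * sumOn A u) ∂(stationaryMeasure V 0) := by
  have hd : DependsOn (fun u => F u * sumOn A u ^ k) (A : Set ℤ) := fun x y hxy => by
    simp only [hF hxy, dependsOn_sumOn A hxy]
  rw [mixedMoment, (h.integral_tilted_eq lam hd ((hm lam).mul
    ((measurable_sumOn A).pow_const k).aestronglyMeasurable)).2.2, integral_tilted,
    ← integral_div]
  refine integral_congr_ae (ae_of_all _ fun u => ?_)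
  simp only [smul_eq_mul]; ring

/-- After tilting, the parameter enters only through `exp (lam * sumOn A u)` in a numerator and a
denominator. Integrability of `F` for every parameter provides all exponential moments, so the
quotient rule applies; the denominator contributes the mean of the sum. -/
theorem hasDerivAt_mixedMoment (h : Decomposition V φ φ1 φ2 ψ ψ1 ψ2 κ L M) {A : Finset ℤ}
    {F : (ℤ → ℝ) → ℝ} (hF : DependsOn F (A : Set ℤ))
    (hi : ∀ lam, Integrable F (stationaryMeasure V lam)) (k : ℕ) (lam : ℝ) :
    HasDerivAt (mixedMoment V A F k)
      (mixedMoment V A F (k + 1) lam - A.card * meanSpin V lam * mixedMoment V A F k lam) lam := by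
  have := h.isProbabilityMeasure 0
  have := h.isProbabilityMeasure lam
  have hm := fun lam => (hi lam).aestronglyMeasurable
  have hexp := fun t => (h.mgf_sumOn A t).1
  have hFi : ∀ t : ℝ, Integrable (fun u => F u * Real.exp (t * sumOn A u))
      (stationaryMeasure V 0) := fun t => by
    have := (h.integral_tilted_eq t hF (hm t)).2.1 (hi t)
    rw [integrable_tilted_iff (hexp t)] at this
    simpa [mul_comm] using this
  have d1 := (expMoment (hm 0).aemeasurable hFi k lam).2
  have d0 := (expMoment (μ := stationaryMeasure V 0) (F := fun _ => 1) (X := sumOn A)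
    aemeasurable_const (by simpa using hexp) 0 lam).2
  simp only [pow_zero, mul_one, one_mul, zero_add, pow_one] at d0
  have hpos : 0 < ∫ u, Real.exp (lam * sumOn A u) ∂(stationaryMeasure V 0) := by
    have : IsProbabilityMeasure (stationaryMeasure V 0) := by
      unfold stationaryMeasure; infer_instance
    exact integral_exp_pos (hexp lam)
  have hone := h.mixedMoment_eq (A := A) (F := fun _ => 1) (fun _ _ _ => rfl)
    (fun _ => aestronglyMeasurable_const) 1 lam
  -- The logarithmic derivative of the denominator is the expected sum.
  have hS : mixedMoment V A (fun _ => 1) 1 lam = A.card * meanSpin V lam := by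
    simp only [mixedMoment, one_mul, pow_one]
    have hp := h.polyInt lam
    refine (integral_sumOn (siteMeasure V lam) continuous_id A).trans ?_
    have e := integral_sub_sumLaw hp A.card
    rw [integral_sub ((polyInt_sumLaw hp _).integrable .id continuous_id)
      (integrable_const _)] at e
    simp only [integral_const, probReal_univ, smul_eq_mul, one_mul] at e
    simp only [id]
    rw [sub_eq_zero.1 e]
    rfl
  simp only [one_mul, pow_one] at hone
  rw [funext (h.mixedMoment_eq hF hm k)]
  refine (d1.div d0 hpos.ne').congr_deriv ?_
  rw [← hS, hone, h.mixedMoment_eq hF hm (k + 1) lam]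
  field_simp

/-- The covariance of a local function with the sum of its coordinates. -/
noncomputable def firstCoeff (V : ℝ → ℝ) (A : Finset ℤ) (F : (ℤ → ℝ) → ℝ) (lam : ℝ) : ℝ :=
  mixedMoment V A F 1 lam - A.card * meanSpin V lam * mixedMoment V A F 0 lam

/-- The correlation of a local function with the squared sum of its coordinates. -/
noncomputable def secondCoeff (V : ℝ → ℝ) (A : Finset ℤ) (F : (ℤ → ℝ) → ℝ) (lam : ℝ) : ℝ :=
  mixedMoment V A F 2 lam - 2 * A.card * meanSpin V lam * mixedMoment V A F 1 lam
    + (A.card * meanSpin V lam) ^ 2 * mixedMoment V A F 0 lam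
    - A.card * sigmaSq V lam * mixedMoment V A F 0 lam

theorem hasDerivAt_firstCoeff (h : Decomposition V φ φ1 φ2 ψ ψ1 ψ2 κ L M) {A : Finset ℤ}
    {F : (ℤ → ℝ) → ℝ} (hF : DependsOn F (A : Set ℤ))
    (hi : ∀ lam, Integrable F (stationaryMeasure V lam)) (lam : ℝ) :
    HasDerivAt (firstCoeff V A F) (secondCoeff V A F lam) lam := by
  refine ((h.hasDerivAt_mixedMoment hF hi 1 lam).sub
    (((h.hasDerivAt_meanSpin lam).const_mul (A.card : ℝ)).mul
      (h.hasDerivAt_mixedMoment hF hi 0 lam))).congr_deriv ?_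
  simp only [secondCoeff, zero_add, Nat.reduceAdd]
  ring

theorem contDiff_two_of_hasDerivAt {f f1 f2 : ℝ → ℝ} (h1 : ∀ x, HasDerivAt f (f1 x) x)
    (h2 : ∀ x, HasDerivAt f1 (f2 x) x) (hc : Continuous f2) :
    ContDiff ℝ 2 f ∧ deriv f = f1 ∧ iteratedDeriv 2 f = f2 := by
  have e1 : deriv f = f1 := funext fun x => (h1 x).deriv
  have e2 : deriv f1 = f2 := funext fun x => (h2 x).deriv
  refine ⟨?_, e1, ?_⟩
  · rw [show (2 : WithTop ℕ∞) = 1 + 1 by norm_num, contDiff_succ_iff_deriv, e1]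
    refine ⟨fun x => (h1 x).differentiableAt, by simp, ?_⟩
    rw [contDiff_one_iff_deriv, e2]
    exact ⟨fun x => (h2 x).differentiableAt, hc⟩
  · rw [iteratedDeriv_succ, iteratedDeriv_one, e1, e2]

/-- Smoothness and derivatives of the grand canonical expectation. -/
theorem grandCanonicalExp_derivs (h : Decomposition V φ φ1 φ2 ψ ψ1 ψ2 κ L M) {A : Finset ℤ}
    {F : (ℤ → ℝ) → ℝ} (hF : DependsOn F (A : Set ℤ))
    (hi : ∀ lam, Integrable F (stationaryMeasure V lam)) :
    ContDiff ℝ 2 (grandCanonicalExp V F) ∧ ∀ lam,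
      grandCanonicalExp V F (meanSpin V lam) = ∫ u, F u ∂(stationaryMeasure V lam) ∧
      deriv (grandCanonicalExp V F) (meanSpin V lam) = firstCoeff V A F lam / sigmaSq V lam ∧
      iteratedDeriv 2 (grandCanonicalExp V F) (meanSpin V lam)
        = (secondCoeff V A F lam
            - firstCoeff V A F lam * thirdMoment (siteMeasure V lam) / sigmaSq V lam)
          / sigmaSq V lam ^ 2 := by
  obtain ⟨l1, l2, l3⟩ := h.exists_deriv_legendre
  set Λ := deriv (legendre V) with hΛ
  have hΛc : Continuous Λ := continuous_iff_continuousAt.2 fun r => (l3 r).continuousAt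
  have hmom : ∀ k, Continuous (mixedMoment V A F k) := fun k =>
    continuous_iff_continuousAt.2 fun x => (h.hasDerivAt_mixedMoment hF hi k x).continuousAt
  have c0 := hmom 0
  have c1 := hmom 1
  have c2 := hmom 2
  have cm := h.continuous_meanSpin
  have cs := h.continuous_sigmaSq
  have ct := h.continuous_thirdMoment
  have cf : Continuous (firstCoeff V A F) := by unfold firstCoeff; fun_prop
  have csec : Continuous (secondCoeff V A F) := by unfold secondCoeff; fun_prop
  have e0 : ∀ r, grandCanonicalExp V F r = mixedMoment V A F 0 (Λ r) := fun r => by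
    simp [grandCanonicalExp, mixedMoment, hΛ]
  have hpos := h.sigmaSq_pos
  have hne : ∀ x, sigmaSq V x ≠ 0 := fun x => (hpos x).ne'
  have d1 : ∀ r, HasDerivAt (grandCanonicalExp V F)
      (firstCoeff V A F (Λ r) / sigmaSq V (Λ r)) r := fun r => by
    rw [funext e0]
    refine ((h.hasDerivAt_mixedMoment hF hi 0 (Λ r)).comp r (l3 r)).congr_deriv ?_
    simp only [firstCoeff, zero_add, div_eq_mul_inv]
  have d2 : ∀ r, HasDerivAt (fun r => firstCoeff V A F (Λ r) / sigmaSq V (Λ r))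
      ((secondCoeff V A F (Λ r) - firstCoeff V A F (Λ r) * thirdMoment (siteMeasure V (Λ r))
        / sigmaSq V (Λ r)) / sigmaSq V (Λ r) ^ 2) r := fun r => by
    refine ((((h.hasDerivAt_firstCoeff hF hi (Λ r)).div (h.hasDerivAt_sigmaSq (Λ r))
      (hne _)).comp r (l3 r))).congr_deriv ?_
    have := hne (Λ r)
    field_simp
  have hcont : Continuous fun r => (secondCoeff V A F (Λ r)
      - firstCoeff V A F (Λ r) * thirdMoment (siteMeasure V (Λ r)) / sigmaSq V (Λ r))
      / sigmaSq V (Λ r) ^ 2 := by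
    have ct' := ct.comp hΛc
    simp only [Function.comp_def] at ct'
    refine Continuous.div (by fun_prop (disch := simp [hne])) (by fun_prop)
      fun r => pow_ne_zero 2 (hne _)
  obtain ⟨a, b, c⟩ := contDiff_two_of_hasDerivAt d1 d2 hcont
  refine ⟨a, fun lam => ⟨?_, ?_, ?_⟩⟩
  · rw [e0, l1]; simp [mixedMoment]
  · rw [b]; simp only [l1]
  · rw [c]; simp only [l1]

end Decomposition

/-! ### Duality in L² and conditional expectations -/

/-- A square integrable function is controlled by its pairing with smooth test functions. -/
theorem integral_sq_le_of_smooth {P : Measure ℝ} [IsFiniteMeasure P] {d : ℝ → ℝ}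
    (hd : MemLp d 2 P) {K : ℝ} (hK : 0 ≤ K)
    (H : ∀ g : ℝ → ℝ, ContDiff ℝ (⊤ : ℕ∞) g → HasCompactSupport g →
      |∫ x, d x * g x ∂P| ≤ K * √(∫ x, g x ^ 2 ∂P)) :
    ∫ x, d x ^ 2 ∂P ≤ K ^ 2 := by
  set n := √(∫ x, d x ^ 2 ∂P) with hn
  have hn0 : 0 ≤ n := Real.sqrt_nonneg _
  have hn2 : ∫ x, d x ^ 2 ∂P = n ^ 2 :=
    (Real.sq_sqrt (integral_nonneg fun _ => sq_nonneg _)).symm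
  -- Take `g` within `ε` of `d` in L²: the pairing with `g` is at most `K * (n + ε)`, the rest at
  -- most `n * ε`. Letting `ε` tend to zero gives `n ^ 2 ≤ K * n`.
  have key : ∀ ε : ℝ, 0 < ε → n ^ 2 ≤ K * (n + ε) + n * ε := by
    intro ε hε
    obtain ⟨g, hgc, hgs, hgε⟩ := hd.exist_eLpNorm_sub_le (by norm_num) (by norm_num) hε
    have hg : MemLp g 2 P := hgs.continuous.memLp_of_hasCompactSupport hgc
    have hr : MemLp (d - g) 2 P := hd.sub hg
    have hr2 : ∫ x, (d - g) x ^ 2 ∂P ≤ ε ^ 2 := by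
      have h1 := hr.eLpNorm_eq_integral_rpow_norm (by norm_num) (by norm_num)
      rw [h1, ENNReal.ofReal_le_ofReal_iff hε.le] at hgε
      simp only [ENNReal.toReal_ofNat, Real.norm_eq_abs, Real.rpow_two, sq_abs] at hgε
      rw [show ((2 : ℝ)⁻¹) = 1 / 2 by norm_num, ← Real.sqrt_eq_rpow] at hgε
      exact (Real.sqrt_le_left hε.le).1 hgε
    have hdr : |∫ x, d x * (d - g) x ∂P| ≤ n * ε := by
      refine abs_le_of_sq_le_sq ((sq_integral_mul_le hd hr).trans ?_) (by positivity)
      rw [hn2, mul_pow]; gcongr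
    have id1 : Integrable (fun x => d x * g x) P := hd.integrable_mul hg
    have id2 : Integrable (fun x => d x * (d - g) x) P := hd.integrable_mul hr
    have hsum : n ^ 2 = ∫ x, d x * g x ∂P + ∫ x, d x * (d - g) x ∂P := by
      rw [← hn2, ← integral_add id1 id2]
      refine integral_congr_ae (ae_of_all _ fun x => ?_)
      simp only [Pi.sub_apply]; ring
    have hg2 : √(∫ x, g x ^ 2 ∂P) ≤ n + ε := by
      refine Real.sqrt_le_iff.2 ⟨by positivity, ?_⟩
      have i3 := id2.const_mul 2
      have i4 : Integrable (fun x => d x ^ 2 - 2 * (d x * (d - g) x)) P :=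
        hd.integrable_sq.sub i3
      have : ∫ x, g x ^ 2 ∂P = ∫ x, d x ^ 2 ∂P - 2 * ∫ x, d x * (d - g) x ∂P
          + ∫ x, (d - g) x ^ 2 ∂P := by
        rw [← integral_const_mul, ← integral_sub hd.integrable_sq i3,
          ← integral_add i4 hr.integrable_sq]
        refine integral_congr_ae (ae_of_all _ fun x => ?_)
        simp only [Pi.sub_apply]; ring
      rw [this, hn2]
      nlinarith [(abs_le.1 hdr).1]
    rw [hsum]
    exact add_le_add ((le_abs_self _).trans ((H g hgs hgc).trans (by gcongr)))
      ((le_abs_self _).trans hdr)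
  have : n ^ 2 ≤ K * n := by
    refine le_of_forall_pos_le_add fun δ hδ => ?_
    have h := key (δ / (K + n + 1)) (by positivity)
    have e : (K + n) * (δ / (K + n + 1)) ≤ δ := by
      rw [mul_div_assoc', div_le_iff₀ (by positivity)]
      nlinarith
    nlinarith
  have hnK : n ≤ K := by nlinarith
  rw [hn2]
  gcongr

theorem test_of_hasCompactSupport {g : ℝ → ℝ} (hs : ContDiff ℝ (⊤ : ℕ∞) g)
    (hc : HasCompactSupport g) : Test g (deriv g) := by
  have hb : ∀ f : ℝ → ℝ, Continuous f → HasCompactSupport f → PolyBdd f := fun f h1 h2 => by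
    obtain ⟨C, hC⟩ := h2.exists_bound_of_continuous h1
    exact PolyBdd.of_le (C := C) (n := 0) fun x => by simpa using hC x
  have hd : Continuous (deriv g) := hs.continuous_deriv (by simp)
  exact ⟨fun x => (hs.differentiable (by simp) x).hasDerivAt, hd, hb _ hs.continuous hc,
    hb _ hd hc.deriv⟩

theorem contDiff_deriv_of_top {g : ℝ → ℝ} (hs : ContDiff ℝ (⊤ : ℕ∞) g) :
    ContDiff ℝ (⊤ : ℕ∞) (deriv g) := by
  exact (contDiff_infty_iff_deriv.1 hs).2

section conditional
variable {μ : Measure (ℤ → ℝ)} [IsFiniteMeasure μ] {X : (ℤ → ℝ) → ℝ} {F : (ℤ → ℝ) → ℝ}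

theorem memLp_integral_condDistrib (hX : Measurable X) (hF : MemLp F 2 μ) :
    MemLp (fun a => ∫ y, F y ∂condDistrib id X μ (X a)) 2 μ :=
  (memLp_congr_ae (condExp_ae_eq_integral_condDistrib_id hX
    (hF.integrable (by norm_num)))).1 (hF.condExp (by norm_num))

theorem memLp_map_integral_condDistrib (hX : Measurable X) (hF : MemLp F 2 μ) :
    MemLp (fun r => ∫ y, F y ∂condDistrib id X μ r) 2 (μ.map X) := by
  refine (memLp_map_measure_iff ?_ hX.aemeasurable).2 (memLp_integral_condDistrib hX hF)
  exact AEStronglyMeasurable.integral_condDistrib_map aemeasurable_id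
    (hF.1.comp_snd_map_prodMk X)

/-- The tower property: a function of `X` can be moved inside the conditional expectation. This is
what removes the conditioning from the dual problem. -/
theorem integral_condDistrib_mul (hX : Measurable X) (hF : MemLp F 2 μ) {g : ℝ → ℝ}
    (hg : Measurable g) (hg2 : MemLp (fun u => g (X u)) 2 μ) :
    ∫ a, (∫ y, F y ∂condDistrib id X μ (X a)) * g (X a) ∂μ = ∫ a, F a * g (X a) ∂μ := by
  have hFi := hF.integrable (q := 2) (by norm_num)
  have hm : MeasurableSpace.comap X inferInstance ≤ MeasurableSpace.pi := hX.comap_le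
  have h1 := condExp_ae_eq_integral_condDistrib_id hX hFi
  have hgX : AEStronglyMeasurable[MeasurableSpace.comap X inferInstance] (fun u => g (X u)) μ :=
    (hg.comp (comap_measurable X)).stronglyMeasurable.aestronglyMeasurable
  have h2 := condExp_mul_of_aestronglyMeasurable_right hgX (hF.integrable_mul hg2) hFi
  have h3 : ∫ a, F a * g (X a) ∂μ
      = ∫ a, (μ[F * (fun u => g (X u)) | MeasurableSpace.comap X inferInstance]) a ∂μ :=
    (integral_condExp hm).symm
  rw [h3]
  refine integral_congr_ae ?_
  filter_upwards [h1, h2] with a ha hb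
  rw [hb, ← ha, Pi.mul_apply]

end conditional

namespace Decomposition
variable {V φ φ1 φ2 ψ ψ1 ψ2 : ℝ → ℝ} {κ L M : ℝ}

/-- The second factor is centred, so subtracting the mean of `F` changes nothing; this matches the
derivative in the parameter with `b1` of the dual estimate. -/
theorem firstCoeff_eq (h : Decomposition V φ φ1 φ2 ψ ψ1 ψ2 κ L M) {A : Finset ℤ} {lam : ℝ}
    {F : (ℤ → ℝ) → ℝ} (hF : MemLp F 2 (stationaryMeasure V lam)) :
    firstCoeff V A F lam = ∫ u, (F u - ∫ v, F v ∂(stationaryMeasure V lam))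
      * (sumOn A u - A.card * mean1 (siteMeasure V lam)) ∂(stationaryMeasure V lam) := by
  have := h.isProbabilityMeasure lam
  have hp := h.polyInt lam
  set ν := siteMeasure V lam with hν
  have hs : meanSpin V lam = mean1 ν := rfl
  set T : (ℤ → ℝ) → ℝ := fun u => sumOn A u - A.card * mean1 ν with hT
  have ht := Test.id.sub (.const (A.card * mean1 ν))
  have hT2 : MemLp T 2 (stationaryMeasure V lam) := memLp_sumOn ν hp ht.cont ht.3 A
  have hT0 : ∫ u, T u ∂(stationaryMeasure V lam) = 0 :=
    (integral_sumOn ν ht.cont A).trans (integral_sub_sumLaw hp _)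
  have iF := hF.integrable (q := 2) (by norm_num)
  have iFS : Integrable (fun u => F u * sumOn A u) (stationaryMeasure V lam) :=
    hF.integrable_mul (memLp_sumOn ν hp continuous_id PolyBdd.id A)
  have iFT : Integrable (fun u => F u * T u) (stationaryMeasure V lam) := hF.integrable_mul hT2
  have iT := (hT2.integrable (q := 2) (by norm_num)).const_mul
    (∫ v, F v ∂(stationaryMeasure V lam))
  simp_rw [sub_mul]
  rw [integral_sub iFT iT, integral_const_mul, hT0, mul_zero, sub_zero]
  simp only [firstCoeff, mixedMoment, pow_one, pow_zero, mul_one, hs]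
  rw [← integral_const_mul, ← integral_sub iFS (iF.const_mul _)]
  refine integral_congr_ae (ae_of_all _ fun u => ?_)
  simp only [hT]; ring

theorem secondCoeff_eq (h : Decomposition V φ φ1 φ2 ψ ψ1 ψ2 κ L M) {A : Finset ℤ} {lam : ℝ}
    {F : (ℤ → ℝ) → ℝ} (hF : MemLp F 2 (stationaryMeasure V lam)) :
    secondCoeff V A F lam = ∫ u, (F u - ∫ v, F v ∂(stationaryMeasure V lam))
      * ((sumOn A u - A.card * mean1 (siteMeasure V lam)) ^ 2
        - A.card * var1 (siteMeasure V lam)) ∂(stationaryMeasure V lam) := by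
  have := h.isProbabilityMeasure lam
  have hp := h.polyInt lam
  set ν := siteMeasure V lam with hν
  have hs : meanSpin V lam = mean1 ν := rfl
  have hv : sigmaSq V lam = var1 ν := rfl
  set T : (ℤ → ℝ) → ℝ := fun u => (sumOn A u - A.card * mean1 ν) ^ 2 - A.card * var1 ν with hT
  have ht := (Test.id.sub (.const (A.card * mean1 ν))).sq
  have ht' := ht.sub (.const (A.card * var1 ν))
  have hT2 : MemLp T 2 (stationaryMeasure V lam) := memLp_sumOn ν hp ht'.cont ht'.3 A
  have hT0 : ∫ u, T u ∂(stationaryMeasure V lam) = 0 := by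
    refine (integral_sumOn ν ht'.cont A).trans ?_
    rw [integral_sub ((polyInt_sumLaw hp _).integrable ht.3 ht.cont) (integrable_const _),
      integral_sub_sq_sumLaw hp]
    simp
  have iF := hF.integrable (q := 2) (by norm_num)
  have iFS : Integrable (fun u => F u * sumOn A u) (stationaryMeasure V lam) :=
    hF.integrable_mul (memLp_sumOn ν hp continuous_id PolyBdd.id A)
  have iFS2 : Integrable (fun u => F u * sumOn A u ^ 2) (stationaryMeasure V lam) :=
    hF.integrable_mul (memLp_sumOn ν hp (continuous_id.pow 2) (PolyBdd.id.pow 2) A)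
  have iFT : Integrable (fun u => F u * T u) (stationaryMeasure V lam) := hF.integrable_mul hT2
  have iT := (hT2.integrable (q := 2) (by norm_num)).const_mul
    (∫ v, F v ∂(stationaryMeasure V lam))
  simp_rw [sub_mul]
  rw [integral_sub iFT iT, integral_const_mul, hT0, mul_zero, sub_zero]
  simp only [secondCoeff, mixedMoment, pow_one, pow_zero, mul_one, hs, hv]
  have j1 := iFS.const_mul (2 * A.card * mean1 ν)
  have j2 := iF.const_mul ((A.card * mean1 ν) ^ 2)
  have j3 := iF.const_mul (A.card * var1 ν)
  have j4 : Integrable (fun u => F u * sumOn A u ^ 2 - 2 * A.card * mean1 ν * (F u * sumOn A u))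
      (stationaryMeasure V lam) := iFS2.sub j1
  have j5 : Integrable (fun u => F u * sumOn A u ^ 2
      - 2 * A.card * mean1 ν * (F u * sumOn A u) + (A.card * mean1 ν) ^ 2 * F u)
      (stationaryMeasure V lam) := j4.add j2
  rw [← integral_const_mul, ← integral_const_mul, ← integral_const_mul, ← integral_sub iFS2 j1,
    ← integral_add j4 j2, ← integral_sub j5 j3]
  refine integral_congr_ae (ae_of_all _ fun u => ?_)
  simp only [hT]; ring

end Decomposition

/-! ### Assembling the estimate -/

/-- The integers `0, …, n - 1`. -/
def interval (n : ℕ) : Finset ℤ := (Finset.range n).map Nat.castEmbedding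

theorem card_interval (n : ℕ) : (interval n).card = n := by simp [interval]

theorem coe_interval (n : ℕ) : (interval n : Set ℤ) = {k : ℤ | 0 ≤ k ∧ k < (n : ℤ)} := by
  ext k
  simp only [interval, Finset.coe_map, Finset.coe_range, Set.mem_image, Set.mem_Iio,
    Nat.castEmbedding_apply, Set.mem_ofPred_eq]
  constructor
  · rintro ⟨m, hm, rfl⟩
    omega
  · rintro ⟨h0, h1⟩
    exact ⟨k.toNat, by omega, by omega⟩

theorem interval_subset {m n : ℕ} (h : m ≤ n) : interval m ⊆ interval n :=
  Finset.map_subset_map.2 (Finset.range_subset_range.2 h)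

theorem spatialAverage_eq (N : ℕ) : spatialAverage N = fun u => sumOn (interval N) u / N := by
  ext u
  simp [spatialAverage, sumOn, interval]

theorem measurable_spatialAverage (N : ℕ) : Measurable (spatialAverage N) := by
  rw [spatialAverage_eq]
  exact (measurable_sumOn _).div_const _

end GinzburgLandau

namespace GinzburgLandau
namespace Decomposition
variable {V φ φ1 φ2 ψ ψ1 ψ2 : ℝ → ℝ} {κ L M : ℝ}

/-- The `L²` form of the second order equivalence of ensembles at a fixed parameter. -/
theorem integral_sq_canonicalExp_sub_le (h : Decomposition V φ φ1 φ2 ψ ψ1 ψ2 κ L M) {B lam : ℝ}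
    (hR : Regular (siteMeasure V lam) B) {N ℓ : ℕ} (hℓ : 1 ≤ ℓ) (hN : 2 * ℓ ≤ N)
    {F : (ℤ → ℝ) → ℝ} (hF : DependsOn F (interval ℓ : Set ℤ))
    (hF2 : MemLp F 2 (stationaryMeasure V lam)) {c1 c2 : ℝ}
    (hc1 : c1 = firstCoeff V (interval ℓ) F lam / sigmaSq V lam)
    (hc2 : c2 = (secondCoeff V (interval ℓ) F lam
      - firstCoeff V (interval ℓ) F lam * thirdMoment (siteMeasure V lam) / sigmaSq V lam)
        / sigmaSq V lam ^ 2) :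
    MemLp (fun u => canonicalExp V lam F N (spatialAverage N u)
      - ∫ v, F v ∂(stationaryMeasure V lam) - c1 * (spatialAverage N u - meanSpin V lam)
      - 1 / 2 * c2 * ((spatialAverage N u - meanSpin V lam) ^ 2 - sigmaSq V lam / N)) 2
      (stationaryMeasure V lam) ∧
    ∫ u, (canonicalExp V lam F N (spatialAverage N u)
      - ∫ v, F v ∂(stationaryMeasure V lam) - c1 * (spatialAverage N u - meanSpin V lam)
      - 1 / 2 * c2 * ((spatialAverage N u - meanSpin V lam) ^ 2 - sigmaSq V lam / N)) ^ 2
      ∂(stationaryMeasure V lam)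
      ≤ (1300 * B ^ 11) ^ 2 * ((ℓ : ℝ) / N) ^ 3 * variance F (stationaryMeasure V lam) := by
  have := h.isProbabilityMeasure lam
  have hprob : IsProbabilityMeasure (stationaryMeasure V lam) := by
    unfold stationaryMeasure; infer_instance
  set ν := siteMeasure V lam with hν
  set μ := stationaryMeasure V lam with hμ
  have hs : meanSpin V lam = mean1 ν := rfl
  have hv : sigmaSq V lam = var1 ν := rfl
  have hB := hR.one_le
  have hN0 : (N : ℝ) ≠ 0 := by
    have : N ≠ 0 := by omega
    exact_mod_cast this
  set X := spatialAverage N with hX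
  have hXm : Measurable X := measurable_spatialAverage N
  have hXe : ∀ u, X u = sumOn (interval N) u / N := fun u => by rw [hX, spatialAverage_eq]
  set m := ∫ v, F v ∂μ with hm
  set p : ℝ → ℝ := fun r => r - meanSpin V lam with hp
  set q : ℝ → ℝ := fun r => (r - meanSpin V lam) ^ 2 - sigmaSq V lam / N with hq
  have hpc : Continuous p := by fun_prop
  have hqc : Continuous q := by fun_prop
  have tp : Test (fun s : ℝ => p (s / N)) fun _ => 1 / N :=
    ((Test.id.const_mul (1 / N : ℝ)).sub (.const (meanSpin V lam))).congr
      (fun s => by simp only [hp]; ring) (fun s => by ring)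
  have tq := (tp.sq.sub (.const (sigmaSq V lam / N)))
  have p2 : MemLp (fun u => p (X u)) 2 μ := by
    simp only [hXe]
    exact memLp_sumOn ν hR.polyInt tp.cont tp.3 _
  have q2 : MemLp (fun u => q (X u)) 2 μ := by
    simp only [hXe]
    exact memLp_sumOn ν hR.polyInt tq.cont tq.3 _
  set d : ℝ → ℝ := fun r => canonicalExp V lam F N r - m - c1 * p r - 1 / 2 * c2 * q r with hd
  have hc2L : MemLp (fun u => canonicalExp V lam F N (X u)) 2 μ :=
    memLp_integral_condDistrib hXm hF2
  have dX : MemLp (fun u => d (X u)) 2 μ :=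
    ((hc2L.sub (memLp_const m)).sub (p2.const_mul c1)).sub (q2.const_mul (1 / 2 * c2))
  have hdm : AEStronglyMeasurable d (μ.map X) :=
    (((memLp_map_integral_condDistrib hXm hF2).1.sub aestronglyMeasurable_const).sub
      (hpc.aestronglyMeasurable.const_mul c1)).sub
      (hqc.aestronglyMeasurable.const_mul (1 / 2 * c2))
  have hdP : MemLp d 2 (μ.map X) := (memLp_map_measure_iff hdm hXm.aemeasurable).2 dX
  refine ⟨dX, ?_⟩
  change ∫ u, d (X u) ^ 2 ∂μ ≤ _
  set θ : (ℤ → ℝ) → ℝ := fun u => F u - m with hθ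
  have hθ2 : MemLp θ 2 μ := hF2.sub (memLp_const m)
  have hvar : variance F μ = ∫ u, θ u ^ 2 ∂μ := variance_eq_integral hF2.1.aemeasurable
  have hθ0 : ∫ u, θ u ∂μ = 0 := by
    rw [integral_sub (hF2.integrable (by norm_num)) (integrable_const _)]; simp [hm]
  have hθd : AEDependsOn ν (interval ℓ) θ :=
    aeDependsOn_of_dependsOn (fun x y hxy => by simp only [hθ, hF hxy]) hθ2.1
  set K := 1300 * B ^ 11 * √(((ℓ : ℝ) / N) ^ 3) * √(variance F μ) with hK
  have hK2 : K ^ 2 = (1300 * B ^ 11) ^ 2 * ((ℓ : ℝ) / N) ^ 3 * variance F μ := by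
    rw [hK, mul_pow, mul_pow, Real.sq_sqrt (by positivity), Real.sq_sqrt (variance_nonneg _ _)]
  have hK0 : 0 ≤ K := by positivity
  rw [← hK2, ← integral_map (f := fun r => d r ^ 2) hXm.aemeasurable (hdm.pow 2)]
  have hP : IsProbabilityMeasure (μ.map X) := Measure.isProbabilityMeasure_map hXm.aemeasurable
  refine integral_sq_le_of_smooth hdP hK0 fun g hgs hgc => ?_
  have hgm := hgs.continuous.measurable
  have hg2 : MemLp (fun u => g (X u)) 2 μ :=
    (hgs.continuous.memLp_of_hasCompactSupport (μ := μ.map X) (p := 2) hgc).comp_measurePreserving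
      ⟨hXm, rfl⟩
  -- Passage from the average to the sum. The rescaling makes the linear and quadratic pairings gain
  -- factors `N` and `N ^ 2`, which cancel the denominators in `duality_bound`.
  set g0 : ℝ → ℝ := fun s => g ((N : ℝ)⁻¹ * s) with hg0
  have hs0 : ContDiff ℝ (⊤ : ℕ∞) g0 := hgs.comp (by fun_prop)
  have hcs0 : HasCompactSupport g0 := by
    have := hgc.comp_homeomorph (Homeomorph.mulLeft₀ (N : ℝ)⁻¹ (inv_ne_zero hN0))
    exact this
  have hgX : ∀ u, g0 (sumOn (interval N) u) = g (X u) := fun u => by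
    simp only [hg0, hXe]; congr 1; field_simp
  have h1s := contDiff_deriv_of_top hs0
  have h2s := contDiff_deriv_of_top h1s
  have key := hR.duality_bound (test_of_hasCompactSupport hs0 hcs0)
    (test_of_hasCompactSupport h1s hcs0.deriv) (test_of_hasCompactSupport h2s hcs0.deriv.deriv)
    (A := interval ℓ) (J := interval N) (interval_subset (by omega))
    (by rwa [card_interval]) (by simpa only [card_interval] using hN) hθd hθ2 hθ0
    (V := √(variance F μ)) (G := √(∫ r, g r ^ 2 ∂(μ.map X))) (Real.sqrt_nonneg _)
    (Real.sqrt_nonneg _)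
    (by rw [Real.sq_sqrt (variance_nonneg _ _), hvar]; exact le_rfl)
    (by
      rw [Real.sq_sqrt (integral_nonneg fun _ => sq_nonneg _),
        ← integral_sumOn ν (g := fun x => g0 x ^ 2) (hs0.continuous.pow 2),
        integral_map hXm.aemeasurable (hgm.pow_const 2).aestronglyMeasurable]
      simp only [hgX]
      exact le_rfl)
    (h.firstCoeff_eq hF2) (h.secondCoeff_eq hF2)
  rw [card_interval, card_interval] at key
  refine le_trans (le_of_eq ?_) key
  congr 1
  rw [integral_map (f := fun x => d x * g x) hXm.aemeasurable (hdm.mul hgm.aestronglyMeasurable)]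
  have i1 : Integrable (fun u => F u * g (X u)) μ := hF2.integrable_mul hg2
  have i1' : Integrable (fun u => canonicalExp V lam F N (X u) * g (X u)) μ :=
    hc2L.integrable_mul hg2
  have i2 : Integrable (fun u => m * g (X u)) μ :=
    (hg2.integrable (by norm_num)).const_mul m
  have i3 : Integrable (fun u => p (X u) * g (X u)) μ := p2.integrable_mul hg2
  have i4 : Integrable (fun u => q (X u) * g (X u)) μ := q2.integrable_mul hg2
  have i5 : Integrable (fun u => canonicalExp V lam F N (X u) * g (X u) - m * g (X u)) μ :=
    i1'.sub i2
  have i6 : Integrable (fun u => canonicalExp V lam F N (X u) * g (X u) - m * g (X u)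
      - c1 * (p (X u) * g (X u))) μ := i5.sub (i3.const_mul c1)
  have e0 : ∫ u, d (X u) * g (X u) ∂μ = ∫ u, θ u * g (X u) ∂μ
      - c1 * ∫ u, p (X u) * g (X u) ∂μ - 1 / 2 * c2 * ∫ u, q (X u) * g (X u) ∂μ := by
    have ec : ∫ u, canonicalExp V lam F N (X u) * g (X u) ∂μ = ∫ u, F u * g (X u) ∂μ :=
      integral_condDistrib_mul hXm hF2 hgm hg2
    simp only [hd, hθ, sub_mul, mul_assoc]
    simp only [← mul_assoc (1 / 2 : ℝ) c2]
    rw [integral_sub i6 (i4.const_mul _), integral_sub i5 (i3.const_mul _), integral_sub i1' i2,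
      integral_sub i1 i2, ec, integral_const_mul, integral_const_mul,
      integral_const_mul]
  have e1 : ∫ u, (sumOn (interval N) u - N * mean1 ν) * g0 (sumOn (interval N) u)
      ∂(Measure.infinitePi fun _ : ℤ => ν) = N * ∫ u, p (X u) * g (X u) ∂μ := by
    rw [← integral_const_mul]
    refine integral_congr_ae (ae_of_all _ fun u => ?_)
    simp only [hgX, hp, hXe, hs]
    field_simp
  have e2 : ∫ u, ((sumOn (interval N) u - N * mean1 ν) ^ 2 - N * var1 ν)
      * g0 (sumOn (interval N) u) ∂(Measure.infinitePi fun _ : ℤ => ν)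
      = N ^ 2 * ∫ u, q (X u) * g (X u) ∂μ := by
    rw [← integral_const_mul]
    refine integral_congr_ae (ae_of_all _ fun u => ?_)
    simp only [hgX, hq, hXe, hs, hv]
    field_simp
  have e3 : ∫ u, θ u * g0 (sumOn (interval N) u) ∂(Measure.infinitePi fun _ : ℤ => ν)
      = ∫ u, θ u * g (X u) ∂μ := by
    simp only [hgX]
    rfl
  have hv0 : var1 ν ≠ 0 := hR.var1_pos.ne'
  rw [e0, e1, e2, e3, hc1, hc2, hv]
  generalize ∫ u, θ u * g (X u) ∂μ = I0
  generalize ∫ u, p (X u) * g (X u) ∂μ = I1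
  generalize ∫ u, q (X u) * g (X u) ∂μ = I2
  field_simp

end Decomposition

theorem canonicalExp_const (V : ℝ → ℝ) (lam c : ℝ) (N : ℕ) (r : ℝ) :
    canonicalExp V lam (fun _ => c) N r = c := by
  simp [canonicalExp]

end GinzburgLandau

theorem mainTheorem5 (V : ℝ → ℝ) (hV : GinzburgLandau.AssumptionV V) :
    ∃ C : ℝ, 0 < C ∧
      ∀ (lam0 : ℝ) (N ℓ : ℕ), 1 ≤ N → 2 * ℓ ≤ N →
      ∀ F : (ℤ → ℝ) → ℝ,
        DependsOn F {k : ℤ | 0 ≤ k ∧ k < (ℓ : ℤ)} →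
        (∀ lam : ℝ, MemLp F 2 (GinzburgLandau.stationaryMeasure V lam)) →
        ContDiff ℝ 2 (GinzburgLandau.grandCanonicalExp V F) ∧
        ∫⁻ u : ℤ → ℝ, ENNReal.ofReal
            ((GinzburgLandau.canonicalExp V lam0 F N (GinzburgLandau.spatialAverage N u)
              - GinzburgLandau.grandCanonicalExp V F (GinzburgLandau.meanSpin V lam0)
              - deriv (GinzburgLandau.grandCanonicalExp V F) (GinzburgLandau.meanSpin V lam0)
                * (GinzburgLandau.spatialAverage N u - GinzburgLandau.meanSpin V lam0)
              - (1 / 2 : ℝ)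
                * iteratedDeriv 2 (GinzburgLandau.grandCanonicalExp V F)
                    (GinzburgLandau.meanSpin V lam0)
                * ((GinzburgLandau.spatialAverage N u - GinzburgLandau.meanSpin V lam0) ^ 2
                    - GinzburgLandau.sigmaSq V lam0 / (N : ℝ))) ^ 2)
            ∂(GinzburgLandau.stationaryMeasure V lam0)
          ≤ ENNReal.ofReal (C * ((ℓ : ℝ) / (N : ℝ)) ^ 3)
            * ⨆ lam : ℝ, evariance F (GinzburgLandau.stationaryMeasure V lam) := by
  obtain ⟨φ, φ1, φ2, ψ, ψ1, ψ2, κ, L, M, h⟩ := hV.exists_decomposition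
  obtain ⟨B, hB⟩ := h.exists_regular
  have hB1 := (hB 0).one_le
  refine ⟨(1300 * B ^ 11) ^ 2, by positivity, fun lam0 N ℓ hN hℓN F hF hF2 => ?_⟩
  have hprob : ∀ lam, IsProbabilityMeasure (GinzburgLandau.stationaryMeasure V lam) := fun lam => by
    have := h.isProbabilityMeasure lam
    unfold GinzburgLandau.stationaryMeasure; infer_instance
  rw [← GinzburgLandau.coe_interval] at hF
  obtain ⟨hsm, hder⟩ := h.grandCanonicalExp_derivs hF
    fun lam => (hF2 lam).integrable (by norm_num)
  refine ⟨hsm, ?_⟩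
  -- For an empty block `F` is constant and the error vanishes; this case is apart because the dual
  -- estimate requires a nonempty block.
  rcases Nat.eq_zero_or_pos ℓ with rfl | hℓ
  · have hc : F = fun _ => F 0 := funext fun u => hF fun i hi => by
      simp [GinzburgLandau.interval] at hi
    have hg : GinzburgLandau.grandCanonicalExp V F = fun _ => F 0 := by
      funext r
      rw [hc]
      simp [GinzburgLandau.grandCanonicalExp]
    rw [hg, hc]
    simp [GinzburgLandau.canonicalExp_const, iteratedDeriv_const]
  · obtain ⟨e0, e1, e2⟩ := hder lam0
    obtain ⟨hL, hle⟩ := h.integral_sq_canonicalExp_sub_le (hB lam0) hℓ hℓN hF (hF2 lam0) e1 e2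
    rw [e0, ← ofReal_integral_eq_lintegral_ofReal hL.integrable_sq
      (ae_of_all _ fun _ => sq_nonneg _)]
    refine (ENNReal.ofReal_le_ofReal hle).trans ?_
    -- The estimate involves only the variance at `lam0`; the supremum enters by monotonicity alone.
    rw [ENNReal.ofReal_mul (by positivity), ofReal_variance (hF2 lam0)]
    gcongr
    exact le_iSup (fun lam => evariance F (GinzburgLandau.stationaryMeasure V lam)) lam0
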